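/- **Setting.** Let $f\in C^3([0,\infty))$ with $f(1)=0$, $f'(1)<0$, put $c_s=\sqrt{-2f'(1)}$ and $F(r)=\int_r^1 f(\rho)\,d\rho$, and assume: $\frac{c_s^2}{4}(1-\rho)^2\le F(\rho)$ for all $\rho\ge 0$; there are $M\ge0$, $q\ge2$ with $F(\rho)\le M|1-\rho|^q$ for all $\rho\ge2$; and $f''(1)+3f'(1)\ne0$. Let $X=H^1(\mathbb R)\times L^2(\mathbb R)$ with $\|(\eta,v)\|_X^2=\|\eta\|_{H^1}^2+\|v\|_{L^2}^2$, let $NX=\{(\eta,v)\in X:\max\eta<1\}$, and $$E(\eta,v)=\frac18\int_{\mathbb R}\frac{(\eta')^2}{1-\eta}+\frac12\int_{\mathbb R}(1-\eta)v^2+\frac12\int_{\mathbb R}F(1-\eta),\qquad p(\eta,v)=\frac12\int_{\mathbb R}\eta v .$$ A soliton of speed $c$ is a smooth ($\eta\in C^3$, $v\in C^2$) non-constant $(\eta,v)\in NX$ solving $$\frac c2\eta=v(1-\eta),\qquad cv=f(1-\eta)-v^2-\frac{\eta''}{2(1-\eta)}-\frac{(\eta')^2}{4(1-\eta)^2}.$$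 **Statement.** There are $c_0\in(0,c_s)$, $a_d>0$, $K_d>0$ such that, for every $c\in(c_0,c_s)$, there is an even soliton $Q_c=(\eta_c,v_c)$ of speed $c$, it is the only soliton of speed $c$ up to translations, for all $x\in\mathbb R$ $$\sum_{k_1=0}^{3}\sum_{k_2=0}^{2}\frac{|\partial_x^{k_1}\eta_c(x)|+c^{1+2k_2}|\partial_x^{k_2}v_c(x)|}{c_s^2-c^2}\le K_d\,e^{-a_d\sqrt{c_s^2-c^2}\,|x|},$$ and the following expansion holds for every $N\ge1$. For $\mathfrak c=(c_1,\dots,c_N)$ with $c_0<c_1<\dots<c_N<c_s$, for $L>0$ and for $\mathfrak a=(a_1,\dots,a_N)\in\mathbb R^N$ with $a_{k+1}-a_k>L$ for all $k\in\{1,\dots,N-1\}$, write $Q_{c,a}=Q_c(\cdot-a)$, $R_{\mathfrak c,\mathfrak a}=(\eta_{\mathfrak c,\mathfrak a},v_{\mathfrak c,\mathfrak a})=\sum_{k=1}^N Q_{c_k,a_k}$, $\nu_{\mathfrak c}=\min_k\sqrt{c_s^2-c_k^2}$, $\Lambda(L,\mathfrak c)=\frac1{\nu_{\mathfrak c}}+L$.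 (i) There are $L_0>0$ and $\beta_0<1$, depending only on $N$ (and on $f$ and the branch $c\mapsto Q_c$), such that $\eta_{\mathfrak c,\mathfrak a}\le\beta_0$ on $\mathbb R$ for all such $\mathfrak c,\mathfrak a,L$ with $L\ge L_0$. (ii) For every $\beta<1$ there is $C>0$, depending only on $N$ and $\beta$ (and on $f$ and the branch), such that the following holds for all such $\mathfrak c,\mathfrak a$ and all $L>0$ for which $\eta_{\mathfrak c,\mathfrak a}\le\beta$ on $\mathbb R$. Let $Q=R_{\mathfrak c,\mathfrak a}+\varepsilon\in NX$ satisfy $\langle\varepsilon,\partial_xQ_{c_k,a_k}\rangle_{L^2\times L^2}=\nabla p(Q_{c_k,a_k}).\varepsilon=0$ for all $k\in\{1,\dots,N\}$, and let $\tau>0$ with $2\tau<\nu_{\mathfrak c}$. Then $$\Big|E(Q)-\sum_{k=1}^N E(Q_{c_k})-\frac12\Big(\sum_{k=1}^N\nabla^2E(Q_{c_k})(\varepsilon_k,\varepsilon_k)+\sum_{k=0}^N\nabla^2E(0)(\varepsilon_{k,k+1},\varepsilon_{k,k+1})\Big)-\mathcal R_{\mathfrak c,\mathfrak a}(\varepsilon)\Big|$$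 $$\le C\Big(\Lambda(L,\mathfrak c)e^{-a_d\nu_{\mathfrak c}L}+\|\varepsilon\|_X\Lambda(L,\mathfrak c)^{1/2}e^{-a_d\nu_{\mathfrak c}L}+\tau\|\varepsilon\|_X^2+\|\varepsilon\|_X^2e^{-a_d\tau L/2}\Big),$$ where $$\mathcal R_{\mathfrak c,\mathfrak a}(\varepsilon)=\int_0^1\frac{(1-t)^2}{2}\nabla^3E(R_{\mathfrak c,\mathfrak a}+t\varepsilon)(\varepsilon,\varepsilon,\varepsilon)\,dt,$$ $\varepsilon_k=\varepsilon(\cdot+a_k)\sqrt{\Phi_k(\cdot+a_k)}$, $\varepsilon_{k,k+1}=\varepsilon\sqrt{\Phi_{k,k+1}}$, and, with $T_k^{\pm}(x)=\tanh\big(\tau(x-a_k\pm\frac L4)\big)$ for $1\le k\le N$, $$\Phi_k=\tfrac12(T_k^+-T_k^-),\quad \Phi_{0,1}=\tfrac12(1-T_1^+),\quad \Phi_{k,k+1}=\tfrac12(T_k^--T_{k+1}^+)\ (1\le k\le N-1),\quad \Phi_{N,N+1}=\tfrac12(1+T_N^-).$$ -/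

import Mathlib

noncomputable section

open MeasureTheory

namespace NLSHydro

/-- A pair of real functions `(η, v)` on the line. -/
abbrev Hydro : Type := (ℝ → ℝ) × (ℝ → ℝ)

/-! ### Functional setting -/

/-- `u` is (the continuous representative of) an element of the Sobolev space `H¹(ℝ)`: `u ∈ L²` and
`u` is a primitive of a function `g ∈ L²`. Such a `u` is almost everywhere differentiable and its weak
derivative `g` is almost everywhere equal to `deriv u`. -/
def MemH1 (u : ℝ → ℝ) : Prop :=
  MemLp u 2 volume ∧
    ∃ g : ℝ → ℝ, MemLp g 2 volume ∧ ∀ x y : ℝ, u y - u x = ∫ t in x..y, g t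

/-- The energy space `X = H¹(ℝ) × L²(ℝ)`. -/
def XSpace : Set Hydro := {P | MemH1 P.1 ∧ MemLp P.2 2 volume}

/-- The non-vanishing subset `NX = {(η, v) ∈ X : max η < 1}`. As `η` is continuous and tends to `0` at
infinity, this is the pointwise condition `η < 1`. -/
def NXSpace : Set Hydro := {P | P ∈ XSpace ∧ ∀ x, P.1 x < 1}

/-- The norm of `X = H¹ × L²`. -/
def normX (P : Hydro) : ℝ :=
  Real.sqrt ((∫ x, P.1 x ^ 2) + (∫ x, deriv P.1 x ^ 2) + ∫ x, P.2 x ^ 2)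

/-- The scalar product of `L² × L²`. -/
def innerL2 (P R : Hydro) : ℝ := (∫ x, P.1 x * R.1 x) + ∫ x, P.2 x * R.2 x

/-- `∂ₓ(η, v)`. -/
def dx (P : Hydro) : Hydro := (deriv P.1, deriv P.2)

/-- `(η, v)` translated by `a`, i.e. `x ↦ (η (x - a), v (x - a))`. -/
def translate (a : ℝ) (P : Hydro) : Hydro := (fun x => P.1 (x - a), fun x => P.2 (x - a))

/-! ### Nonlinearity, energy and momentum -/

/-- The sound speed `c_s = √(-2 f'(1))`. -/
def soundSpeed (f : ℝ → ℝ) : ℝ := Real.sqrt (-2 * deriv f 1)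

/-- `F(r) = ∫_r^1 f`. -/
def potential (f : ℝ → ℝ) (r : ℝ) : ℝ := ∫ ρ in r..1, f ρ

/-- The assumptions on the nonlinearity `f ∈ C³(ℝ₊)`. -/
structure Nonlinearity (f : ℝ → ℝ) : Prop where
  smooth : ContDiffOn ℝ 3 f (Set.Ici 0)
  vanish : f 1 = 0
  defocusing : deriv f 1 < 0
  lower : ∀ ρ : ℝ, 0 ≤ ρ → soundSpeed f ^ 2 / 4 * (1 - ρ) ^ 2 ≤ potential f ρ
  upper : ∃ M q : ℝ, 0 ≤ M ∧ 2 ≤ q ∧ ∀ ρ : ℝ, 2 ≤ ρ → potential f ρ ≤ M * |1 - ρ| ^ q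
  nondegenerate : iteratedDeriv 2 f 1 + 3 * deriv f 1 ≠ 0

/-- The energy `E(η, v) = ⅛ ∫ η'² / (1 - η) + ½ ∫ (1 - η) v² + ½ ∫ F(1 - η)`. -/
def energy (f : ℝ → ℝ) (P : Hydro) : ℝ :=
  1 / 8 * (∫ x, deriv P.1 x ^ 2 / (1 - P.1 x)) + 1 / 2 * (∫ x, (1 - P.1 x) * P.2 x ^ 2)
    + 1 / 2 * ∫ x, potential f (1 - P.1 x)

/-- The momentum `p(η, v) = ½ ∫ η v`. -/
def momentum (P : Hydro) : ℝ := 1 / 2 * ∫ x, P.1 x * P.2 x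

/-- `∇ⁿG(P)(ε, …, ε)`: the `n`-th differential of the functional `G` at `P`, evaluated on the diagonal,
that is the `n`-th derivative at `s = 0` of `s ↦ G(P + s ε)`. -/
def diagDeriv (n : ℕ) (G : Hydro → ℝ) (P ε : Hydro) : ℝ :=
  iteratedDeriv n (fun s : ℝ => G (P + s • ε)) 0

/-! ### Travelling waves -/

/-- `(η, v)` is a dark soliton of speed `c`: a smooth non constant solution, lying in `NX`, of the
hydrodynamical travelling wave system
`c η / 2 = v (1 - η)`, `c v = f(1 - η) - v² - η'' / (2 (1 - η)) - η'² / (4 (1 - η)²)`. -/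
structure IsSoliton (f : ℝ → ℝ) (c : ℝ) (P : Hydro) : Prop where
  mem : P ∈ NXSpace
  smooth_eta : ContDiff ℝ 3 P.1
  smooth_v : ContDiff ℝ 2 P.2
  nonconst : ∃ x y, (P.1 x, P.2 x) ≠ (P.1 y, P.2 y)
  eq_one : ∀ x, c / 2 * P.1 x = P.2 x * (1 - P.1 x)
  eq_two : ∀ x, c * P.2 x = f (1 - P.1 x) - P.2 x ^ 2
    - iteratedDeriv 2 P.1 x / (2 * (1 - P.1 x)) - deriv P.1 x ^ 2 / (4 * (1 - P.1 x) ^ 2)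

/-- `Q` is the branch of solitons on `(c₀, c_s)`: for each speed `c` in this interval, `Q c` is even and is,
up to translations, the unique soliton of speed `c`. -/
def IsSolitonBranch (f : ℝ → ℝ) (c₀ : ℝ) (Q : ℝ → Hydro) : Prop :=
  ∀ c ∈ Set.Ioo c₀ (soundSpeed f),
    IsSoliton f c (Q c) ∧ (∀ x, (Q c).1 (-x) = (Q c).1 x ∧ (Q c).2 (-x) = (Q c).2 x) ∧
      ∀ P : Hydro, IsSoliton f c P → ∃ a : ℝ, P = translate a (Q c)

/-- Exponential decay of the solitons `Q c` and of their spatial derivatives, uniformly with respect to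
the speed `c ∈ (c₀, c_s)`, with rate `a_d √(c_s² - c²)`. -/
def HasDecay (f : ℝ → ℝ) (c₀ : ℝ) (Q : ℝ → Hydro) (a_d K_d : ℝ) : Prop :=
  ∀ c ∈ Set.Ioo c₀ (soundSpeed f), ∀ x : ℝ,
    ∑ k₁ ∈ Finset.range 4, ∑ k₂ ∈ Finset.range 3, (soundSpeed f ^ 2 - c ^ 2)⁻¹ *
        (|iteratedDeriv k₁ (Q c).1 x| + c ^ (1 + 2 * k₂) * |iteratedDeriv k₂ (Q c).2 x|)
      ≤ K_d * Real.exp (-a_d * Real.sqrt (soundSpeed f ^ 2 - c ^ 2) * |x|)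

/-! ### Chains of solitons -/

/-- Well ordered admissible speeds. -/
def Adm (f : ℝ → ℝ) (c₀ : ℝ) (N : ℕ) : Set (Fin N → ℝ) :=
  {c | (∀ k, c k ∈ Set.Ioo c₀ (soundSpeed f)) ∧ StrictMono c}

/-- Positions with consecutive distances larger than `L`. -/
def Pos (N : ℕ) (L : ℝ) : Set (Fin N → ℝ) :=
  {a | ∀ i j : Fin N, (i : ℕ) + 1 = (j : ℕ) → L < a j - a i}

/-- The sum of solitons `R_{c,a} = ∑ₖ Q_{cₖ}(· - aₖ)`. -/
def chain (Q : ℝ → Hydro) {N : ℕ} (c a : Fin N → ℝ) : Hydro :=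
  ∑ k, translate (a k) (Q (c k))

/-- The set `U^⊥_{c,a}(L)` of the perturbations `P = R_{c,a} + ε ∈ X` of a chain with `a ∈ Pos_N(L)` such
that `⟨ε, ∂ₓQ_{cₖ,aₖ}⟩ = ∇p(Q_{cₖ,aₖ}).ε = 0` for all `k`. -/
def perpSet (Q : ℝ → Hydro) {N : ℕ} (c a : Fin N → ℝ) (L : ℝ) : Set Hydro :=
  {P | P ∈ XSpace ∧ a ∈ Pos N L ∧ ∀ k,
    innerL2 (P - chain Q c a) (dx (translate (a k) (Q (c k)))) = 0 ∧
      diagDeriv 1 momentum (translate (a k) (Q (c k))) (P - chain Q c a) = 0}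

/-- `ν_c = minₖ √(c_s² - cₖ²)`. -/
def nuMin (f : ℝ → ℝ) {N : ℕ} (c : Fin N → ℝ) : ℝ :=
  ⨅ k, Real.sqrt (soundSpeed f ^ 2 - c k ^ 2)

/-- `Λ(L, c) = 1 / ν_c + L`. -/
def Lam (f : ℝ → ℝ) {N : ℕ} (L : ℝ) (c : Fin N → ℝ) : ℝ := 1 / nuMin f c + L

/-! ### Localisation -/

/-- The cut-off `Φₖ` around the `k`-th soliton. -/
def solCutoff {N : ℕ} (τ L : ℝ) (a : Fin N → ℝ) (k : Fin N) (x : ℝ) : ℝ :=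
  1 / 2 * (Real.tanh (τ * (x - a k + L / 4)) - Real.tanh (τ * (x - a k - L / 4)))

/-- The cut-off `Φ_{k,k+1}`, `0 ≤ k ≤ N`, between the `k`-th and the `(k+1)`-th soliton (counted from `1`);
on the left of the first one if `k = 0` and on the right of the last one if `k = N`. Positions are
indexed from `0`, so the `k`-th soliton sits at `a ⟨k - 1, _⟩`. -/
def gapCutoff {N : ℕ} (τ L : ℝ) (a : Fin N → ℝ) (k : Fin (N + 1)) (x : ℝ) : ℝ :=
  1 / 2 *
    ((if h : 0 < (k : ℕ) then
        Real.tanh (τ * (x - a ⟨(k : ℕ) - 1, by have := k.isLt; omega⟩ - L / 4)) else 1)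
      - (if h : (k : ℕ) < N then Real.tanh (τ * (x - a ⟨(k : ℕ), h⟩ + L / 4)) else -1))

/-- `εₖ = ε(· + aₖ) √(Φₖ(· + aₖ))`. -/
def epsSol {N : ℕ} (τ L : ℝ) (a : Fin N → ℝ) (ε : Hydro) (k : Fin N) : Hydro :=
  (fun x => ε.1 (x + a k) * Real.sqrt (solCutoff τ L a k (x + a k)),
    fun x => ε.2 (x + a k) * Real.sqrt (solCutoff τ L a k (x + a k)))

/-- `ε_{k,k+1} = ε √Φ_{k,k+1}`. -/
def epsGap {N : ℕ} (τ L : ℝ) (a : Fin N → ℝ) (ε : Hydro) (k : Fin (N + 1)) : Hydro :=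
  (fun x => ε.1 x * Real.sqrt (gapCutoff τ L a k x),
    fun x => ε.2 x * Real.sqrt (gapCutoff τ L a k x))

/-- The cubic Taylor remainder `∫₀¹ (1 - t)² / 2 ∇³E(R + t ε)(ε, ε, ε) dt`. -/
def remainder (f : ℝ → ℝ) (R ε : Hydro) : ℝ :=
  ∫ t in (0 : ℝ)..1, (1 - t) ^ 2 / 2 * diagDeriv 3 (energy f) (R + t • ε) ε

end NLSHydro

end

open NLSHydro

namespace NLSHydro

open MeasureTheory Set Filter Topology

/-! ### Elementary calculus near the origin -/

/-! Branch of solitons. The first travelling wave equation gives `v = c η / (2 (1 - η))`, and the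
second then has the first integral `η'² = G₀(η) - c² η²` with `G₀(u) = 4 (1 - u) F(1 - u)`. With `η'
= -η y` and `ν² = c_s² - c²` this reads `y² = ν² - k(η)`, where `k(u) = c_s² - G₀(u) / u²`. The
lower bound on `F` on both sides of `1` forces `f''(1) = 0`, so `k(u) ~ c_s² u` near `0`
(`exists_speedGap_bounds`). Hence `k` is invertible near `0`, and `y = ν tanh θ`, `k(η) = ν² (1 -
tanh² θ)` solves the system up to a change of variable `θ ↔ x` comparable to `ν x`
(`exists_profile`). This gives amplitude `O(ν²)` and decay rate `ν / 4`, uniformly as `c → c_s`. For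
uniqueness, the maximum of any soliton is a positive zero of `G₀(u) - c² u²`, while the constructed
profile peaks at the smallest such zero. Every soliton therefore passes through that value with zero
slope, and Cauchy-Lipschitz applies (`eq_translate`).

Expansion. Taylor's formula for `s ↦ E(R + s ε)` with integral remainder is exact (`energy_taylor`),
so the three lower order terms remain to be compared with their decoupled versions. The densities of
`E` and the coefficients of `∇E` are smooth functions `Ψ` of the jet `(η, η', v)` vanishing at `0`,
so `Ψ(∑ Uₖ) - ∑ Ψ(Uₖ)` is controlled by the products `|Uⱼ| |Uₖ|`, `j ≠ k`, which are exponentially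
small in `ν L` (`exists_interaction`). The gradient terms `∇E(Qₖ).ε = cₖ ∇p(Qₖ).ε` vanish by
orthogonality. The second differential is localised with the partition of unity
(`exists_localisation`): each cut-off satisfies `(√Φ)' = σ √Φ` with `|σ| ≤ τ`, which costs `τ ‖ε‖²`,
and on the support of weight `Φ` the chain is close to one soliton, or to `0`, up to `exp(-τ L /
16)`.

All bounds are uniform in the speeds because an amplitude `ν²` beats the width `1 / ν`; the factors
`Λ` enter only through `1 ≤ c_s Λ`. -/

lemma nonneg_of_hasDerivAt_nonneg {g g' : ℝ → ℝ} {d : ℝ}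
    (hg : ∀ u ∈ Icc 0 d, HasDerivAt g (g' u) u) (h0 : g 0 = 0) (h' : ∀ u ∈ Icc 0 d, 0 ≤ g' u) :
    ∀ u ∈ Icc 0 d, 0 ≤ g u := by
  intro u hu
  have hmono : MonotoneOn g (Icc 0 d) := by
    refine monotoneOn_of_deriv_nonneg (convex_Icc 0 d)
      (fun x hx => (hg x hx).continuousAt.continuousWithinAt) ?_ ?_
    · intro x hx
      exact (hg x (interior_subset hx)).differentiableAt.differentiableWithinAt
    · intro x hx
      rw [(hg x (interior_subset hx)).deriv]
      exact h' x (interior_subset hx)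
  have := hmono (left_mem_Icc.2 (hu.1.trans hu.2)) hu hu.1
  rwa [h0] at this

/-- Lower cubic bounds for a function with a triple zero at the origin. -/
lemma cubic_lower {K K1 K2 K3 : ℝ → ℝ} {d A : ℝ}
    (h1 : ∀ u ∈ Icc 0 d, HasDerivAt K (K1 u) u) (h2 : ∀ u ∈ Icc 0 d, HasDerivAt K1 (K2 u) u)
    (h3 : ∀ u ∈ Icc 0 d, HasDerivAt K2 (K3 u) u) (z : K 0 = 0) (z1 : K1 0 = 0) (z2 : K2 0 = 0)
    (hA : ∀ u ∈ Icc 0 d, A ≤ K3 u) :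
    ∀ u ∈ Icc 0 d, A / 6 * u ^ 3 ≤ K u ∧ A / 6 * u ^ 3 ≤ u * K1 u - 2 * K u := by
  have b2 : ∀ u ∈ Icc 0 d, 0 ≤ K2 u - A * u :=
    nonneg_of_hasDerivAt_nonneg (g' := fun u => K3 u - A)
      (fun u hu => ((h3 u hu).sub ((hasDerivAt_id u).const_mul A)).congr_deriv (by simp))
      (by simp [z2]) (fun u hu => by linarith [hA u hu])
  have b1 : ∀ u ∈ Icc 0 d, 0 ≤ K1 u - A * (u ^ 2 / 2) :=
    nonneg_of_hasDerivAt_nonneg (g' := fun u => K2 u - A * u)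
      (fun u hu => by
        have := (h2 u hu).sub ((((hasDerivAt_id u).pow 2).div_const 2).const_mul A)
        refine this.congr_deriv ?_
        simp) (by simp [z1]) b2
  have b0 : ∀ u ∈ Icc 0 d, 0 ≤ K u - A / 6 * u ^ 3 :=
    nonneg_of_hasDerivAt_nonneg (g' := fun u => K1 u - A * (u ^ 2 / 2))
      (fun u hu => by
        have := (h1 u hu).sub (((hasDerivAt_id u).pow 3).const_mul (A / 6))
        refine this.congr_deriv ?_
        simp; ring) (by simp [z]) b1
  -- `u * K1 - 2 * K` is `u ^ 3` times the derivative of `K / u ^ 2`. Its derivative is `u * K2 -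
  -- K1`, whose derivative is `u * K3`, so two integrations give the second bound.
  have c1 : ∀ u ∈ Icc 0 d, 0 ≤ u * K2 u - K1 u - A * (u ^ 2 / 2) :=
    nonneg_of_hasDerivAt_nonneg (g' := fun u => u * (K3 u - A))
      (fun u hu => by
        have := (((hasDerivAt_id u).mul (h3 u hu)).sub (h2 u hu)).sub
          ((((hasDerivAt_id u).pow 2).div_const 2).const_mul A)
        refine this.congr_deriv ?_
        simp; ring) (by simp [z1]) (fun u hu => mul_nonneg hu.1 (by linarith [hA u hu]))
  have c0 : ∀ u ∈ Icc 0 d, 0 ≤ u * K1 u - 2 * K u - A / 6 * u ^ 3 :=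
    nonneg_of_hasDerivAt_nonneg (g' := fun u => u * K2 u - K1 u - A * (u ^ 2 / 2))
      (fun u hu => by
        have := (((hasDerivAt_id u).mul (h2 u hu)).sub ((h1 u hu).const_mul 2)).sub
          (((hasDerivAt_id u).pow 3).const_mul (A / 6))
        refine this.congr_deriv ?_
        simp; ring) (by simp [z]) c1
  exact fun u hu => ⟨by linarith [b0 u hu], by linarith [c0 u hu]⟩

/-! ### The nonlinearity -/

namespace Nonlinearity

variable {f : ℝ → ℝ}

lemma contDiffOn_pos (hf : Nonlinearity f) : ContDiffOn ℝ 3 f (Ioi 0) :=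
  hf.smooth.mono Ioi_subset_Ici_self

lemma contDiffOn_deriv (hf : Nonlinearity f) : ContDiffOn ℝ 2 (deriv f) (Ioi 0) :=
  ((contDiffOn_succ_iff_deriv_of_isOpen (n := 2) isOpen_Ioi).1
    (by exact hf.contDiffOn_pos.of_le (by norm_num))).2.2

lemma contDiffOn_deriv_deriv (hf : Nonlinearity f) :
    ContDiffOn ℝ 1 (deriv (deriv f)) (Ioi 0) :=
  ((contDiffOn_succ_iff_deriv_of_isOpen (n := 1) isOpen_Ioi).1
    (by exact hf.contDiffOn_deriv.of_le (by norm_num))).2.2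

lemma hasDerivAt (hf : Nonlinearity f) {ρ : ℝ} (h : 0 < ρ) : HasDerivAt f (deriv f ρ) ρ :=
  ((hf.contDiffOn_pos.differentiableOn (by norm_num)).differentiableAt
    (Ioi_mem_nhds h)).hasDerivAt

lemma hasDerivAt_deriv (hf : Nonlinearity f) {ρ : ℝ} (h : 0 < ρ) :
    HasDerivAt (deriv f) (deriv (deriv f) ρ) ρ :=
  ((hf.contDiffOn_deriv.differentiableOn (by norm_num)).differentiableAt
    (Ioi_mem_nhds h)).hasDerivAt

lemma continuousAt_deriv_deriv (hf : Nonlinearity f) {ρ : ℝ} (h : 0 < ρ) :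
    ContinuousAt (deriv (deriv f)) ρ :=
  hf.contDiffOn_deriv_deriv.continuousOn.continuousAt (Ioi_mem_nhds h)

lemma hasDerivAt_potential (hf : Nonlinearity f) {ρ : ℝ} (h : 0 < ρ) :
    HasDerivAt (potential f) (-f ρ) ρ := by
  have hsub : uIcc ρ 1 ⊆ Ioi 0 := fun x hx => lt_of_lt_of_le (lt_min h one_pos) hx.1
  exact intervalIntegral.integral_hasDerivAt_left
    ((hf.contDiffOn_pos.continuousOn.mono hsub).intervalIntegrable)
    (hf.contDiffOn_pos.continuousOn.stronglyMeasurableAtFilter isOpen_Ioi _ h)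
    (hf.hasDerivAt h).continuousAt

lemma contDiffOn_potential (hf : Nonlinearity f) : ContDiffOn ℝ 4 (potential f) (Ioi 0) := by
  have : ContDiffOn ℝ (3 + 1) (potential f) (Ioi 0) := by
    rw [contDiffOn_succ_iff_deriv_of_isOpen isOpen_Ioi]
    refine ⟨fun x hx => (hf.hasDerivAt_potential hx).differentiableAt.differentiableWithinAt,
      by simp, ?_⟩
    exact hf.contDiffOn_pos.neg.congr fun x hx => (hf.hasDerivAt_potential hx).deriv
  exact this

lemma sq_soundSpeed (hf : Nonlinearity f) : soundSpeed f ^ 2 = -2 * deriv f 1 :=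
  Real.sq_sqrt (by linarith [hf.defocusing])

lemma soundSpeed_pos (hf : Nonlinearity f) : 0 < soundSpeed f :=
  Real.sqrt_pos.2 (by linarith [hf.defocusing])

/-! Derivatives in the variable `u = 1 - ρ`. -/

lemma hasDerivAt_potential_one_sub (hf : Nonlinearity f) {u : ℝ} (h : u < 1) :
    HasDerivAt (fun u => potential f (1 - u)) (f (1 - u)) u := by
  simpa using (hf.hasDerivAt_potential (sub_pos.2 h)).comp_const_sub 1 u

lemma hasDerivAt_one_sub (hf : Nonlinearity f) {u : ℝ} (h : u < 1) :
    HasDerivAt (fun u => f (1 - u)) (-deriv f (1 - u)) u := by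
  simpa using (hf.hasDerivAt (sub_pos.2 h)).comp_const_sub 1 u

lemma hasDerivAt_deriv_one_sub (hf : Nonlinearity f) {u : ℝ} (h : u < 1) :
    HasDerivAt (fun u => deriv f (1 - u)) (-deriv (deriv f) (1 - u)) u := by
  simpa using (hf.hasDerivAt_deriv (sub_pos.2 h)).comp_const_sub 1 u

lemma potential_one (f : ℝ → ℝ) : potential f 1 = 0 := by simp [potential]

/-- The lower bound on the potential forces `f''(1) = 0`. -/
lemma deriv_deriv_one (hf : Nonlinearity f) : deriv (deriv f) 1 = 0 := by
  have hcs := hf.sq_soundSpeed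
  -- The sign `σ` selects a side of `ρ = 1`. The function `c_s² (σ u)² / 4 - F(1 - σ u)` vanishes to
  -- second order at `0` and has third derivative `-σ f''(1 - σ u)`. Were this positive at `0`, the
  -- function would be positive for small `u > 0`, against the lower bound on `F`.
  have key : ∀ σ : ℝ, σ ^ 2 = 1 → ¬ (0 < -σ * deriv (deriv f) 1) := by
    intro σ hσ hpos
    have hσ3 : σ ^ 3 = σ := by rw [pow_succ, hσ, one_mul]
    set b := -σ * deriv (deriv f) 1 / 2 with hb
    have hcont : ContinuousAt (fun u : ℝ => -σ * deriv (deriv f) (1 - σ * u)) 0 := by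
      have h1 : ContinuousAt (deriv (deriv f)) (1 - σ * 0) := by
        simpa using hf.continuousAt_deriv_deriv one_pos
      exact continuousAt_const.mul
        (ContinuousAt.comp (f := fun u : ℝ => 1 - σ * u) h1 (by fun_prop))
    have hev : ∀ᶠ u in 𝓝 (0 : ℝ), b < -σ * deriv (deriv f) (1 - σ * u) :=
      hcont.eventually (lt_mem_nhds (by simp only [mul_zero, sub_zero]; linarith))
    obtain ⟨r, hr, hball⟩ := Metric.eventually_nhds_iff.1 hev
    set d := min (r / 2) (1 / 2) with hd
    have hd0 : 0 < d := by positivity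
    have hdr : d < r := (min_le_left _ _).trans_lt (by linarith)
    have hd1 : d ≤ 1 / 2 := min_le_right _ _
    have hσle : |σ| = 1 := by
      have : |σ| ^ 2 = 1 := by rw [sq_abs, hσ]
      nlinarith [abs_nonneg σ]
    have hlt : ∀ u ∈ Icc 0 d, σ * u < 1 := fun u hu => by
      have : |σ * u| ≤ 1 / 2 := by
        rw [abs_mul, hσle, one_mul, abs_of_nonneg hu.1]; exact hu.2.trans hd1
      linarith [le_abs_self (σ * u)]
    have hlin : ∀ u : ℝ, HasDerivAt (fun u : ℝ => σ * u) σ u := fun u => by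
      simpa using (hasDerivAt_id u).const_mul σ
    have hlow := cubic_lower (d := d) (A := b)
      (K := fun u => soundSpeed f ^ 2 / 4 * (σ * u) ^ 2 - potential f (1 - σ * u))
      (K1 := fun u => σ * (soundSpeed f ^ 2 / 2 * (σ * u) - f (1 - σ * u)))
      (K2 := fun u => soundSpeed f ^ 2 / 2 + deriv f (1 - σ * u))
      (K3 := fun u => -σ * deriv (deriv f) (1 - σ * u))
      (fun u hu => by
        have := (((hlin u).pow 2).const_mul (soundSpeed f ^ 2 / 4)).sub
          ((hf.hasDerivAt_potential_one_sub (hlt u hu)).comp u (hlin u))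
        refine this.congr_deriv ?_
        simp; ring)
      (fun u hu => by
        have := (((hlin u).const_mul (soundSpeed f ^ 2 / 2)).sub
          ((hf.hasDerivAt_one_sub (hlt u hu)).comp u (hlin u))).const_mul σ
        refine this.congr_deriv ?_
        linear_combination
          (soundSpeed f ^ 2 / 2 + deriv f (1 - σ * u)) * hσ)
      (fun u hu => by
        have := ((hf.hasDerivAt_deriv_one_sub (hlt u hu)).comp u (hlin u)).const_add
          (soundSpeed f ^ 2 / 2)
        refine this.congr_deriv ?_
        ring)
      (by simp [potential_one]) (by simp [hf.vanish]) (by simp; linarith)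
      (fun u hu => (hball (by simpa [abs_of_nonneg hu.1] using hu.2.trans_lt hdr)).le)
      d ⟨hd0.le, le_rfl⟩
    have h1 := hlow.1
    have h2 := hf.lower (1 - σ * d) (by linarith [hlt d ⟨hd0.le, le_rfl⟩])
    simp only [sub_sub_cancel] at h2
    have : 0 < b / 6 * d ^ 3 := by positivity
    linarith
  by_contra hne
  rcases lt_or_gt_of_ne hne with h | h
  · exact key 1 (by norm_num) (by linarith)
  · exact key (-1) (by norm_num) (by linarith)

end Nonlinearity

/-! ### The first integral of the travelling wave equation -/

/-- `G₀(u) = 4 (1 - u) F(1 - u)`. -/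
noncomputable def firstInt (f : ℝ → ℝ) (u : ℝ) : ℝ := 4 * (1 - u) * potential f (1 - u)

/-- `G₀'`. -/
noncomputable def firstIntDeriv (f : ℝ → ℝ) (u : ℝ) : ℝ :=
  -4 * potential f (1 - u) + 4 * (1 - u) * f (1 - u)

/-- `c_s² - G₀(u) / u²`. -/
noncomputable def speedGap (f : ℝ → ℝ) (u : ℝ) : ℝ := (soundSpeed f ^ 2 * u ^ 2 - firstInt f u) / u ^ 2

/-- The derivative of `speedGap`. -/
noncomputable def speedGapDeriv (f : ℝ → ℝ) (u : ℝ) : ℝ :=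
  (2 * firstInt f u - u * firstIntDeriv f u) / u ^ 3

namespace Nonlinearity

variable {f : ℝ → ℝ}

lemma hasDerivAt_firstInt (hf : Nonlinearity f) {u : ℝ} (h : u < 1) :
    HasDerivAt (firstInt f) (firstIntDeriv f u) u := by
  have := (((hasDerivAt_id u).const_sub 1).const_mul 4).mul (hf.hasDerivAt_potential_one_sub h)
  refine this.congr_deriv ?_
  simp [firstIntDeriv]

lemma hasDerivAt_firstIntDeriv (hf : Nonlinearity f) {u : ℝ} (h : u < 1) :
    HasDerivAt (firstIntDeriv f) (-8 * f (1 - u) - 4 * (1 - u) * deriv f (1 - u)) u := by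
  have := ((hf.hasDerivAt_potential_one_sub h).const_mul (-4)).add
    ((((hasDerivAt_id u).const_sub 1).const_mul 4).mul (hf.hasDerivAt_one_sub h))
  refine this.congr_deriv ?_
  simp; ring

/-- The numerator `c_s² u² - G₀(u)` has a triple zero at `0`, with third derivative `6 c_s²` there
because `f''(1) = 0`. Where the third derivative lies in `(5 c_s², 7 c_s²)`, `cubic_lower` applied
to the numerator and to its opposite gives the constants `5/6` and `7/6`, inside `[1/2, 2]`. -/
lemma exists_speedGap_bounds (hf : Nonlinearity f) : ∃ δ : ℝ, 0 < δ ∧ δ ≤ 1 / 4 ∧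
    ∀ u ∈ Ioc 0 δ, HasDerivAt (speedGap f) (speedGapDeriv f u) u ∧
      soundSpeed f ^ 2 / 2 ≤ speedGapDeriv f u ∧ speedGapDeriv f u ≤ 2 * soundSpeed f ^ 2 ∧
      soundSpeed f ^ 2 / 2 * u ≤ speedGap f u ∧ speedGap f u ≤ 2 * soundSpeed f ^ 2 * u := by
  have hcs := hf.sq_soundSpeed
  have hcs0 : 0 < soundSpeed f ^ 2 := pow_pos hf.soundSpeed_pos 2
  set K3 : ℝ → ℝ := fun u => -12 * deriv f (1 - u) - 4 * (1 - u) * deriv (deriv f) (1 - u)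
    with hK3
  have hc : ContinuousAt K3 0 := by
    have h1 : ContinuousAt (deriv (deriv f)) (1 - 0) := by
      simpa using hf.continuousAt_deriv_deriv one_pos
    have h2 : ContinuousAt (deriv f) (1 - 0) := by
      simpa using (hf.hasDerivAt_deriv one_pos).continuousAt
    have h1' := ContinuousAt.comp (f := fun u : ℝ => 1 - u) h1 (by fun_prop)
    have h2' := ContinuousAt.comp (f := fun u : ℝ => 1 - u) h2 (by fun_prop)
    exact (continuousAt_const.mul h2').sub
      ((continuousAt_const.mul (by fun_prop)).mul h1')
  have hK30 : K3 0 = 6 * soundSpeed f ^ 2 := by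
    simp only [hK3, sub_zero, hf.deriv_deriv_one]; linarith
  have hev : ∀ᶠ u in 𝓝 (0 : ℝ), K3 u ∈ Ioo (5 * soundSpeed f ^ 2) (7 * soundSpeed f ^ 2) :=
    hc.eventually (Ioo_mem_nhds (by rw [hK30]; linarith) (by rw [hK30]; linarith))
  obtain ⟨r, hr, hball⟩ := Metric.eventually_nhds_iff.1 hev
  set d := min (r / 2) (1 / 4) with hd
  have hd0 : 0 < d := by positivity
  have hdr : d < r := (min_le_left _ _).trans_lt (by linarith)
  have hd1 : d ≤ 1 / 4 := min_le_right _ _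
  have hlt : ∀ u ∈ Icc 0 d, u < 1 := fun u hu => by linarith [hu.2]
  have hmem : ∀ u ∈ Icc 0 d, K3 u ∈ Ioo (5 * soundSpeed f ^ 2) (7 * soundSpeed f ^ 2) :=
    fun u hu => hball (by simpa [abs_of_nonneg hu.1] using hu.2.trans_lt hdr)
  have d1 : ∀ u ∈ Icc 0 d, HasDerivAt (fun u => soundSpeed f ^ 2 * u ^ 2 - firstInt f u)
      (2 * soundSpeed f ^ 2 * u - firstIntDeriv f u) u := fun u hu => by
    have := (((hasDerivAt_id u).pow 2).const_mul (soundSpeed f ^ 2)).sub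
      (hf.hasDerivAt_firstInt (hlt u hu))
    refine this.congr_deriv ?_
    simp; ring
  have d2 : ∀ u ∈ Icc 0 d, HasDerivAt (fun u => 2 * soundSpeed f ^ 2 * u - firstIntDeriv f u)
      (2 * soundSpeed f ^ 2 + 8 * f (1 - u) + 4 * (1 - u) * deriv f (1 - u)) u := fun u hu => by
    have := ((hasDerivAt_id u).const_mul (2 * soundSpeed f ^ 2)).sub
      (hf.hasDerivAt_firstIntDeriv (hlt u hu))
    refine this.congr_deriv ?_
    ring
  have d3 : ∀ u ∈ Icc 0 d, HasDerivAt
      (fun u => 2 * soundSpeed f ^ 2 + 8 * f (1 - u) + 4 * (1 - u) * deriv f (1 - u))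
      (K3 u) u := fun u hu => by
    have := (((hf.hasDerivAt_one_sub (hlt u hu)).const_mul 8).const_add
      (2 * soundSpeed f ^ 2)).add
      ((((hasDerivAt_id u).const_sub 1).const_mul 4).mul (hf.hasDerivAt_deriv_one_sub (hlt u hu)))
    refine this.congr_deriv ?_
    simp [hK3]; ring
  have low := cubic_lower d1 d2 d3 (by simp [firstInt, potential_one])
    (by simp [firstIntDeriv, potential_one, hf.vanish]) (by simp [hf.vanish]; linarith)
    (fun u hu => (hmem u hu).1.le)
  have upp := cubic_lower (fun u hu => (d1 u hu).neg) (fun u hu => (d2 u hu).neg)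
    (fun u hu => (d3 u hu).neg) (by simp [firstInt, potential_one])
    (by simp [firstIntDeriv, potential_one, hf.vanish]) (by simp [hf.vanish]; linarith)
    (A := -(7 * soundSpeed f ^ 2)) (fun u hu => neg_le_neg (hmem u hu).2.le)
  refine ⟨d, hd0, hd1, fun u hu => ?_⟩
  have hu0 : u ≠ 0 := hu.1.ne'
  have hu' : u ∈ Icc 0 d := ⟨hu.1.le, hu.2⟩
  obtain ⟨l1, l2⟩ := low u hu'
  obtain ⟨p1, p2⟩ := upp u hu'
  simp only [Pi.neg_apply] at p1 p2
  have hu3 : 0 < u ^ 3 := pow_pos hu.1 3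
  have hcu : 0 < soundSpeed f ^ 2 * u ^ 3 := mul_pos hcs0 hu3
  refine ⟨?_, ?_, ?_, ?_, ?_⟩
  · have := (d1 u hu').div ((hasDerivAt_id u).pow 2) (by simpa using hu0)
    refine this.congr_deriv ?_
    simp only [speedGapDeriv, id, Pi.pow_apply]
    field_simp
    ring
  · rw [speedGapDeriv, le_div_iff₀ hu3]; nlinarith
  · rw [speedGapDeriv, div_le_iff₀ hu3]; nlinarith
  · rw [speedGap, le_div_iff₀ (pow_pos hu.1 2)]; nlinarith
  · rw [speedGap, div_le_iff₀ (pow_pos hu.1 2)]; nlinarith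

end Nonlinearity

/-! ### Construction of the profile -/

lemma hasDerivAt_tanh (x : ℝ) : HasDerivAt Real.tanh (1 - Real.tanh x ^ 2) x := by
  have h := (Real.hasDerivAt_sinh x).div (Real.hasDerivAt_cosh x) (Real.cosh_pos x).ne'
  have he : Real.tanh = Real.sinh / Real.cosh := by
    ext y; exact Real.tanh_eq_sinh_div_cosh y
  rw [he]
  refine h.congr_deriv ?_
  have := (Real.cosh_pos x).ne'
  simp only [Pi.div_apply]
  field_simp

lemma one_sub_tanh_sq_pos (x : ℝ) : 0 < 1 - Real.tanh x ^ 2 := sub_pos.2 (Real.tanh_sq_lt_one x)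

lemma one_sub_tanh_sq_le (x : ℝ) : 1 - Real.tanh x ^ 2 ≤ 4 * Real.exp (-(2 * |x|)) := by
  have hc := Real.cosh_pos x
  have h1 : 1 - Real.tanh x ^ 2 = 1 / Real.cosh x ^ 2 := by
    rw [Real.tanh_eq_sinh_div_cosh, div_pow, eq_div_iff (by positivity), sub_mul,
      div_mul_cancel₀ _ (by positivity), Real.cosh_sq]
    ring
  have h2 : Real.exp |x| / 2 ≤ Real.cosh x := by
    rw [← Real.cosh_abs, Real.cosh_eq]
    linarith [Real.exp_pos (-|x|)]
  have h3 : (Real.exp |x| / 2) ^ 2 ≤ Real.cosh x ^ 2 :=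
    pow_le_pow_left₀ (by positivity) h2 2
  rw [h1, div_le_iff₀ (by positivity)]
  have h4 : Real.exp (-(2 * |x|)) * Real.exp |x| ^ 2 = 1 := by
    rw [← Real.exp_nat_mul, ← Real.exp_add]; simp
  nlinarith [Real.exp_pos (-(2 * |x|))]

/-- A function on `(0, δ]` comparable to the identity, together with its derivative. -/
structure IsGap (k k' : ℝ → ℝ) (δ m M : ℝ) : Prop where
  pos : 0 < δ
  mpos : 0 < m
  deriv : ∀ u ∈ Ioc 0 δ, HasDerivAt k (k' u) u
  cont : ContinuousOn k' (Ioc 0 δ)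
  lower' : ∀ u ∈ Ioc 0 δ, m ≤ k' u
  upper' : ∀ u ∈ Ioc 0 δ, k' u ≤ M
  lower : ∀ u ∈ Ioc 0 δ, m * u ≤ k u
  upper : ∀ u ∈ Ioc 0 δ, k u ≤ M * u

namespace IsGap

variable {k k' : ℝ → ℝ} {δ m M : ℝ}

lemma m_le_M (h : IsGap k k' δ m M) : m ≤ M :=
  (h.lower' δ ⟨h.pos, le_rfl⟩).trans (h.upper' δ ⟨h.pos, le_rfl⟩)

lemma sub_le (h : IsGap k k' δ m M) {u v : ℝ} (hu : u ∈ Ioc 0 δ) (hv : v ∈ Ioc 0 δ)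
    (huv : u ≤ v) : m * (v - u) ≤ k v - k u :=
  (convex_Ioc 0 δ).mul_sub_le_image_sub_of_le_deriv
    (fun x hx => (h.deriv x hx).continuousAt.continuousWithinAt)
    (fun x hx => (h.deriv x (interior_subset hx)).differentiableAt.differentiableWithinAt)
    (fun x hx => by
      rw [(h.deriv x (interior_subset hx)).deriv]; exact h.lower' x (interior_subset hx))
    u hu v hv huv

lemma mul_abs_sub_le (h : IsGap k k' δ m M) {u v : ℝ} (hu : u ∈ Ioc 0 δ) (hv : v ∈ Ioc 0 δ) :
    m * |v - u| ≤ |k v - k u| := by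
  rcases le_total u v with huv | huv
  · rw [abs_of_nonneg (sub_nonneg.2 huv)]
    exact (h.sub_le hu hv huv).trans (le_abs_self _)
  · rw [abs_sub_comm v, abs_sub_comm (k v), abs_of_nonneg (sub_nonneg.2 huv)]
    exact (h.sub_le hv hu huv).trans (le_abs_self _)

/-- The intermediate value theorem on `[S / M, δ]` gives a preimage of `S`. Since `k` expands
distances by at least `m`, the inverse is Lipschitz, hence continuous, and the derivative of an
inverse function applies. -/
lemma exists_inverse (h : IsGap k k' δ m M) : ∃ H : ℝ → ℝ, ∀ S ∈ Ioo 0 (m * δ),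
    H S ∈ Ioo 0 δ ∧ k (H S) = S ∧ HasDerivAt H (k' (H S))⁻¹ S ∧ S ≤ M * H S ∧ m * H S ≤ S := by
  have hM : 0 < M := h.mpos.trans_le h.m_le_M
  have hex : ∀ S : ℝ, ∃ u, S ∈ Ioo 0 (m * δ) → u ∈ Ioo 0 δ ∧ k u = S := by
    intro S
    by_cases hS : S ∈ Ioo 0 (m * δ)
    · have hS0 : S / M ∈ Ioc 0 δ := by
        refine ⟨div_pos hS.1 hM, ?_⟩
        rw [div_le_iff₀ hM]
        nlinarith [hS.2, h.m_le_M, h.pos]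
      have hsub : Icc (S / M) δ ⊆ Ioc 0 δ := fun x hx => ⟨hS0.1.trans_le hx.1, hx.2⟩
      have hcont : ContinuousOn k (Icc (S / M) δ) := fun x hx =>
        (h.deriv x (hsub hx)).continuousAt.continuousWithinAt
      have h1 : k (S / M) ≤ S := by
        have := h.upper _ hS0
        rwa [mul_div_cancel₀ _ hM.ne'] at this
      have h2 : S < k δ := hS.2.trans_le (h.lower δ ⟨h.pos, le_rfl⟩)
      obtain ⟨u, hu, hku⟩ := intermediate_value_Icc hS0.2 hcont ⟨h1, h2.le⟩
      refine ⟨u, fun _ => ⟨⟨(hsub hu).1, lt_of_le_of_ne hu.2 ?_⟩, hku⟩⟩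
      rintro rfl
      exact h2.ne' hku
    -- Arbitrary value outside the range of interest.
    · exact ⟨0, fun h => absurd h hS⟩
  choose H hH using hex
  have hmem : ∀ S ∈ Ioo 0 (m * δ), H S ∈ Ioc 0 δ := fun S hS =>
    ⟨(hH S hS).1.1, (hH S hS).1.2.le⟩
  refine ⟨H, fun S hS => ⟨(hH S hS).1, (hH S hS).2, ?_, ?_, ?_⟩⟩
  · have hnhds : Ioo 0 (m * δ) ∈ 𝓝 S := Ioo_mem_nhds hS.1 hS.2
    refine (h.deriv _ (hmem S hS)).of_local_left_inverse ?_
      (h.mpos.trans_le (h.lower' _ (hmem S hS))).ne' ?_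
    · have hlip : LipschitzOnWith (Real.toNNReal m⁻¹) H (Ioo 0 (m * δ)) := by
        refine LipschitzOnWith.of_dist_le_mul fun x hx y hy => ?_
        rw [Real.dist_eq, Real.dist_eq, Real.coe_toNNReal _ (inv_nonneg.2 h.mpos.le)]
        have := h.mul_abs_sub_le (hmem y hy) (hmem x hx)
        rw [(hH x hx).2, (hH y hy).2] at this
        rw [← div_eq_inv_mul, le_div_iff₀ h.mpos]
        linarith
      exact hlip.continuousOn.continuousAt hnhds
    · filter_upwards [hnhds] with T hT using (hH T hT).2
  · have := h.upper _ (hmem S hS)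
    rwa [(hH S hS).2] at this
  · have := h.lower _ (hmem S hS)
    rwa [(hH S hS).2] at this

/-- A positive continuous function bounded away from `0` is the derivative of the inverse of a
global time change. -/
lemma _root_.NLSHydro.exists_time_change {ρ : ℝ → ℝ} {r R : ℝ} (hr : 0 < r) (hc : Continuous ρ)
    (hl : ∀ t, r ≤ ρ t) (hu : ∀ t, ρ t ≤ R) (heven : ∀ t, ρ (-t) = ρ t) :
    ∃ T : ℝ → ℝ, (∀ x, HasDerivAt T (ρ (T x))⁻¹ x) ∧ (∀ x, T (-x) = -T x) ∧
      ∀ x, |x| ≤ R * |T x| := by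
  set X : ℝ → ℝ := fun t => ∫ s in (0 : ℝ)..t, ρ s with hX
  have hXd : ∀ t, HasDerivAt X (ρ t) t := fun t =>
    intervalIntegral.integral_hasDerivAt_right (hc.intervalIntegrable _ _)
      (hc.stronglyMeasurableAtFilter _ _) hc.continuousAt
  have hXc : Continuous X := continuous_iff_continuousAt.2 fun t => (hXd t).continuousAt
  have hmono : StrictMono X := strictMono_of_hasDerivAt_pos hXd fun t => hr.trans_le (hl t)
  have hX0 : X 0 = 0 := by simp [hX]
  have hmono' : Monotone fun t => X t - r * t :=
    monotone_of_hasDerivAt_nonneg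
      (fun t => ((hXd t).sub ((hasDerivAt_id t).const_mul r)))
      (fun t => by simpa using hl t)
  have htop : Tendsto X atTop atTop := by
    refine tendsto_atTop_mono' _ ?_ (tendsto_id.const_mul_atTop hr)
    filter_upwards [eventually_ge_atTop 0] with t ht
    have := hmono' ht
    simp only [hX0, mul_zero, sub_zero] at this
    simpa using this
  have hbot : Tendsto X atBot atBot := by
    refine tendsto_atBot_mono' _ ?_ (tendsto_id.const_mul_atBot hr)
    filter_upwards [eventually_le_atBot 0] with t ht
    have := hmono' ht
    simp only [hX0, mul_zero, sub_zero] at this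
    simpa using this
  have hsurj : Function.Surjective X := hXc.surjective htop hbot
  set e := hmono.orderIsoOfSurjective X hsurj with he
  have hXe : ∀ x, X (e.symm x) = x := fun x => e.apply_symm_apply x
  have hodd : ∀ t, X (-t) = -X t := fun t => by
    have : ∫ s in (0 : ℝ)..t, ρ (-s) = ∫ s in -t..-0, ρ s := intervalIntegral.integral_comp_neg _
    simp only [heven, neg_zero] at this
    simp only [hX, this]
    rw [intervalIntegral.integral_symm]
  refine ⟨e.symm, fun x => ?_, fun x => ?_, fun x => ?_⟩
  · exact (hXd _).of_local_left_inverse e.symm.continuous.continuousAt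
      (hr.trans_le (hl _)).ne' (Eventually.of_forall hXe)
  · apply hmono.injective
    rw [hXe, hodd, hXe]
  -- `x` is the integral of `ρ` from `0` to `T x`.
  · have : ‖∫ s in (0 : ℝ)..(e.symm x), ρ s‖ ≤ R * |e.symm x - 0| :=
      intervalIntegral.norm_integral_le_of_norm_le_const fun s _ => by
        rw [Real.norm_of_nonneg (hr.le.trans (hl s))]; exact hu s
    have h2 := hXe x
    simp only [hX] at h2
    rwa [h2, sub_zero, Real.norm_eq_abs] at this

/-- The profile equation `η' = - η y`, `y² = ν² - k(η)`. -/
lemma exists_profile (h : IsGap k k' δ m M) {ν : ℝ} (hν : 0 < ν) (hνδ : ν ^ 2 < m * δ) :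
    ∃ η y : ℝ → ℝ, (∀ x, η x ∈ Ioc 0 δ) ∧ (∀ x, k (η x) = ν ^ 2 - y x ^ 2) ∧
      (∀ x, HasDerivAt η (-(η x * y x)) x) ∧ (∀ x, HasDerivAt y (k' (η x) * η x / 2) x) ∧
      (∀ x, η (-x) = η x) ∧ y 0 = 0 ∧
      ∀ x, η x ≤ 4 / m * ν ^ 2 * Real.exp (-(m / M * ν * |x|)) := by
  obtain ⟨H, hH⟩ := h.exists_inverse
  have hm := h.mpos
  have hM : 0 < M := hm.trans_le h.m_le_M
  -- With `y = ν tanh θ` the relation `k(η) = ν² - y²` determines `η = H (S θ)`. This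
  -- parametrisation avoids the square root, which is singular at the crest `y = 0`.
  set S : ℝ → ℝ := fun θ => ν ^ 2 * (1 - Real.tanh θ ^ 2) with hSdef
  have hSpos : ∀ θ, 0 < S θ := fun θ => mul_pos (by positivity) (one_sub_tanh_sq_pos θ)
  have hS : ∀ θ, S θ ∈ Ioo 0 (m * δ) := fun θ => by
    refine ⟨hSpos θ, lt_of_le_of_lt ?_ hνδ⟩
    exact mul_le_of_le_one_right (by positivity) (by linarith [sq_nonneg (Real.tanh θ)])
  have hSd : ∀ θ, HasDerivAt S (-2 * Real.tanh θ * S θ) θ := fun θ => by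
    have := (((hasDerivAt_tanh θ).pow 2).const_sub 1).const_mul (ν ^ 2)
    refine this.congr_deriv ?_
    simp [hSdef]; ring
  set U : ℝ → ℝ := fun θ => H (S θ) with hU
  have hUm : ∀ θ, U θ ∈ Ioc 0 δ := fun θ => Ioo_subset_Ioc_self (hH _ (hS θ)).1
  have hUd : ∀ θ, HasDerivAt U ((k' (U θ))⁻¹ * (-2 * Real.tanh θ * S θ)) θ := fun θ =>
    (hH _ (hS θ)).2.2.1.comp θ (hSd θ)
  have hk'pos : ∀ θ, 0 < k' (U θ) := fun θ => hm.trans_le (h.lower' _ (hUm θ))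
  have hUc : Continuous U := continuous_iff_continuousAt.2 fun θ => (hUd θ).continuousAt
  have hSc : Continuous S := continuous_iff_continuousAt.2 fun θ => (hSd θ).continuousAt
  -- `ρ = dx/dθ`, found by equating `dη/dθ = -2 tanh θ S / k'(η)` with `-η ν tanh θ dx/dθ`. The
  -- factor `tanh θ` cancels, so `ρ` stays bounded above and below, even at the crest.
  set ρ : ℝ → ℝ := fun θ => 2 * S θ / (ν * (k' (U θ) * U θ)) with hρ
  have hden : ∀ θ, 0 < ν * (k' (U θ) * U θ) := fun θ =>
    mul_pos hν (mul_pos (hk'pos θ) (hUm θ).1)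
  have hρc : Continuous ρ := by
    refine (continuous_const.mul hSc).div (continuous_const.mul (Continuous.mul ?_ hUc))
      fun θ => (hden θ).ne'
    exact h.cont.comp_continuous hUc hUm
  have hev : ∀ θ, U (-θ) = U θ := fun θ => by simp [hU, hSdef, Real.tanh_neg]
  have hρl : ∀ θ, 2 * m / (ν * M) ≤ ρ θ := fun θ => by
    rw [hρ, div_le_div_iff₀ (by positivity) (hden θ)]
    have h1 := (hH _ (hS θ)).2.2.2.2
    have h2 : k' (U θ) * (m * U θ) ≤ M * S θ :=
      mul_le_mul (h.upper' _ (hUm θ)) h1 (mul_pos hm (hUm θ).1).le hM.le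
    nlinarith
  have hρu : ∀ θ, ρ θ ≤ 2 * M / (ν * m) := fun θ => by
    rw [hρ, div_le_div_iff₀ (hden θ) (by positivity)]
    have h1 := (hH _ (hS θ)).2.2.2.1
    have h2 : m * S θ ≤ k' (U θ) * (M * U θ) :=
      mul_le_mul (h.lower' _ (hUm θ)) h1 (hSpos θ).le (hk'pos θ).le
    nlinarith
  obtain ⟨T, hTd, hTodd, hTle⟩ := exists_time_change (by positivity) hρc hρl hρu
    (fun θ => by simp only [hρ, hev]; simp [hSdef, Real.tanh_neg])
  have hT0 : T 0 = 0 := by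
    have := hTodd 0
    rw [neg_zero] at this
    linarith
  refine ⟨fun x => U (T x), fun x => ν * Real.tanh (T x), fun x => hUm _, fun x => ?_,
    fun x => ?_, fun x => ?_, fun x => ?_, by simp [hT0], fun x => ?_⟩
  · simp only [hU]
    rw [(hH _ (hS _)).2.1]
    simp only [hSdef]; ring
  · refine ((hUd _).comp x (hTd x)).congr_deriv ?_
    have h1 := (hk'pos (T x)).ne'
    have h2 := (hUm (T x)).1.ne'
    have h3 := (hSpos (T x)).ne'
    simp only [hρ]
    field_simp
  · refine (((hasDerivAt_tanh _).comp x (hTd x)).const_mul ν).congr_deriv ?_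
    have h1 := (hk'pos (T x)).ne'
    have h2 := (hUm (T x)).1.ne'
    have h3 := (one_sub_tanh_sq_pos (T x)).ne'
    simp only [hρ, hSdef]
    field_simp
  · simp only [hTodd, hev]
  -- `η ≤ S / m ≤ (4 ν² / m) exp(-2 |T x|)`, and `|T x| ≥ ν m |x| / (2 M)` converts the decay to the
  -- variable `x`.
  · have h1 : m * U (T x) ≤ S (T x) := (hH _ (hS _)).2.2.2.2
    have h2 : S (T x) ≤ ν ^ 2 * (4 * Real.exp (-(2 * |T x|))) :=
      mul_le_mul_of_nonneg_left (one_sub_tanh_sq_le _) (by positivity)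
    have h3 : Real.exp (-(2 * |T x|)) ≤ Real.exp (-(m / M * ν * |x|)) := by
      apply Real.exp_le_exp.2
      have h4 := hTle x
      have h5 : m / M * ν * |x| ≤ m / M * ν * (2 * M / (ν * m) * |T x|) := by gcongr
      have h6 : m / M * ν * (2 * M / (ν * m) * |T x|) = 2 * |T x| := by field_simp
      linarith
    have h7 : U (T x) ≤ ν ^ 2 * (4 * Real.exp (-(m / M * ν * |x|))) / m := by
      rw [le_div_iff₀ hm]
      have : ν ^ 2 * (4 * Real.exp (-(2 * |T x|))) ≤
        ν ^ 2 * (4 * Real.exp (-(m / M * ν * |x|))) := by gcongr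
      linarith
    refine h7.trans (le_of_eq ?_)
    ring

end IsGap

namespace Nonlinearity

variable {f : ℝ → ℝ}

lemma exists_isGap (hf : Nonlinearity f) : ∃ δ : ℝ, δ ≤ 1 / 4 ∧
    IsGap (speedGap f) (speedGapDeriv f) δ (soundSpeed f ^ 2 / 2) (2 * soundSpeed f ^ 2) := by
  obtain ⟨δ, h0, h1, h⟩ := hf.exists_speedGap_bounds
  refine ⟨δ, h1, h0, by have := hf.soundSpeed_pos; positivity, fun u hu => (h u hu).1, ?_,
    fun u hu => (h u hu).2.1, fun u hu => (h u hu).2.2.1, fun u hu => (h u hu).2.2.2.1,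
    fun u hu => (h u hu).2.2.2.2⟩
  intro u hu
  have hu1 : u < 1 := by linarith [hu.2]
  refine ContinuousAt.continuousWithinAt ?_
  exact ((continuousAt_const.mul (hf.hasDerivAt_firstInt hu1).continuousAt).sub
    (continuousAt_id.mul (hf.hasDerivAt_firstIntDeriv hu1).continuousAt)).div
    (continuousAt_id.pow 3) (pow_ne_zero 3 hu.1.ne')

end Nonlinearity

/-! ### Exponentially decaying functions -/

lemma integrable_and_integral_exp_neg_abs {b : ℝ} (hb : 0 < b) :
    Integrable (fun x : ℝ => Real.exp (-(b * |x|))) ∧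
      ∫ x : ℝ, Real.exp (-(b * |x|)) = 2 / b := by
  have h1 : IntegrableOn (fun x : ℝ => Real.exp (-b * x)) (Ioi 0) :=
    integrableOn_exp_mul_Ioi (neg_neg_of_pos hb) 0
  have hI : ∫ x in Ioi (0 : ℝ), Real.exp (-b * x) = 1 / b := by
    rw [integral_exp_mul_Ioi (neg_neg_of_pos hb)]
    simp [div_eq_mul_inv]
  have h2 : ∫ x : ℝ, Real.exp (-(b * |x|)) = 2 / b := by
    have := integral_comp_abs (f := fun x => Real.exp (-(b * x)))
    rw [this]
    simp only [← neg_mul]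
    rw [hI]; ring
  refine ⟨?_, h2⟩
  -- A non-integrable function has integral `0` by convention, so the nonzero value of the integral
  -- yields integrability.
  by_contra hni
  rw [integral_undef hni] at h2
  have : 0 < 2 / b := by positivity
  linarith

lemma integrable_exp_neg_abs {b : ℝ} (hb : 0 < b) :
    Integrable (fun x : ℝ => Real.exp (-(b * |x|))) := (integrable_and_integral_exp_neg_abs hb).1

lemma exp_neg_sq (b t : ℝ) : Real.exp (-(b * t)) ^ 2 = Real.exp (-(2 * b * t)) := by
  rw [← Real.exp_nat_mul]; congr 1; push_cast; ring

lemma memLp_two_of_le_exp {g : ℝ → ℝ} {C b : ℝ} (hg : Continuous g) (hb : 0 < b)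
    (h : ∀ x, |g x| ≤ C * Real.exp (-(b * |x|))) : MemLp g 2 volume := by
  rw [memLp_two_iff_integrable_sq hg.aestronglyMeasurable]
  refine ((integrable_exp_neg_abs (b := 2 * b) (by positivity)).const_mul (C ^ 2)).mono'
    (hg.pow 2).aestronglyMeasurable (Eventually.of_forall fun x => ?_)
  rw [Real.norm_eq_abs, abs_pow, ← exp_neg_sq, ← mul_pow]
  exact pow_le_pow_left₀ (abs_nonneg _) (h x) 2

/-! ### Existence of solitons -/

/-- The right-hand side of the profile equation `η'' = J_c(η)`. -/
noncomputable def profileRHS (f : ℝ → ℝ) (c u : ℝ) : ℝ := firstIntDeriv f u / 2 - c ^ 2 * u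

/-- The derivative of `profileRHS`. -/
noncomputable def profileRHSDeriv (f : ℝ → ℝ) (c u : ℝ) : ℝ :=
  -4 * f (1 - u) - 2 * (1 - u) * deriv f (1 - u) - c ^ 2

lemma Nonlinearity.hasDerivAt_profileRHS {f : ℝ → ℝ} (hf : Nonlinearity f) (c : ℝ) {u : ℝ}
    (h : u < 1) : HasDerivAt (profileRHS f c) (profileRHSDeriv f c u) u := by
  have := ((hf.hasDerivAt_firstIntDeriv h).div_const 2).sub
    ((hasDerivAt_id u).const_mul (c ^ 2))
  refine this.congr_deriv ?_
  simp only [profileRHSDeriv]; ring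

lemma Nonlinearity.continuousAt_profileRHSDeriv {f : ℝ → ℝ} (hf : Nonlinearity f) (c : ℝ) {u : ℝ}
    (h : u < 1) : ContinuousAt (profileRHSDeriv f c) u :=
  ((continuousAt_const.mul (hf.hasDerivAt_one_sub h).continuousAt).sub
    ((continuousAt_const.mul (by fun_prop)).mul
      (hf.hasDerivAt_deriv_one_sub h).continuousAt)).sub continuousAt_const

/-- Uniform bounds for a soliton profile of amplitude `ν²` and decay rate `a ν`. -/
structure SolitonBounds (K a ν : ℝ) (P : Hydro) : Prop where
  pos : ∀ x, 0 < P.1 x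
  le_quarter : ∀ x, P.1 x ≤ 1 / 4
  eta : ∀ k ≤ 3, ∀ x, |iteratedDeriv k P.1 x| ≤ K * ν ^ 2 * Real.exp (-(a * ν * |x|))
  v : ∀ k ≤ 2, ∀ x, |iteratedDeriv k P.2 x| ≤ K * ν ^ 2 * Real.exp (-(a * ν * |x|))

lemma memH1_of_contDiff {u : ℝ → ℝ} (hu : ContDiff ℝ 1 u) (h : MemLp u 2 volume)
    (h' : MemLp (deriv u) 2 volume) : MemH1 u := by
  refine ⟨h, deriv u, h', fun x y => ?_⟩
  have hc : Continuous (deriv u) := hu.continuous_deriv le_rfl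
  exact (intervalIntegral.integral_eq_sub_of_hasDerivAt
    (fun t _ => (hu.differentiable (by norm_num) t).hasDerivAt)
    (hc.intervalIntegrable _ _)).symm

/-- A solution of the profile system yields a soliton, with bounds on all derivatives in terms of
the profile. -/
lemma Nonlinearity.isSoliton_of_profile {f : ℝ → ℝ} (hf : Nonlinearity f) {c δ ν A b B : ℝ}
    {η y : ℝ → ℝ} (hc : 0 < c) (hcs : c < soundSpeed f) (hν : ν ^ 2 = soundSpeed f ^ 2 - c ^ 2)
    (hδ : δ ≤ 1 / 4) (hb : 0 < b) (hB : ∀ u ∈ Icc (0 : ℝ) (1 / 4), |profileRHSDeriv f c u| ≤ B)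
    (hgap : ∀ u ∈ Ioc 0 δ, 0 ≤ speedGap f u) (hgap' : ∀ u ∈ Ioc 0 δ, 0 < speedGapDeriv f u)
    (hη : ∀ x, η x ∈ Ioc 0 δ)
    (hk : ∀ x, speedGap f (η x) = ν ^ 2 - y x ^ 2)
    (hη' : ∀ x, HasDerivAt η (-(η x * y x)) x)
    (hy' : ∀ x, HasDerivAt y (speedGapDeriv f (η x) * η x / 2) x)
    (hdec : ∀ x, η x ≤ A * Real.exp (-(b * |x|))) :
    ∃ v : ℝ → ℝ, IsSoliton f c (η, v) ∧ (∀ x, v x = c * η x / (2 * (1 - η x))) ∧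
      ∃ D : ℝ, D = (1 + soundSpeed f) ^ 3 * (1 + B) * 8 ∧
      (∀ k ≤ 3, ∀ x, |iteratedDeriv k η x| ≤ D * η x) ∧
      ∀ k ≤ 2, ∀ x, |iteratedDeriv k v x| ≤ D * η x := by
  have hs0 := hf.soundSpeed_pos
  set s := soundSpeed f with hs
  have hηpos : ∀ x, 0 < η x := fun x => (hη x).1
  have hη4 : ∀ x, η x ≤ 1 / 4 := fun x => (hη x).2.trans hδ
  have hη1 : ∀ x, η x < 1 := fun x => by linarith [hη4 x]
  have h1η : ∀ x, 1 - η x ≠ 0 := fun x => by linarith [hη4 x]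
  have hB0 : 0 ≤ B := (abs_nonneg _).trans (hB 0 ⟨le_rfl, by norm_num⟩)
  have hysq : ∀ x, y x ^ 2 ≤ s ^ 2 := fun x => by
    have := hgap _ (hη x)
    rw [hk] at this
    nlinarith [sq_nonneg c]
  have hyle : ∀ x, |y x| ≤ s := fun x => abs_le_of_sq_le_sq (hysq x) hs0.le
  have hfirst : ∀ x, (η x * y x) ^ 2 = firstInt f (η x) - c ^ 2 * η x ^ 2 := fun x => by
    have h := hk x
    rw [speedGap, div_eq_iff (pow_ne_zero 2 (hηpos x).ne')] at h
    rw [mul_pow]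
    rw [← hs] at h
    linear_combination h + η x ^ 2 * hν
  -- The identity is checked after multiplication by `η`, where the first integral replaces `η² y²`.
  have hη'' : ∀ x, HasDerivAt (fun x => -(η x * y x)) (profileRHS f c (η x)) x := fun x => by
    refine ((hη' x).mul (hy' x)).neg.congr_deriv ?_
    have h0 := (hηpos x).ne'
    have h := hfirst x
    have h2 : speedGapDeriv f (η x) * η x ^ 3 =
        2 * firstInt f (η x) - η x * firstIntDeriv f (η x) :=
      div_mul_cancel₀ _ (pow_ne_zero 3 h0)
    rw [profileRHS]
    apply mul_left_cancel₀ h0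
    linear_combination h - h2 / 2
  have hηd : deriv η = fun x => -(η x * y x) := funext fun x => (hη' x).deriv
  have hηdd : deriv (deriv η) = fun x => profileRHS f c (η x) := by
    rw [hηd]; exact funext fun x => (hη'' x).deriv
  have hJ : ∀ x, HasDerivAt (fun x => profileRHS f c (η x))
      (profileRHSDeriv f c (η x) * -(η x * y x)) x := fun x =>
    (hf.hasDerivAt_profileRHS c (hη1 x)).comp x (hη' x)
  have hηddd : deriv (deriv (deriv η)) = fun x => profileRHSDeriv f c (η x) * -(η x * y x) := by
    rw [hηdd]; exact funext fun x => (hJ x).deriv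
  have hηc : Continuous η := continuous_iff_continuousAt.2 fun x => (hη' x).continuousAt
  have hyc : Continuous y := continuous_iff_continuousAt.2 fun x => (hy' x).continuousAt
  have hC3 : ContDiff ℝ 3 η := by
    have e1 : ContDiff ℝ 1 (deriv (deriv η)) := by
      rw [contDiff_one_iff_deriv]
      refine ⟨by rw [hηdd]; exact fun x => (hJ x).differentiableAt, ?_⟩
      rw [hηddd]
      refine Continuous.mul ?_ (hηc.mul hyc).neg
      exact continuous_iff_continuousAt.2 fun x =>
        ContinuousAt.comp (f := η) (hf.continuousAt_profileRHSDeriv c (hη1 x)) hηc.continuousAt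
    have e2 : ContDiff ℝ (1 + 1) (deriv η) := by
      rw [contDiff_succ_iff_deriv]
      exact ⟨by rw [hηd]; exact fun x => (hη'' x).differentiableAt, by simp, e1⟩
    have e3 : ContDiff ℝ (2 + 1) η := by
      rw [contDiff_succ_iff_deriv]
      exact ⟨fun x => (hη' x).differentiableAt, by simp, e2.of_le (by norm_num)⟩
    exact e3.of_le (by norm_num)
  set v : ℝ → ℝ := fun x => c * η x / (2 * (1 - η x)) with hv
  have hvd : ∀ x, HasDerivAt v (c * -(η x * y x) / (2 * (1 - η x) ^ 2)) x := fun x => by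
    refine (((hη' x).const_mul c).div (((hη' x).const_sub 1).const_mul 2)
      (mul_ne_zero two_ne_zero (h1η x))).congr_deriv ?_
    have := h1η x
    field_simp
    ring
  have hvdd : ∀ x, HasDerivAt (fun x => c * -(η x * y x) / (2 * (1 - η x) ^ 2))
      (c * profileRHS f c (η x) / (2 * (1 - η x) ^ 2)
        + c * (η x * y x) ^ 2 / (1 - η x) ^ 3) x := fun x => by
    refine (((hη'' x).const_mul c).div ((((hη' x).const_sub 1).pow 2).const_mul 2)
      (mul_ne_zero two_ne_zero (pow_ne_zero 2 (h1η x)))).congr_deriv ?_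
    have := h1η x
    simp only [Pi.pow_apply]
    field_simp
    push_cast
    ring
  have hvc2 : ContDiff ℝ 2 v := by
    have : ContDiff ℝ 2 η := hC3.of_le (by norm_num)
    exact (contDiff_const.mul this).div (contDiff_const.mul (contDiff_const.sub this))
      fun x => mul_ne_zero two_ne_zero (h1η x)
  have hvD : deriv v = fun x => c * -(η x * y x) / (2 * (1 - η x) ^ 2) :=
    funext fun x => (hvd x).deriv
  have hvDD : deriv (deriv v) = fun x => c * profileRHS f c (η x) / (2 * (1 - η x) ^ 2)
        + c * (η x * y x) ^ 2 / (1 - η x) ^ 3 := by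
    rw [hvD]; exact funext fun x => (hvdd x).deriv
  -- bounds
  have b1 : ∀ x, |η x * y x| ≤ s * η x := fun x => by
    rw [abs_mul, abs_of_pos (hηpos x), mul_comm]
    exact mul_le_mul_of_nonneg_right (hyle x) (hηpos x).le
  -- `profileRHS` vanishes at `0`, so the mean value inequality keeps a factor `η`; thus all
  -- derivatives inherit the decay of the profile.
  have b2 : ∀ x, |profileRHS f c (η x)| ≤ B * η x := fun x => by
    have := (convex_Icc (0 : ℝ) (1 / 4)).norm_image_sub_le_of_norm_hasDerivWithin_le
      (f := profileRHS f c) (f' := profileRHSDeriv f c) (C := B) (x := 0) (y := η x)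
      (fun u hu => (hf.hasDerivAt_profileRHS c (by linarith [hu.2])).hasDerivWithinAt)
      hB ⟨le_rfl, by norm_num⟩ ⟨(hηpos x).le, hη4 x⟩
    simpa [profileRHS, firstIntDeriv, potential_one, hf.vanish, abs_of_pos (hηpos x)] using this
  have b3 : ∀ x, |profileRHSDeriv f c (η x) * -(η x * y x)| ≤ B * (s * η x) := fun x => by
    rw [abs_mul, abs_neg]
    exact mul_le_mul (hB _ ⟨(hηpos x).le, hη4 x⟩) (b1 x) (abs_nonneg _) hB0
  have hden : ∀ x, 9 / 16 ≤ (1 - η x) ^ 2 := fun x => by nlinarith [hη4 x]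
  have hden3 : ∀ x, 27 / 64 ≤ (1 - η x) ^ 3 := fun x => by
    have h34 : (3 / 4 : ℝ) ≤ 1 - η x := by linarith [hη4 x]
    calc (27 / 64 : ℝ) = (3 / 4) ^ 3 := by norm_num
      _ ≤ _ := pow_le_pow_left₀ (by norm_num) h34 3
  have d0 : ∀ x, |v x| ≤ s * η x := fun x => by
    have h34 : (3 / 4 : ℝ) ≤ 1 - η x := by linarith [hη4 x]
    have hx := hηpos x
    simp only [hv]
    rw [abs_of_pos (by positivity), div_le_iff₀ (by positivity)]
    have : c * η x ≤ s * η x := mul_le_mul_of_nonneg_right hcs.le hx.le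
    nlinarith [mul_pos hs0 hx]
  have d1 : ∀ x, |c * -(η x * y x) / (2 * (1 - η x) ^ 2)| ≤ s * (s * η x) := fun x => by
    have h := hden x
    rw [abs_div, abs_mul, abs_neg, abs_of_pos hc, abs_of_pos (a := 2 * _) (by positivity),
      div_le_iff₀ (by positivity)]
    have h3 : c * |η x * y x| ≤ s * (s * η x) :=
      mul_le_mul hcs.le (b1 x) (abs_nonneg _) hs0.le
    have : 0 ≤ s * (s * η x) := by have := hηpos x; positivity
    nlinarith
  have d2 : ∀ x, |c * profileRHS f c (η x) / (2 * (1 - η x) ^ 2)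
        + c * (η x * y x) ^ 2 / (1 - η x) ^ 3| ≤ s * (B * η x) + s * (s ^ 2 * η x) := fun x => by
    refine (abs_add_le _ _).trans (add_le_add ?_ ?_)
    · have h := hden x
      rw [abs_div, abs_mul, abs_of_pos hc, abs_of_pos (a := 2 * _) (by positivity),
        div_le_iff₀ (by positivity)]
      have h3 : c * |profileRHS f c (η x)| ≤ s * (B * η x) :=
        mul_le_mul hcs.le (b2 x) (abs_nonneg _) hs0.le
      have : 0 ≤ s * (B * η x) := by have := hηpos x; positivity
      nlinarith
    · have h := hden3 x
      have hx := hηpos x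
      rw [abs_of_nonneg (by positivity), div_le_iff₀ (by positivity)]
      have h3 : (η x * y x) ^ 2 ≤ (s ^ 2 * η x) * (1 / 4) := by
        rw [mul_pow]
        have : η x ^ 2 ≤ η x * (1 / 4) := by nlinarith [hη4 x]
        calc η x ^ 2 * y x ^ 2 ≤ (η x * (1 / 4)) * s ^ 2 :=
              mul_le_mul this (hysq x) (sq_nonneg _) (by positivity)
          _ = _ := by ring
      have h4 : c * (η x * y x) ^ 2 ≤ s * ((s ^ 2 * η x) * (1 / 4)) :=
        mul_le_mul hcs.le h3 (sq_nonneg _) hs0.le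
      have : 0 ≤ s * (s ^ 2 * η x) := by positivity
      nlinarith
  have hA : ∀ x, 0 ≤ A * Real.exp (-(b * |x|)) := fun x => (hηpos x).le.trans (hdec x)
  have hηL : MemLp η 2 volume := memLp_two_of_le_exp hηc hb fun x => by
    rw [abs_of_pos (hηpos x)]; exact hdec x
  have hηdL : MemLp (deriv η) 2 volume := by
    refine memLp_two_of_le_exp (C := s * A) (hC3.continuous_deriv (by norm_num)) hb fun x => ?_
    rw [hηd, abs_neg, mul_assoc]
    exact (b1 x).trans (mul_le_mul_of_nonneg_left (hdec x) hs0.le)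
  have hvL : MemLp v 2 volume := by
    refine memLp_two_of_le_exp (C := s * A) hvc2.continuous hb fun x => ?_
    rw [mul_assoc]
    exact (d0 x).trans (mul_le_mul_of_nonneg_left (hdec x) hs0.le)
  refine ⟨v, ⟨⟨⟨memH1_of_contDiff (hC3.of_le (by norm_num)) hηL hηdL, hvL⟩, hη1⟩, hC3, hvc2,
    ?_, ?_, ?_⟩, fun x => rfl, _, rfl, ?_, ?_⟩
  -- If `η` were constant then `y` would vanish identically, contradicting `y' = k'(η) η / 2 > 0`.
  · by_contra hcon
    push Not at hcon
    have hconst : ∀ x, η x = η 0 := fun x => congrArg Prod.fst (hcon x 0)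
    have hz : ∀ x, y x = 0 := fun x => by
      have h1 : HasDerivAt η 0 x := by
        rw [show η = fun _ => η 0 from funext hconst]; exact hasDerivAt_const _ _
      have := h1.unique (hη' x)
      have h2 : η x * y x = 0 := by linarith
      exact (mul_eq_zero.1 h2).resolve_left (hηpos x).ne'
    have h1 : HasDerivAt y 0 0 := by
      rw [show y = fun _ => (0 : ℝ) from funext hz]; exact hasDerivAt_const _ _
    have h2 := h1.unique (hy' 0)
    have h3 := mul_pos (hgap' _ (hη 0)) (hηpos 0)
    linarith
  · intro x
    have := h1η x
    simp only [hv]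
    field_simp
  · intro x
    have h := hfirst x
    have h1 := h1η x
    have e : iteratedDeriv 2 η x = profileRHS f c (η x) := by
      rw [iteratedDeriv_succ, iteratedDeriv_one, hηdd]
    simp only [e, hηd, neg_sq, h, hv, profileRHS, firstIntDeriv, firstInt]
    field_simp
    ring
  · intro k hk x
    have hx := hηpos x
    have hp : ∀ t : ℝ, t ≤ (1 + s) ^ 3 * (1 + B) * 8 → t * η x ≤ (1 + s) ^ 3 * (1 + B) * 8 * η x :=
      fun t ht => mul_le_mul_of_nonneg_right ht hx.le
    have hs3 : (1 + s) ≤ (1 + s) ^ 3 := le_self_pow₀ (by linarith) (by norm_num)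
    have hsB : 0 ≤ s * B := by positivity
    have hQ : (1 + s) * (1 + B) ≤ (1 + s) ^ 3 * (1 + B) :=
      mul_le_mul_of_nonneg_right hs3 (by linarith)
    interval_cases k
    · rw [iteratedDeriv_zero, abs_of_pos hx]
      calc η x = 1 * η x := (one_mul _).symm
        _ ≤ _ := hp _ (by nlinarith)
    · rw [iteratedDeriv_one, hηd, abs_neg]
      exact (b1 x).trans (hp _ (by nlinarith))
    · rw [iteratedDeriv_succ, iteratedDeriv_one, hηdd]
      exact (b2 x).trans (hp _ (by nlinarith))
    · rw [iteratedDeriv_succ, iteratedDeriv_succ, iteratedDeriv_one, hηddd]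
      refine (b3 x).trans ?_
      rw [← mul_assoc]
      exact hp _ (by nlinarith)
  · intro k hk x
    have hx := hηpos x
    have hp : ∀ t : ℝ, t ≤ (1 + s) ^ 3 * (1 + B) * 8 → t * η x ≤ (1 + s) ^ 3 * (1 + B) * 8 * η x :=
      fun t ht => mul_le_mul_of_nonneg_right ht hx.le
    have hs3 : (1 + s) ≤ (1 + s) ^ 3 := le_self_pow₀ (by linarith) (by norm_num)
    have hsB : 0 ≤ s * B := by positivity
    have hQ : (1 + s) * (1 + B) ≤ (1 + s) ^ 3 * (1 + B) :=
      mul_le_mul_of_nonneg_right hs3 (by linarith)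
    have hQ' : (1 + s) ^ 3 ≤ (1 + s) ^ 3 * (1 + B) :=
      le_mul_of_one_le_right (by positivity) (by linarith)
    interval_cases k
    · rw [iteratedDeriv_zero]
      exact (d0 x).trans (hp _ (by nlinarith))
    · rw [iteratedDeriv_one, hvD]
      refine (d1 x).trans ?_
      rw [← mul_assoc]
      exact hp _ (by nlinarith [pow_pos hs0 3])
    · rw [iteratedDeriv_succ, iteratedDeriv_one, hvDD]
      refine (d2 x).trans ?_
      calc s * (B * η x) + s * (s ^ 2 * η x) = (s * B + s ^ 3) * η x := by ring
        _ ≤ _ := hp _ (by nlinarith [pow_pos hs0 3, pow_pos hs0 2])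

/-- Existence of solitons whose speed is close to the speed of sound. -/
lemma Nonlinearity.exists_soliton {f : ℝ → ℝ} (hf : Nonlinearity f) :
    ∃ δ₀ K : ℝ, 0 < δ₀ ∧ 0 < K ∧ ∀ c : ℝ, 0 < c → c < soundSpeed f →
      soundSpeed f ^ 2 - c ^ 2 < δ₀ → ∃ P : Hydro, IsSoliton f c P ∧
        (∀ x, P.1 (-x) = P.1 x ∧ P.2 (-x) = P.2 x) ∧
        SolitonBounds K (1 / 4) (Real.sqrt (soundSpeed f ^ 2 - c ^ 2)) P ∧
        deriv P.1 0 = 0 ∧ firstInt f (P.1 0) = c ^ 2 * P.1 0 ^ 2 ∧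
        ∀ u ∈ Ioo 0 (P.1 0), firstInt f u ≠ c ^ 2 * u ^ 2 := by
  obtain ⟨δ, hδ, hgap⟩ := hf.exists_isGap
  have hs0 := hf.soundSpeed_pos
  have hm := hgap.mpos
  -- The speed enters `profileRHSDeriv` only through `-c²`, so a bound at `c = 0` plus `c_s²` is
  -- uniform in `c`.
  obtain ⟨B, hB⟩ : ∃ B, ∀ u ∈ Icc (0 : ℝ) (1 / 4), |profileRHSDeriv f 0 u| ≤ B := by
    obtain ⟨B, hB⟩ := (isCompact_Icc (a := (0 : ℝ)) (b := 1 / 4)).exists_bound_of_continuousOn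
      (f := profileRHSDeriv f 0) fun u hu =>
        (hf.continuousAt_profileRHSDeriv 0 (by linarith [hu.2])).continuousWithinAt
    exact ⟨B, hB⟩
  have hB0 : 0 ≤ B := (abs_nonneg _).trans (hB 0 ⟨le_rfl, by norm_num⟩)
  set s := soundSpeed f with hs
  set D := (1 + s) ^ 3 * (1 + (B + s ^ 2)) * 8 with hD
  have hD0 : 0 < D := by positivity
  refine ⟨s ^ 2 / 2 * δ, D * (4 / (s ^ 2 / 2)), mul_pos hm hgap.pos, by positivity,
    fun c hc hcs hνδ => ?_⟩
  have hνp : 0 < s ^ 2 - c ^ 2 := by nlinarith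
  set ν := Real.sqrt (s ^ 2 - c ^ 2) with hν
  have hν2 : ν ^ 2 = s ^ 2 - c ^ 2 := Real.sq_sqrt hνp.le
  have hν0 : 0 < ν := Real.sqrt_pos.2 hνp
  obtain ⟨η, y, h1, h2, h3, h4, h5, h6, h7⟩ := hgap.exists_profile hν0 (hν2 ▸ hνδ)
  -- The decay rate `1 / 4` is `m / M` for the slope bounds `m = c_s² / 2` and `M = 2 c_s²`.
  have hrate : s ^ 2 / 2 / (2 * s ^ 2) = 1 / 4 := by field_simp; norm_num
  rw [hrate] at h7
  have hBc : ∀ u ∈ Icc (0 : ℝ) (1 / 4), |profileRHSDeriv f c u| ≤ B + s ^ 2 := fun u hu => by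
    have e : profileRHSDeriv f c u = profileRHSDeriv f 0 u - c ^ 2 := by
      simp only [profileRHSDeriv]; ring
    rw [e]
    refine (abs_sub _ _).trans (add_le_add (hB u hu) ?_)
    rw [abs_of_nonneg (sq_nonneg c)]
    nlinarith
  obtain ⟨v, hsol, hv, D', hD', e1, e2⟩ := hf.isSoliton_of_profile (b := 1 / 4 * ν) hc hcs hν2 hδ
    (by positivity) hBc
    (fun u hu => (mul_pos hm hu.1).le.trans (hgap.lower u hu))
    (fun u hu => hm.trans_le (hgap.lower' u hu)) h1 h2 h3 h4 h7
  have hDD : D' = D := hD'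
  subst hDD
  have hub : ∀ x, D * η x ≤ D * (4 / (s ^ 2 / 2)) * ν ^ 2 * Real.exp (-(1 / 4 * ν * |x|)) := fun x => by
    have := mul_le_mul_of_nonneg_left (h7 x) hD0.le
    linarith
  have hne : ∀ u : ℝ, u ∈ Ioc 0 δ → firstInt f u = c ^ 2 * u ^ 2 → speedGap f u = ν ^ 2 := by
    intro u hu h
    rw [speedGap, h, hν2, div_eq_iff (pow_ne_zero 2 hu.1.ne')]
    ring
  have hη0 : speedGap f (η 0) = ν ^ 2 := by rw [h2, h6]; ring
  refine ⟨(η, v), hsol, fun x => ⟨h5 x, by simp only [hv, h5]⟩,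
    ⟨fun x => (h1 x).1, fun x => (h1 x).2.trans hδ, fun k hk x => (e1 k hk x).trans (hub x),
      fun k hk x => (e2 k hk x).trans (hub x)⟩, ?_, ?_, ?_⟩
  · show deriv η 0 = 0
    rw [(h3 0).deriv, h6]; ring
  · show firstInt f (η 0) = c ^ 2 * η 0 ^ 2
    rw [speedGap, div_eq_iff (pow_ne_zero 2 (h1 0).1.ne')] at hη0
    linear_combination -hη0 - η 0 ^ 2 * hν2
  -- Strict monotonicity of `k` on `(0, δ]` makes the amplitude the smallest positive zero of `G₀(u)
  -- - c² u²`, the key to uniqueness.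
  · intro u hu h
    have hu' : u ∈ Ioc 0 δ := ⟨hu.1, hu.2.le.trans (h1 0).2⟩
    have h8 := hgap.sub_le hu' (h1 0) hu.2.le
    rw [hne u hu' h, hη0] at h8
    have := mul_pos hm (sub_pos.2 hu.2)
    linarith

/-! ### The Sobolev space `H¹(ℝ)` -/

namespace MemH1

variable {u w : ℝ → ℝ}

lemma _root_.NLSHydro.locallyIntegrable_of_memLp_two {g : ℝ → ℝ} (hg : MemLp g 2 volume) :
    LocallyIntegrable g volume := hg.locallyIntegrable (by norm_num)

lemma _root_.NLSHydro.intervalIntegrable_of_memLp_two {g : ℝ → ℝ} (hg : MemLp g 2 volume)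
    (a b : ℝ) : IntervalIntegrable g volume a b :=
  intervalIntegrable_iff.mpr
    (((locallyIntegrable_of_memLp_two hg).integrableOn_isCompact isCompact_uIcc).mono_set
      uIoc_subset_uIcc)

lemma exists_ae_hasDerivAt (hu : MemH1 u) :
    ∃ g : ℝ → ℝ, MemLp g 2 volume ∧ ∀ᵐ x, HasDerivAt u (g x) x := by
  obtain ⟨-, g, hg, h⟩ := hu
  refine ⟨g, hg, ?_⟩
  filter_upwards [_root_.LocallyIntegrable.ae_hasDerivAt_integral
    (locallyIntegrable_of_memLp_two hg)] with x hx
  have : u = fun y => u 0 + ∫ t in (0 : ℝ)..y, g t := by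
    ext y; rw [← h 0 y]; ring
  rw [this]
  exact (hx 0).const_add _

lemma ae_differentiableAt (hu : MemH1 u) : ∀ᵐ x, DifferentiableAt ℝ u x := by
  obtain ⟨g, -, h⟩ := hu.exists_ae_hasDerivAt
  filter_upwards [h] with x hx using hx.differentiableAt

lemma memLp_deriv (hu : MemH1 u) : MemLp (deriv u) 2 volume := by
  obtain ⟨g, hg, h⟩ := hu.exists_ae_hasDerivAt
  refine (memLp_congr_ae ?_).1 hg
  filter_upwards [h] with x hx using hx.deriv.symm

lemma absolutelyContinuousOnInterval (hu : MemH1 u) (a b : ℝ) :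
    AbsolutelyContinuousOnInterval u a b := by
  obtain ⟨-, g, hg, h⟩ := hu
  have h1 : AbsolutelyContinuousOnInterval (fun x => ∫ t in a..x, g t) a b :=
    (intervalIntegrable_of_memLp_two hg a b).absolutelyContinuousOnInterval_intervalIntegral
      left_mem_uIcc
  have h2 : AbsolutelyContinuousOnInterval (fun _ : ℝ => u a) a b :=
    (contDiff_const (n := 1)).contDiffOn.absolutelyContinuousOnInterval
  have h3 := h2.add h1
  have : ((fun _ : ℝ => u a) + fun x => ∫ t in a..x, g t) = u := by
    ext y
    simp only [Pi.add_apply]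
    rw [← h a y]; ring
  rwa [this] at h3

lemma continuous (hu : MemH1 u) : Continuous u := by
  rw [continuous_iff_continuousAt]
  intro x
  have h := (hu.absolutelyContinuousOnInterval (x - 1) (x + 1)).continuousOn
  refine h.continuousAt ?_
  rw [uIcc_of_le (by linarith)]
  exact Icc_mem_nhds (by linarith) (by linarith)

lemma comp_neg (hu : MemH1 u) : MemH1 fun x => u (-x) := by
  obtain ⟨h0, g, hg, h⟩ := hu
  have mp : MeasurePreserving (fun x : ℝ => -x) volume volume := Measure.measurePreserving_neg _
  refine ⟨h0.comp_measurePreserving mp, fun x => -g (-x),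
    (hg.comp_measurePreserving mp).neg, fun x y => ?_⟩
  rw [h, intervalIntegral.integral_neg, intervalIntegral.integral_comp_neg,
    intervalIntegral.integral_symm]

/-- `u²` is a primitive of the integrable function `2 u u'`, so it has a limit at infinity, and the
integrability of `u²` forces this limit to be `0`. -/
lemma tendsto_atTop (hu : MemH1 u) : Tendsto u atTop (𝓝 0) := by
  have hL := hu.1
  have hL' := hu.memLp_deriv
  have hint : Integrable (fun x => deriv u x * u x + u x * deriv u x) :=
    (hL'.integrable_mul hL).add (hL.integrable_mul hL')
  have h1 := intervalIntegral_tendsto_integral_Ioi (f := fun x => deriv u x * u x + u x * deriv u x)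
    0 hint.integrableOn tendsto_id
  have h2 : ∀ y : ℝ, ∫ x in (0 : ℝ)..y, (deriv u x * u x + u x * deriv u x)
      = u y * u y - u 0 * u 0 := fun y =>
    (hu.absolutelyContinuousOnInterval 0 y).integral_deriv_mul_eq_sub
      (hu.absolutelyContinuousOnInterval 0 y)
  simp only [id, h2] at h1
  have h3 := h1.add_const (u 0 * u 0)
  simp only [sub_add_cancel] at h3
  have hsq : Integrable (fun x => u x * u x) := hL.integrable_mul hL
  have h0 := IntegrableAtFilter.eq_zero_of_tendsto (hsq.integrableAtFilter atTop) (fun s hs => by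
    obtain ⟨b, hb⟩ := mem_atTop_sets.1 hs
    rw [← top_le_iff, ← Real.volume_Ici (a := b)]
    exact measure_mono hb) h3
  rw [h0] at h3
  have h4 : Tendsto (fun x => Real.sqrt (u x * u x)) atTop (𝓝 0) := by
    simpa [Function.comp_def] using (Real.continuous_sqrt.tendsto 0).comp h3
  simp only [Real.sqrt_mul_self_eq_abs] at h4
  exact tendsto_zero_iff_abs_tendsto_zero u |>.2 h4

lemma tendsto_atBot (hu : MemH1 u) : Tendsto u atBot (𝓝 0) := by
  have := hu.comp_neg.tendsto_atTop.comp tendsto_neg_atBot_atTop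
  simpa [Function.comp_def] using this

lemma tendsto_cocompact (hu : MemH1 u) : Tendsto u (cocompact ℝ) (𝓝 0) := by
  rw [cocompact_eq_atBot_atTop]
  exact hu.tendsto_atBot.sup hu.tendsto_atTop

lemma exists_max (hu : MemH1 u) {x₀ : ℝ} (h : 0 < u x₀) : ∃ x, ∀ y, u y ≤ u x :=
  hu.continuous.exists_forall_ge' x₀
    ((hu.tendsto_cocompact.eventually (gt_mem_nhds h)).mono fun _ h => h.le)

lemma neg (hu : MemH1 u) : MemH1 fun x => -u x := by
  obtain ⟨h0, g, hg, h⟩ := hu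
  refine ⟨h0.neg, fun x => -g x, hg.neg, fun x y => ?_⟩
  rw [intervalIntegral.integral_neg, ← h]; ring

lemma add (hu : MemH1 u) (hw : MemH1 w) : MemH1 fun x => u x + w x := by
  obtain ⟨h0, g, hg, h⟩ := hu
  obtain ⟨h0', g', hg', h'⟩ := hw
  refine ⟨h0.add h0', fun x => g x + g' x, hg.add hg', fun x y => ?_⟩
  rw [intervalIntegral.integral_add (intervalIntegrable_of_memLp_two hg _ _)
    (intervalIntegrable_of_memLp_two hg' _ _), ← h, ← h']; ring

/-- A positive supremum is attained because `u` vanishes at infinity. This turns the pointwise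
condition `η < 1` into a uniform distance from vacuum. -/
lemma exists_upper_bound (hu : MemH1 u) {b : ℝ} (hb : 0 < b) (h : ∀ x, u x < b) :
    ∃ b' < b, ∀ x, u x ≤ b' := by
  by_cases hpos : ∃ x, 0 < u x
  · obtain ⟨x₀, hx₀⟩ := hpos
    obtain ⟨x, hx⟩ := hu.exists_max hx₀
    exact ⟨u x, h x, hx⟩
  · push Not at hpos
    exact ⟨0, hb, hpos⟩

lemma exists_bound (hu : MemH1 u) : ∃ B, ∀ x, |u x| ≤ B := by
  have h1 : ∃ B, ∀ x, u x ≤ B := by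
    by_cases hpos : ∃ x, 0 < u x
    · obtain ⟨x₀, hx₀⟩ := hpos
      obtain ⟨x, hx⟩ := hu.exists_max hx₀
      exact ⟨u x, hx⟩
    · push Not at hpos
      exact ⟨0, hpos⟩
  have h2 : ∃ B, ∀ x, -u x ≤ B := by
    by_cases hpos : ∃ x, 0 < -u x
    · obtain ⟨x₀, hx₀⟩ := hpos
      obtain ⟨x, hx⟩ := hu.neg.exists_max hx₀
      exact ⟨-u x, hx⟩
    · push Not at hpos
      exact ⟨0, hpos⟩
  obtain ⟨B1, h1⟩ := h1
  obtain ⟨B2, h2⟩ := h2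
  exact ⟨max B1 B2, fun x => abs_le.2 ⟨by linarith [h2 x, le_max_right B1 B2],
    (h1 x).trans (le_max_left _ _)⟩⟩

/-- Integration by parts in `H¹(ℝ)`. -/
lemma integral_mul_deriv (hu : MemH1 u) (hw : MemH1 w) :
    ∫ x, u x * deriv w x = -∫ x, deriv u x * w x := by
  have i1 : Integrable (fun x => deriv u x * w x) := hu.memLp_deriv.integrable_mul hw.1
  have i2 : Integrable (fun x => u x * deriv w x) := hu.1.integrable_mul hw.memLp_deriv
  have h1 := intervalIntegral_tendsto_integral (i1.add i2)
    (tendsto_neg_atTop_atBot (G := ℝ)) tendsto_id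
  have h2 : ∀ y : ℝ, ∫ x in (-y)..(id y), ((fun x => deriv u x * w x) + fun x => u x * deriv w x) x
      = u y * w y - u (-y) * w (-y) := fun y =>
    (hu.absolutelyContinuousOnInterval (-y) y).integral_deriv_mul_eq_sub
      (hw.absolutelyContinuousOnInterval (-y) y)
  simp only [h2] at h1
  have h3 : Tendsto (fun y : ℝ => u y * w y - u (-y) * w (-y)) atTop (𝓝 0) := by
    simpa using (hu.tendsto_atTop.mul hw.tendsto_atTop).sub
      (hu.comp_neg.tendsto_atTop.mul hw.comp_neg.tendsto_atTop)
  have h4 := tendsto_nhds_unique h1 h3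
  have h5 : ∫ x, ((fun x => deriv u x * w x) + fun x => u x * deriv w x) x =
      (∫ x, deriv u x * w x) + ∫ x, u x * deriv w x := integral_add i1 i2
  rw [h5] at h4
  linarith

end MemH1

/-! ### Uniqueness of solitons -/

namespace IsSoliton

variable {f : ℝ → ℝ} {c : ℝ} {P : Hydro}

lemma hasDerivAt_eta (hP : IsSoliton f c P) (x : ℝ) : HasDerivAt P.1 (deriv P.1 x) x :=
  (hP.smooth_eta.differentiable (by norm_num) x).hasDerivAt

lemma hasDerivAt_deriv_eta (hP : IsSoliton f c P) (x : ℝ) :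
    HasDerivAt (deriv P.1) (iteratedDeriv 2 P.1 x) x := by
  have h := (hP.smooth_eta.differentiable_iteratedDeriv 1 (by norm_num)) x
  rw [iteratedDeriv_succ, iteratedDeriv_one] at *
  exact h.hasDerivAt

lemma v_eq (hP : IsSoliton f c P) (x : ℝ) : P.2 x = c * P.1 x / (2 * (1 - P.1 x)) := by
  have h := hP.eq_one x
  have h1 : 1 - P.1 x ≠ 0 := (sub_pos.2 (hP.mem.2 x)).ne'
  field_simp
  linarith

/-- The quotient `(η'² - G₀(η) + c² η²) / (1 - η)` is conserved by the travelling wave system. Since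
`η → 0`, its constant value is the limit of `η'²`, which vanishes because `η'² ` is integrable. -/
lemma first_integral (hf : Nonlinearity f) (hP : IsSoliton f c P) (x : ℝ) :
    deriv P.1 x ^ 2 = firstInt f (P.1 x) - c ^ 2 * P.1 x ^ 2 := by
  have hlt := hP.mem.2
  have h1 : ∀ x, 1 - P.1 x ≠ 0 := fun x => (sub_pos.2 (hlt x)).ne'
  set I : ℝ → ℝ := fun x => (deriv P.1 x ^ 2 - firstInt f (P.1 x) + c ^ 2 * P.1 x ^ 2)
    / (1 - P.1 x) with hI
  have hd : ∀ x, HasDerivAt I 0 x := fun x => by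
    have e1 := hP.hasDerivAt_eta x
    have e2 := hP.hasDerivAt_deriv_eta x
    have e3 := (hf.hasDerivAt_firstInt (hlt x)).comp x e1
    refine ((((e2.pow 2).sub e3).add ((e1.pow 2).const_mul (c ^ 2))).div (e1.const_sub 1)
      (h1 x)).congr_deriv ?_
    have e4 := hP.eq_two x
    rw [hP.v_eq x] at e4
    have hx := h1 x
    simp only [Pi.add_apply, Pi.sub_apply, Pi.pow_apply, Function.comp, firstIntDeriv, firstInt]
    field_simp at e4 ⊢
    push_cast
    linear_combination deriv P.1 x / 4 * e4
  have hconst : ∀ x, I x = I 0 := fun x =>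
    is_const_of_deriv_eq_zero (fun x => (hd x).differentiableAt) (fun x => (hd x).deriv) x 0
  have hH := hP.mem.1.1
  have hsq : ∀ x, deriv P.1 x ^ 2 =
      I 0 * (1 - P.1 x) + firstInt f (P.1 x) - c ^ 2 * P.1 x ^ 2 := fun x => by
    have := hconst x
    simp only [hI] at this
    rw [div_eq_iff (h1 x)] at this
    linear_combination this
  have hlim : Tendsto (fun x => deriv P.1 x ^ 2) atTop (𝓝 (I 0)) := by
    have t := hH.tendsto_atTop
    have tf : Tendsto (fun x => firstInt f (P.1 x)) atTop (𝓝 0) := by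
      have := (hf.hasDerivAt_firstInt one_pos).continuousAt.tendsto.comp t
      simpa [firstInt, Nonlinearity.potential_one, Function.comp_def] using this
    have := (((t.const_sub 1).const_mul (I 0)).add tf).sub ((t.pow 2).const_mul (c ^ 2))
    simp only [← hsq] at this
    simpa using this
  have hint : Integrable (fun x => deriv P.1 x ^ 2) := hH.memLp_deriv.integrable_sq
  have h0 := IntegrableAtFilter.eq_zero_of_tendsto (hint.integrableAtFilter atTop) (fun s hs => by
    obtain ⟨b, hb⟩ := mem_atTop_sets.1 hs
    rw [← top_le_iff, ← Real.volume_Ici (a := b)]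
    exact measure_mono hb) hlim
  rw [hsq, h0]; ring

/-- Eliminating `v` by the first equation and `η'²` by the first integral leaves an autonomous
equation without first order term. -/
lemma profile_eq (hf : Nonlinearity f) (hP : IsSoliton f c P) (x : ℝ) :
    HasDerivAt (deriv P.1) (profileRHS f c (P.1 x)) x := by
  refine (hP.hasDerivAt_deriv_eta x).congr_deriv ?_
  have e := hP.eq_two x
  have h1 : 1 - P.1 x ≠ 0 := (sub_pos.2 (hP.mem.2 x)).ne'
  rw [hP.v_eq x, hP.first_integral hf x, firstInt] at e
  rw [profileRHS, firstIntDeriv]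
  field_simp at e
  have h2 : (1 - P.1 x) * 4 ≠ 0 := by simpa using h1
  apply mul_left_cancel₀ h2
  linear_combination e / 2

/-- A soliton attains every positive value below its maximum, which is a zero of the first
integral. -/
lemma exists_max_eta (hf : Nonlinearity f) (hc : 0 < c) (hcs : c < soundSpeed f)
    (hP : IsSoliton f c P) : (∀ x, 0 ≤ P.1 x) ∧
      ∃ x₁, 0 < P.1 x₁ ∧ (∀ x, P.1 x ≤ P.1 x₁) ∧ firstInt f (P.1 x₁) = c ^ 2 * P.1 x₁ ^ 2 := by
  have hH := hP.mem.1.1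
  have hcrit : ∀ x, deriv P.1 x = 0 → firstInt f (P.1 x) = c ^ 2 * P.1 x ^ 2 := fun x hx => by
    have := hP.first_integral hf x
    rw [hx] at this
    linear_combination -this
  have hnn : ∀ x, 0 ≤ P.1 x := by
    by_contra hneg
    push Not at hneg
    obtain ⟨x₀, hx₀⟩ := hneg
    obtain ⟨x, hx⟩ := hH.neg.exists_max (x₀ := x₀) (by linarith)
    -- At a negative minimum `u`, the first integral would give `c² u² = G₀(u) ≥ c_s² (1 - u) u² >
    -- c² u²`.
    have hmin : IsLocalMin P.1 x := Eventually.of_forall fun y => by linarith [hx y]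
    have h1 := hcrit x hmin.deriv_eq_zero
    have hlt : P.1 x < 0 := by linarith [hx x₀]
    have h2 := hf.lower (1 - P.1 x) (by linarith)
    rw [sub_sub_cancel] at h2
    rw [firstInt] at h1
    have h3 : 4 * (1 - P.1 x) * (soundSpeed f ^ 2 / 4 * P.1 x ^ 2) ≤
        4 * (1 - P.1 x) * potential f (1 - P.1 x) :=
      mul_le_mul_of_nonneg_left h2 (by linarith)
    have h4 : c ^ 2 < soundSpeed f ^ 2 := by nlinarith
    have h5 : 0 < P.1 x ^ 2 := by have := hlt.ne; positivity
    have h6 := mul_lt_mul_of_pos_right h4 h5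
    have h7 : 0 ≤ -P.1 x * (soundSpeed f ^ 2 * P.1 x ^ 2) :=
      mul_nonneg (by linarith) (by positivity)
    nlinarith
  refine ⟨hnn, ?_⟩
  obtain ⟨x₀, hx₀⟩ : ∃ x, 0 < P.1 x := by
    by_contra hcon
    push Not at hcon
    have hz : ∀ x, P.1 x = 0 := fun x => le_antisymm (hcon x) (hnn x)
    obtain ⟨x, y, hxy⟩ := hP.nonconst
    exact hxy (by simp [hP.v_eq, hz])
  obtain ⟨x, hx⟩ := hH.exists_max hx₀
  have hmax : IsLocalMax P.1 x := Eventually.of_forall fun y => hx y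
  exact ⟨x, hx₀.trans_le (hx x₀), hx, hcrit x hmax.deriv_eq_zero⟩

/-- Uniqueness of the soliton of speed `c` up to translations. -/
lemma eq_translate {Q : Hydro} (hf : Nonlinearity f) (hc : 0 < c) (hcs : c < soundSpeed f)
    (hP : IsSoliton f c P) (hQ : IsSoliton f c Q) (hQ0 : deriv Q.1 0 = 0) (hpos : 0 < Q.1 0)
    (hfst : firstInt f (Q.1 0) = c ^ 2 * Q.1 0 ^ 2)
    (hne : ∀ u ∈ Ioo 0 (Q.1 0), firstInt f u ≠ c ^ 2 * u ^ 2) :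
    ∃ a : ℝ, P = translate a Q := by
  obtain ⟨hPn, x₁, hx₁, hPmax, hx₁'⟩ := hP.exists_max_eta hf hc hcs
  obtain ⟨hQn, y₁, -, hQmax, -⟩ := hQ.exists_max_eta hf hc hcs
  -- The maximum of `P.1` is a positive zero of the first integral, and `Q.1 0` is the smallest one.
  -- By continuity `P.1` takes the value `Q.1 0`, and its slope vanishes there.
  have hle : Q.1 0 ≤ P.1 x₁ := by
    by_contra hlt
    push Not at hlt
    exact hne _ ⟨hx₁, hlt⟩ hx₁'
  obtain ⟨x₃, hx₃⟩ : ∃ x, P.1 x < Q.1 0 :=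
    (hP.mem.1.1.tendsto_atTop.eventually (gt_mem_nhds hpos)).exists
  obtain ⟨x₂, hx₂⟩ := mem_range_of_exists_le_of_exists_ge hP.mem.1.1.continuous
    ⟨x₃, hx₃.le⟩ ⟨x₁, hle⟩
  have hd₂ : deriv P.1 x₂ = 0 := by
    have := hP.first_integral hf x₂
    rw [hx₂, hfst, sub_self] at this
    exact pow_eq_zero_iff two_ne_zero |>.1 this
  set r := max (P.1 x₁) (Q.1 y₁) with hr
  have hr1 : r < 1 := max_lt (hP.mem.2 _) (hQ.mem.2 _)
  obtain ⟨B, hB⟩ := (isCompact_Icc (a := (0 : ℝ)) (b := r)).exists_bound_of_continuousOn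
    (f := profileRHSDeriv f c) fun u hu =>
      (hf.continuousAt_profileRHSDeriv c (hu.2.trans_lt hr1)).continuousWithinAt
  -- The vector field is controlled only away from `u = 1`; the strip `[0, r] × ℝ` with `r < 1`
  -- contains both trajectories.
  have hlip : ∀ t : ℝ, LipschitzOnWith (Real.toNNReal (max 1 B))
      (fun z : ℝ × ℝ => (z.2, profileRHS f c z.1)) (Icc 0 r ×ˢ univ) := fun _ => by
    refine LipschitzOnWith.of_dist_le_mul fun z hz w hw => ?_
    rw [Real.coe_toNNReal _ (by positivity), Prod.dist_eq]
    refine max_le ?_ ?_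
    · calc dist z.2 w.2 ≤ dist z w := le_max_right _ _
        _ ≤ max 1 B * dist z w := le_mul_of_one_le_left dist_nonneg (le_max_left _ _)
    · have := (convex_Icc (0 : ℝ) r).norm_image_sub_le_of_norm_hasDerivWithin_le
        (f := profileRHS f c) (f' := profileRHSDeriv f c) (C := B)
        (fun u hu => (hf.hasDerivAt_profileRHS c (hu.2.trans_lt hr1)).hasDerivWithinAt)
        hB hw.1 hz.1
      calc dist (profileRHS f c z.1) (profileRHS f c w.1) ≤ B * dist z.1 w.1 := this
        _ ≤ max 1 B * dist z w :=
          mul_le_mul (le_max_right _ _) (le_max_left _ _) dist_nonneg (by positivity)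
  have heq := ODE_solution_unique_univ (t₀ := x₂)
    (f := fun x => (P.1 x, deriv P.1 x)) (g := fun x => (Q.1 (x - x₂), deriv Q.1 (x - x₂)))
    (v := fun _ z => (z.2, profileRHS f c z.1)) (s := fun _ => Icc 0 r ×ˢ univ) hlip
    (fun t => ⟨(hP.hasDerivAt_eta t).prodMk (hP.profile_eq hf t),
      ⟨⟨hPn t, (hPmax t).trans (le_max_left _ _)⟩, mem_univ _⟩⟩)
    (fun t => ⟨((hQ.hasDerivAt_eta (t - x₂)).comp_sub_const t x₂).prodMk
      ((hQ.profile_eq hf (t - x₂)).comp_sub_const t x₂),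
      ⟨⟨hQn _, (hQmax _).trans (le_max_right _ _)⟩, mem_univ _⟩⟩)
    (by simp [hx₂, hd₂, hQ0])
  have hη : ∀ x, P.1 x = Q.1 (x - x₂) := fun x => congrArg Prod.fst (congrFun heq x)
  refine ⟨x₂, Prod.ext (funext hη) (funext fun x => ?_)⟩
  rw [hP.v_eq, hη]
  exact (hQ.v_eq (x - x₂)).symm

end IsSoliton

/-- The branch of solitons near the speed of sound, with uniform bounds. -/
lemma Nonlinearity.exists_branch {f : ℝ → ℝ} (hf : Nonlinearity f) :
    ∃ (c₀ : ℝ) (Q : ℝ → Hydro) (K : ℝ), 0 < c₀ ∧ c₀ < soundSpeed f ∧ 0 < K ∧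
      IsSolitonBranch f c₀ Q ∧ ∀ c ∈ Ioo c₀ (soundSpeed f),
        SolitonBounds K (1 / 4) (Real.sqrt (soundSpeed f ^ 2 - c ^ 2)) (Q c) := by
  obtain ⟨δ₀, K, hδ₀, hK, h⟩ := hf.exists_soliton
  have hs0 := hf.soundSpeed_pos
  set s := soundSpeed f with hs
  -- The second entry ensures `c_s² - c² ≤ 2 c_s (c_s - c) < δ₀`; the first one keeps `c₀` positive.
  set c₀ := max (s / 2) (s - δ₀ / (2 * s)) with hc₀
  have hc₀0 : 0 < c₀ := lt_max_of_lt_left (by positivity)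
  have hc₀s : c₀ < s := max_lt (by linarith) (sub_lt_self _ (by positivity))
  have hex : ∀ c : ℝ, ∃ P : Hydro, c ∈ Ioo c₀ s → IsSoliton f c P ∧
        (∀ x, P.1 (-x) = P.1 x ∧ P.2 (-x) = P.2 x) ∧
        SolitonBounds K (1 / 4) (Real.sqrt (s ^ 2 - c ^ 2)) P ∧
        deriv P.1 0 = 0 ∧ firstInt f (P.1 0) = c ^ 2 * P.1 0 ^ 2 ∧
        ∀ u ∈ Ioo 0 (P.1 0), firstInt f u ≠ c ^ 2 * u ^ 2 := by
    intro c
    by_cases hc : c ∈ Ioo c₀ s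
    · have hc0 : 0 < c := hc₀0.trans hc.1
      obtain ⟨P, hP⟩ := h c hc0 hc.2 (by
        have h1 : s - δ₀ / (2 * s) < c := (le_max_right _ _).trans_lt hc.1
        have h2 : (s - c) * (2 * s) < δ₀ := by
          rw [← lt_div_iff₀ (by positivity)]; linarith
        nlinarith [hc.2])
      exact ⟨P, fun _ => hP⟩
    · exact ⟨0, fun h => absurd h hc⟩
  choose Q hQ using hex
  refine ⟨c₀, Q, K, hc₀0, hc₀s, hK, fun c hc => ?_, fun c hc => (hQ c hc).2.2.1⟩
  obtain ⟨q1, q2, q3, q4, q5, q6⟩ := hQ c hc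
  exact ⟨q1, q2, fun P hP => hP.eq_translate hf (hc₀0.trans hc.1) hc.2 q1 q4 (q3.pos 0) q5 q6⟩

/-- Pointwise bounds on the branch imply the uniform exponential decay. -/
lemma hasDecay_of_bounds {f : ℝ → ℝ} {c₀ K a a_d : ℝ} {Q : ℝ → Hydro} (hc₀ : 0 < c₀)
    (ha : a_d ≤ a)
    (h : ∀ c ∈ Ioo c₀ (soundSpeed f),
      SolitonBounds K a (Real.sqrt (soundSpeed f ^ 2 - c ^ 2)) (Q c)) :
    HasDecay f c₀ Q a_d (12 * (K * (1 + (1 + soundSpeed f) ^ 5))) := by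
  intro c hc x
  have hc0 : 0 < c := hc₀.trans hc.1
  have hνp : 0 < soundSpeed f ^ 2 - c ^ 2 := by nlinarith [hc.2]
  have hb := h c hc
  set s := soundSpeed f with hs
  set ν := Real.sqrt (s ^ 2 - c ^ 2) with hν
  have hν2 : ν ^ 2 = s ^ 2 - c ^ 2 := Real.sq_sqrt hνp.le
  have hν0 : 0 < ν := Real.sqrt_pos.2 hνp
  have hK : 0 ≤ K := by
    have h1 := (abs_nonneg _).trans (hb.eta 0 (by norm_num) 0)
    have h2 : 0 < ν ^ 2 * Real.exp (-(a * ν * |0|)) := by positivity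
    rw [mul_assoc] at h1
    exact nonneg_of_mul_nonneg_left h1 h2
  have hexp : Real.exp (-(a * ν * |x|)) ≤ Real.exp (-a_d * ν * |x|) := by
    apply Real.exp_le_exp.2
    have : a_d * (ν * |x|) ≤ a * (ν * |x|) := mul_le_mul_of_nonneg_right ha (by positivity)
    linarith
  set E := Real.exp (-a_d * ν * |x|) with hE
  -- Each of the `4 · 3 = 12` terms is bounded separately: the prefactor cancels `ν²`, and `c ^ (1 +
  -- 2 k₂) ≤ (1 + c_s) ^ 5` since `k₂ ≤ 2`.
  have hterm : ∀ k₁ ∈ Finset.range 4, ∀ k₂ ∈ Finset.range 3, (s ^ 2 - c ^ 2)⁻¹ *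
      (|iteratedDeriv k₁ (Q c).1 x| + c ^ (1 + 2 * k₂) * |iteratedDeriv k₂ (Q c).2 x|) ≤
      K * (1 + (1 + s) ^ 5) * E := by
    intro k₁ hk₁ k₂ hk₂
    have h1 := hb.eta k₁ (by have := Finset.mem_range.1 hk₁; omega) x
    have h2 := hb.v k₂ (by have := Finset.mem_range.1 hk₂; omega) x
    have h3 : c ^ (1 + 2 * k₂) ≤ (1 + s) ^ 5 := by
      calc c ^ (1 + 2 * k₂) ≤ (1 + s) ^ (1 + 2 * k₂) :=
            pow_le_pow_left₀ hc0.le (by linarith [hc.2]) _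
        _ ≤ (1 + s) ^ 5 := pow_le_pow_right₀ (by linarith [hc.2])
            (by have := Finset.mem_range.1 hk₂; omega)
    have hKE : K * ν ^ 2 * Real.exp (-(a * ν * |x|)) ≤ K * ν ^ 2 * E :=
      mul_le_mul_of_nonneg_left hexp (by positivity)
    rw [← hν2, ← div_eq_inv_mul, div_le_iff₀ (by positivity)]
    have h4 : c ^ (1 + 2 * k₂) * |iteratedDeriv k₂ (Q c).2 x| ≤ (1 + s) ^ 5 * (K * ν ^ 2 * E) :=
      mul_le_mul h3 (h2.trans hKE) (abs_nonneg _) (by have := hc0.trans hc.2; positivity)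
    linarith
  calc _ ≤ ∑ k₁ ∈ Finset.range 4, ∑ k₂ ∈ Finset.range 3, K * (1 + (1 + s) ^ 5) * E :=
        Finset.sum_le_sum fun k₁ h₁ => Finset.sum_le_sum fun k₂ h₂ => hterm k₁ h₁ k₂ h₂
    _ = _ := by simp; ring

/-! ### Densities of the energy and of its differentials -/

/-- The energy density. -/
noncomputable def dens0 (f : ℝ → ℝ) (u p v : ℝ) : ℝ :=
  p ^ 2 / (8 * (1 - u)) + (1 - u) * v ^ 2 / 2 + potential f (1 - u) / 2

/-- The density of the first differential of the energy in the direction `(a, q, w)`. -/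
noncomputable def dens1 (f : ℝ → ℝ) (u p v a q w : ℝ) : ℝ :=
  p * q / (4 * (1 - u)) + p ^ 2 * a / (8 * (1 - u) ^ 2) - a * v ^ 2 / 2 + (1 - u) * v * w
    + f (1 - u) * a / 2

/-- The density of the second differential of the energy in the direction `(a, q, w)`. -/
noncomputable def dens2 (f : ℝ → ℝ) (u p v a q w : ℝ) : ℝ :=
  (q + p * a / (1 - u)) ^ 2 / (4 * (1 - u)) - 2 * a * v * w + (1 - u) * w ^ 2
    - deriv f (1 - u) * a ^ 2 / 2

/-- The density of the third differential of the energy in the direction `(a, q, w)`. -/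
noncomputable def dens3 (f : ℝ → ℝ) (u p _v a q w : ℝ) : ℝ :=
  3 * a * (q + p * a / (1 - u)) ^ 2 / (4 * (1 - u) ^ 2) - 3 * a * w ^ 2
    + deriv (deriv f) (1 - u) * a ^ 3 / 2

section Densities

variable {f : ℝ → ℝ} {u p v a q w : ℝ}

lemma hasDerivAt_line (u a s : ℝ) : HasDerivAt (fun s : ℝ => u + s * a) a s := by
  simpa using ((hasDerivAt_id s).mul_const a).const_add u

lemma hasDerivAt_dens0 (hf : Nonlinearity f) {s : ℝ} (h : u + s * a < 1) :
    HasDerivAt (fun s => dens0 f (u + s * a) (p + s * q) (v + s * w))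
      (dens1 f (u + s * a) (p + s * q) (v + s * w) a q w) s := by
  have hu := hasDerivAt_line u a s
  have hp := hasDerivAt_line p q s
  have hv := hasDerivAt_line v w s
  have h1 : 1 - (u + s * a) ≠ 0 := (sub_pos.2 h).ne'
  refine (((hp.pow 2).div ((hu.const_sub 1).const_mul 8) (mul_ne_zero (by norm_num) h1)).add
    (((hu.const_sub 1).mul (hv.pow 2)).div_const 2) |>.add
    (((hf.hasDerivAt_potential_one_sub h).comp s hu).div_const 2)).congr_deriv ?_
  simp only [dens1, Pi.pow_apply]
  field_simp
  push_cast
  ring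

lemma hasDerivAt_dens1 (hf : Nonlinearity f) {s : ℝ} (h : u + s * a < 1) :
    HasDerivAt (fun s => dens1 f (u + s * a) (p + s * q) (v + s * w) a q w)
      (dens2 f (u + s * a) (p + s * q) (v + s * w) a q w) s := by
  have hu := hasDerivAt_line u a s
  have hp := hasDerivAt_line p q s
  have hv := hasDerivAt_line v w s
  have h1 : 1 - (u + s * a) ≠ 0 := (sub_pos.2 h).ne'
  refine ((((((hp.mul_const q).div ((hu.const_sub 1).const_mul 4)
      (mul_ne_zero (by norm_num) h1)).add
    (((hp.pow 2).mul_const a).div (((hu.const_sub 1).pow 2).const_mul 8)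
      (mul_ne_zero (by norm_num) (pow_ne_zero 2 h1)))).sub
    (((hv.pow 2).const_mul a).div_const 2)).add
    (((hu.const_sub 1).mul hv).mul_const w)).add
    ((((hf.hasDerivAt_one_sub h).comp s hu).mul_const a).div_const 2)).congr_deriv ?_
  simp only [dens2, Pi.pow_apply]
  field_simp
  push_cast
  ring

lemma hasDerivAt_dens2 (hf : Nonlinearity f) {s : ℝ} (h : u + s * a < 1) :
    HasDerivAt (fun s => dens2 f (u + s * a) (p + s * q) (v + s * w) a q w)
      (dens3 f (u + s * a) (p + s * q) (v + s * w) a q w) s := by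
  have hu := hasDerivAt_line u a s
  have hp := hasDerivAt_line p q s
  have hv := hasDerivAt_line v w s
  have h1 : 1 - (u + s * a) ≠ 0 := (sub_pos.2 h).ne'
  have hr : HasDerivAt (fun s => q + (p + s * q) * a / (1 - (u + s * a)))
      (a * (q + (p + s * q) * a / (1 - (u + s * a))) / (1 - (u + s * a))) s := by
    refine (((hp.mul_const a).div (hu.const_sub 1) h1).const_add q).congr_deriv ?_
    generalize 1 - (u + s * a) = d at h1
    field_simp
    ring
  refine (((((hr.pow 2).div ((hu.const_sub 1).const_mul 4) (mul_ne_zero (by norm_num) h1)).sub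
    ((hv.const_mul (2 * a)).mul_const w)).add
    ((hu.const_sub 1).mul_const (w ^ 2))).sub
    ((((hf.hasDerivAt_deriv_one_sub h).comp s hu).mul_const (a ^ 2)).div_const 2)).congr_deriv ?_
  simp only [dens3, Pi.pow_apply]
  generalize q + (p + s * q) * a / (1 - (u + s * a)) = r
  generalize 1 - (u + s * a) = d at h1
  field_simp
  push_cast
  ring

lemma continuousAt_dens3 (hf : Nonlinearity f) {s : ℝ} (h : u + s * a < 1) :
    ContinuousAt (fun s => dens3 f (u + s * a) (p + s * q) (v + s * w) a q w) s := by
  have h1 : 1 - (u + s * a) ≠ 0 := (sub_pos.2 h).ne'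
  have hc : ContinuousAt (fun s => deriv (deriv f) (1 - (u + s * a))) s :=
    ContinuousAt.comp (f := fun s => 1 - (u + s * a))
      (hf.continuousAt_deriv_deriv (sub_pos.2 h)) (by fun_prop)
  have hl : ContinuousAt (fun s => 1 - (u + s * a)) s := by fun_prop
  have hr : ContinuousAt (fun s => q + (p + s * q) * a / (1 - (u + s * a))) s :=
    continuousAt_const.add (ContinuousAt.div (by fun_prop) hl h1)
  exact (((continuousAt_const.mul (hr.pow 2)).div (continuousAt_const.mul (hl.pow 2))
    (mul_ne_zero (by norm_num) (pow_ne_zero 2 h1))).sub (by fun_prop)).add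
    ((hc.mul continuousAt_const).div_const 2)

/-- The derivatives of `f` are bounded by compactness of `[-B, b]`, which avoids the vacuum `u = 1`.
The mean value inequality, used once for `f` and again for `F`, yields the linear and quadratic
vanishing at `u = 0`. -/
lemma exists_nonlinearity_bound (hf : Nonlinearity f) {B b : ℝ} (hB : 0 ≤ B) (hb0 : 0 ≤ b)
    (hb : b < 1) : ∃ C, 0 ≤ C ∧ ∀ u ∈ Icc (-B) b, |potential f (1 - u)| ≤ C * u ^ 2 ∧
      |f (1 - u)| ≤ C * |u| ∧ |deriv f (1 - u)| ≤ C ∧ |deriv (deriv f) (1 - u)| ≤ C := by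
  have hlt : ∀ u ∈ Icc (-B) b, u < 1 := fun u hu => hu.2.trans_lt hb
  obtain ⟨C1, h1⟩ := (isCompact_Icc (a := -B) (b := b)).exists_bound_of_continuousOn
    (f := fun u => deriv f (1 - u))
    fun u hu => (hf.hasDerivAt_deriv_one_sub (hlt u hu)).continuousAt.continuousWithinAt
  obtain ⟨C2, h2⟩ := (isCompact_Icc (a := -B) (b := b)).exists_bound_of_continuousOn
    (f := fun u => deriv (deriv f) (1 - u))
    fun u hu => (ContinuousAt.comp (f := fun u : ℝ => 1 - u)
      (hf.continuousAt_deriv_deriv (sub_pos.2 (hlt u hu))) (by fun_prop)).continuousWithinAt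
  have hmem0 : (0 : ℝ) ∈ Icc (-B) b := ⟨by linarith, hb0⟩
  have hC1 : 0 ≤ C1 := (norm_nonneg _).trans (h1 0 hmem0)
  have hC2 : 0 ≤ C2 := (norm_nonneg _).trans (h2 0 hmem0)
  have hf1 : ∀ u ∈ Icc (-B) b, |f (1 - u)| ≤ C1 * |u| := fun u hu => by
    have := (convex_Icc (-B) b).norm_image_sub_le_of_norm_hasDerivWithin_le
      (f := fun u => f (1 - u)) (C := C1)
      (fun t ht => (hf.hasDerivAt_one_sub (hlt t ht)).hasDerivWithinAt)
      (fun t ht => by rw [norm_neg]; exact h1 t ht) hmem0 hu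
    simpa [hf.vanish] using this
  refine ⟨C1 + C2, by positivity, fun u hu => ⟨?_, ?_, ?_, ?_⟩⟩
  · have hsub : uIcc 0 u ⊆ Icc (-B) b := (convex_Icc (-B) b).ordConnected.uIcc_subset hmem0 hu
    have := (convex_uIcc 0 u).norm_image_sub_le_of_norm_hasDerivWithin_le
      (f := fun u => potential f (1 - u)) (C := C1 * |u|)
      (fun t ht => (hf.hasDerivAt_potential_one_sub (hlt t (hsub ht))).hasDerivWithinAt)
      (fun t ht => (hf1 t (hsub ht)).trans (mul_le_mul_of_nonneg_left (by
        simpa using abs_sub_left_of_mem_uIcc ht) hC1)) left_mem_uIcc right_mem_uIcc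
    simp only [sub_zero, Nonlinearity.potential_one, Real.norm_eq_abs] at this
    rw [mul_assoc, abs_mul_abs_self, ← pow_two] at this
    nlinarith [sq_nonneg u]
  · nlinarith [hf1 u hu, abs_nonneg u]
  · have := h1 u hu
    simp only [Real.norm_eq_abs] at this
    linarith
  · have := h2 u hu
    simp only [Real.norm_eq_abs] at this
    linarith

lemma abs_mul_le_half_sq (x y : ℝ) : |x * y| ≤ (x ^ 2 + y ^ 2) / 2 := by
  rw [abs_mul]
  nlinarith [sq_nonneg (|x| - |y|), sq_abs x, sq_abs y]

set_option maxHeartbeats 1000000 in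
/-- All densities are bounded by a quadratic expression. -/
lemma exists_dens_bound (hf : Nonlinearity f) {B b : ℝ} (hB : 0 ≤ B) (hb0 : 0 ≤ b) (hb : b < 1) :
    ∃ C, 0 ≤ C ∧ ∀ u p v a q w : ℝ, u ∈ Icc (-B) b → |a| ≤ B →
      |dens0 f u p v| ≤ C * (u ^ 2 + p ^ 2 + v ^ 2 + a ^ 2 + q ^ 2 + w ^ 2) ∧
      |dens1 f u p v a q w| ≤ C * (u ^ 2 + p ^ 2 + v ^ 2 + a ^ 2 + q ^ 2 + w ^ 2) ∧
      |dens2 f u p v a q w| ≤ C * (u ^ 2 + p ^ 2 + v ^ 2 + a ^ 2 + q ^ 2 + w ^ 2) ∧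
      |dens3 f u p v a q w| ≤ C * (u ^ 2 + p ^ 2 + v ^ 2 + a ^ 2 + q ^ 2 + w ^ 2) := by
  obtain ⟨C, hC, hCb⟩ := exists_nonlinearity_bound hf hB hb0 hb
  set D := (1 - b)⁻¹ with hD
  have hD0 : 0 < D := inv_pos.2 (sub_pos.2 hb)
  -- The constant adds up the majorants `t1`–`t15` of the individual monomials; the bound on `a`
  -- reduces terms of higher degree to quadratic ones.
  refine ⟨C * (1 + B) + D + (1 + B) + B * D ^ 2 + (D + 3 * B * D ^ 2) * (2 + 2 * B ^ 2 * D ^ 2)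
    + 3 * B, by positivity, ?_⟩
  intro u p v a q w hu ha
  obtain ⟨c1, c2, c3, c4⟩ := hCb u hu
  have hpos : 0 < 1 - u := by linarith [hu.2]
  set i := (1 - u)⁻¹ with hi
  have hi0 : 0 < i := inv_pos.2 hpos
  have hiD : i ≤ D := inv_anti₀ (sub_pos.2 hb) (by linarith [hu.2])
  have hi2 : i ^ 2 ≤ D ^ 2 := pow_le_pow_left₀ hi0.le hiD 2
  have hu1 : 1 - u ≤ 1 + B := by linarith [hu.1]
  have e0 : dens0 f u p v = p ^ 2 * i / 8 + (1 - u) * v ^ 2 / 2 + potential f (1 - u) / 2 := by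
    rw [dens0, hi]; field_simp
  have e1 : dens1 f u p v a q w = p * q * i / 4 + p ^ 2 * a * i ^ 2 / 8 - a * v ^ 2 / 2
      + (1 - u) * (v * w) + f (1 - u) * a / 2 := by
    rw [dens1, hi]; field_simp
  have e2 : dens2 f u p v a q w = (q + p * a * i) ^ 2 * i / 4 - 2 * a * (v * w) + (1 - u) * w ^ 2
      - deriv f (1 - u) * a ^ 2 / 2 := by
    rw [dens2, hi]; field_simp
  have e3 : dens3 f u p v a q w = 3 * a * (q + p * a * i) ^ 2 * i ^ 2 / 4 - 3 * a * w ^ 2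
      + deriv (deriv f) (1 - u) * a ^ 3 / 2 := by
    rw [dens3, hi]; field_simp
  set W := u ^ 2 + p ^ 2 + v ^ 2 + a ^ 2 + q ^ 2 + w ^ 2 with hW
  have su := sq_nonneg u
  have sp := sq_nonneg p
  have sv := sq_nonneg v
  have sa := sq_nonneg a
  have sq := sq_nonneg q
  have sw := sq_nonneg w
  have hW0 : 0 ≤ W := by positivity
  have huW : u ^ 2 ≤ W := by rw [hW]; linarith
  have hpW : p ^ 2 ≤ W := by rw [hW]; linarith
  have hvW : v ^ 2 ≤ W := by rw [hW]; linarith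
  have haW : a ^ 2 ≤ W := by rw [hW]; linarith
  have hwW : w ^ 2 ≤ W := by rw [hW]; linarith
  have hpq : |p * q| ≤ W := (abs_mul_le_half_sq p q).trans (by rw [hW]; linarith)
  have hvw : |v * w| ≤ W := (abs_mul_le_half_sq v w).trans (by rw [hW]; linarith)
  have hua : |u| * |a| ≤ W := by
    rw [← abs_mul]; exact (abs_mul_le_half_sq u a).trans (by rw [hW]; linarith)
  have hr : (q + p * a * i) ^ 2 ≤ (2 + 2 * B ^ 2 * D ^ 2) * W := by
    have h1 : (p * a * i) ^ 2 ≤ B ^ 2 * D ^ 2 * p ^ 2 := by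
      have : a ^ 2 ≤ B ^ 2 := sq_le_sq' (by linarith [(abs_le.1 ha).1]) (abs_le.1 ha).2
      calc (p * a * i) ^ 2 = a ^ 2 * i ^ 2 * p ^ 2 := by ring
        _ ≤ _ := by gcongr
    have h2 : B ^ 2 * D ^ 2 * p ^ 2 ≤ B ^ 2 * D ^ 2 * W := by gcongr
    have h3 : q ^ 2 ≤ W := by rw [hW]; linarith
    have h4 : (q + p * a * i) ^ 2 ≤ 2 * q ^ 2 + 2 * (p * a * i) ^ 2 := by
      linarith [sq_nonneg (q - p * a * i), add_sq q (p * a * i), sub_sq q (p * a * i)]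
    calc (q + p * a * i) ^ 2 ≤ 2 * W + 2 * (B ^ 2 * D ^ 2 * W) := by linarith
      _ = _ := by ring
  set R := (2 + 2 * B ^ 2 * D ^ 2) * W with hR
  have hR0 : 0 ≤ R := by positivity
  have n1 : 0 ≤ C * B * W := by positivity
  have n2 : 0 ≤ D * W := by positivity
  have n3 : 0 ≤ B * W := by positivity
  have n4 : 0 ≤ B * D ^ 2 * W := by positivity
  have n5 : 0 ≤ D * R := by positivity
  have n6 : 0 ≤ B * D ^ 2 * R := by positivity
  have n7 : 0 ≤ C * W := by positivity
  have hexp : (C * (1 + B) + D + (1 + B) + B * D ^ 2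
      + (D + 3 * B * D ^ 2) * (2 + 2 * B ^ 2 * D ^ 2) + 3 * B) * W =
      C * W + C * B * W + D * W + W + B * W + B * D ^ 2 * W + D * R + 3 * (B * D ^ 2 * R)
        + 3 * (B * W) := by rw [hR]; ring
  rw [hexp, e0, e1, e2, e3]
  have t1 : |f (1 - u) * a| ≤ C * W := by
    rw [abs_mul]
    calc |f (1 - u)| * |a| ≤ C * |u| * |a| := by gcongr
      _ = C * (|u| * |a|) := by ring
      _ ≤ _ := by gcongr
  have t2 : |deriv f (1 - u) * a ^ 2| ≤ C * W := by
    rw [abs_mul, abs_of_nonneg sa]; gcongr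
  have t3 : |deriv (deriv f) (1 - u) * a ^ 3| ≤ C * B * W := by
    rw [abs_mul, abs_pow, pow_succ', sq_abs, ← mul_assoc]
    gcongr
  have t4 : |potential f (1 - u)| ≤ C * W := c1.trans (by gcongr)
  have t5 : |p * q * i| ≤ D * W := by
    rw [abs_mul, abs_of_pos hi0, mul_comm]; gcongr
  have t6 : |p ^ 2 * a * i ^ 2| ≤ B * D ^ 2 * W := by
    rw [abs_mul, abs_mul, abs_of_nonneg sp, abs_of_nonneg (sq_nonneg i)]
    calc p ^ 2 * |a| * i ^ 2 ≤ W * B * D ^ 2 := by gcongr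
      _ = _ := by ring
  have t7 : |a * v ^ 2| ≤ B * W := by rw [abs_mul, abs_of_nonneg sv]; gcongr
  have t8 : |(1 - u) * (v * w)| ≤ W + B * W := by
    rw [abs_mul, abs_of_pos hpos]
    calc (1 - u) * |v * w| ≤ (1 + B) * W := by gcongr
      _ = _ := by ring
  have t9 : |a * (v * w)| ≤ B * W := by rw [abs_mul]; gcongr
  have t10 : |(1 - u) * w ^ 2| ≤ W + B * W := by
    rw [abs_mul, abs_of_pos hpos, abs_of_nonneg sw]
    calc (1 - u) * w ^ 2 ≤ (1 + B) * W := by gcongr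
      _ = _ := by ring
  have t11 : |(1 - u) * v ^ 2| ≤ W + B * W := by
    rw [abs_mul, abs_of_pos hpos, abs_of_nonneg sv]
    calc (1 - u) * v ^ 2 ≤ (1 + B) * W := by gcongr
      _ = _ := by ring
  have t12 : |p ^ 2 * i| ≤ D * W := by
    rw [abs_mul, abs_of_nonneg sp, abs_of_pos hi0, mul_comm]; gcongr
  have t13 : |(q + p * a * i) ^ 2 * i| ≤ D * R := by
    rw [abs_mul, abs_of_nonneg (sq_nonneg _), abs_of_pos hi0, mul_comm]; gcongr
  have t14 : |a * (q + p * a * i) ^ 2 * i ^ 2| ≤ B * D ^ 2 * R := by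
    rw [abs_mul, abs_mul, abs_of_nonneg (sq_nonneg (q + p * a * i)), abs_of_nonneg (sq_nonneg i)]
    calc |a| * (q + p * a * i) ^ 2 * i ^ 2 ≤ B * R * D ^ 2 := by gcongr
      _ = _ := by ring
  have t15 : |a * w ^ 2| ≤ B * W := by rw [abs_mul, abs_of_nonneg sw]; gcongr
  rw [abs_le] at t1 t2 t3 t4 t5 t6 t7 t8 t9 t10 t11 t12 t13 t14 t15
  refine ⟨abs_le.2 ⟨?_, ?_⟩, abs_le.2 ⟨?_, ?_⟩, abs_le.2 ⟨?_, ?_⟩, abs_le.2 ⟨?_, ?_⟩⟩ <;>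
  linarith

end Densities

/-! ### Differentiation of the energy along lines -/

/-- Bounded, almost everywhere differentiable, with derivative in `L²`. -/
structure WeakH1 (u : ℝ → ℝ) : Prop where
  ae_diff : ∀ᵐ x, DifferentiableAt ℝ u x
  memLp : MemLp u 2 volume
  memLp_deriv : MemLp (deriv u) 2 volume
  bdd : ∃ B, ∀ x, |u x| ≤ B

/-- Differentiating the energy requires only an almost everywhere derivative in `L²` and
boundedness. This class is stable under multiplication by a cut-off by the pointwise product rule
alone. -/
lemma MemH1.weakH1 {u : ℝ → ℝ} (hu : MemH1 u) : WeakH1 u :=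
  ⟨hu.ae_differentiableAt, hu.1, hu.memLp_deriv, hu.exists_bound⟩

lemma WeakH1.add_smul {u w : ℝ → ℝ} (hu : WeakH1 u) (hw : WeakH1 w) (s : ℝ) :
    WeakH1 (fun x => u x + s * w x) := by
  refine ⟨?_, hu.memLp.add (hw.memLp.const_mul s), ?_, ?_⟩
  · filter_upwards [hu.ae_diff, hw.ae_diff] with x h1 h2 using h1.add (h2.const_mul s)
  · refine (memLp_congr_ae ?_).1 (hu.memLp_deriv.add (hw.memLp_deriv.const_mul s))
    filter_upwards [hu.ae_diff, hw.ae_diff] with x h1 h2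
    exact (h1.hasDerivAt.add (h2.hasDerivAt.const_mul s)).deriv.symm
  · obtain ⟨A, hA⟩ := hu.bdd
    obtain ⟨B, hB⟩ := hw.bdd
    refine ⟨A + |s| * B, fun x => (abs_add_le _ _).trans (add_le_add (hA x) ?_)⟩
    rw [abs_mul]
    exact mul_le_mul_of_nonneg_left (hB x) (abs_nonneg s)

/-- The class of pairs on which the energy is differentiated. -/
def WeakX (P : Hydro) : Prop := WeakH1 P.1 ∧ MemLp P.2 2 volume

lemma weakX_of_mem {P : Hydro} (h : P ∈ XSpace) : WeakX P := ⟨h.1.weakH1, h.2⟩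

lemma WeakX.add_smul {P ε : Hydro} (hP : WeakX P) (hε : WeakX ε) (s : ℝ) : WeakX (P + s • ε) :=
  ⟨hP.1.add_smul hε.1 s, hP.2.add (hε.2.const_mul s)⟩

lemma weakH1_zero : WeakH1 (0 : ℝ → ℝ) :=
  ⟨Eventually.of_forall fun _ => differentiableAt_const _, MemLp.zero', by
    rw [show deriv (0 : ℝ → ℝ) = fun _ => 0 from funext fun x => deriv_const x 0]
    exact MemLp.zero', 0, fun x => by simp⟩

lemma weakX_zero : WeakX 0 := ⟨weakH1_zero, MemLp.zero'⟩

/-- Differentiation of a parametric integral on an open set. -/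
lemma hasDerivAt_integral_family {e e' : ℝ → ℝ → ℝ} {I : Set ℝ} {g : ℝ → ℝ} (hI : IsOpen I)
    (hm : ∀ s ∈ I, AEStronglyMeasurable (e s) volume)
    (hm' : ∀ s ∈ I, AEStronglyMeasurable (e' s) volume) (hg : Integrable g)
    (hb : ∀ s ∈ I, ∀ᵐ x, |e s x| ≤ g x) (hb' : ∀ᵐ x, ∀ s ∈ I, |e' s x| ≤ g x)
    (hd : ∀ᵐ x, ∀ s ∈ I, HasDerivAt (fun s => e s x) (e' s x) s) {s : ℝ} (hs : s ∈ I) :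
    HasDerivAt (fun s => ∫ x, e s x) (∫ x, e' s x) s :=
  (hasDerivAt_integral_of_dominated_loc_of_deriv_le (hI.mem_nhds hs)
    (Filter.eventually_of_mem (hI.mem_nhds hs) hm) (hg.mono' (hm s hs) (hb s hs)) (hm' s hs)
    hb' hg hd).2

/-- Composition of a function continuous below `1` with a function bounded away from `1`. -/
lemma aestronglyMeasurable_comp_of_le {g u : ℝ → ℝ} {b : ℝ} (hb : b < 1)
    (hg : ∀ t < 1, ContinuousAt g t) (hu : AEStronglyMeasurable u volume) (h : ∀ x, u x ≤ b) :
    AEStronglyMeasurable (fun x => g (u x)) volume := by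
  have hc : Continuous fun t => g (min t b) := continuous_iff_continuousAt.2 fun t =>
    ContinuousAt.comp (f := fun t => min t b) (hg _ ((min_le_right _ _).trans_lt hb))
      (by fun_prop)
  have : (fun x => g (u x)) = fun x => g (min (u x) b) := by
    ext x; rw [min_eq_left (h x)]
  rw [this]
  exact hc.comp_aestronglyMeasurable hu

section Measurability

variable {f u p v a q w : ℝ → ℝ} {b : ℝ}

lemma aestronglyMeasurable_dens (hf : Nonlinearity f) (hb : b < 1)
    (hu : AEStronglyMeasurable u volume) (hp : AEStronglyMeasurable p volume)
    (hv : AEStronglyMeasurable v volume) (ha : AEStronglyMeasurable a volume)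
    (hq : AEStronglyMeasurable q volume) (hw : AEStronglyMeasurable w volume)
    (h : ∀ x, u x ≤ b) :
    AEStronglyMeasurable (fun x => dens0 f (u x) (p x) (v x)) volume ∧
    AEStronglyMeasurable (fun x => dens1 f (u x) (p x) (v x) (a x) (q x) (w x)) volume ∧
    AEStronglyMeasurable (fun x => dens2 f (u x) (p x) (v x) (a x) (q x) (w x)) volume ∧
    AEStronglyMeasurable (fun x => dens3 f (u x) (p x) (v x) (a x) (q x) (w x)) volume := by
  have m1 : AEStronglyMeasurable (fun x => 1 - u x) volume := aestronglyMeasurable_const.sub hu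
  have m2 : AEStronglyMeasurable (fun x => (1 - u x)⁻¹) volume :=
    aestronglyMeasurable_comp_of_le (g := fun t => (1 - t)⁻¹) hb
      (fun t ht => ContinuousAt.inv₀ (by fun_prop) (sub_pos.2 ht).ne') hu h
  have m3 : AEStronglyMeasurable (fun x => potential f (1 - u x)) volume :=
    aestronglyMeasurable_comp_of_le (g := fun t => potential f (1 - t)) hb
      (fun t ht => (hf.hasDerivAt_potential_one_sub ht).continuousAt) hu h
  have m4 : AEStronglyMeasurable (fun x => f (1 - u x)) volume :=
    aestronglyMeasurable_comp_of_le (g := fun t => f (1 - t)) hb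
      (fun t ht => (hf.hasDerivAt_one_sub ht).continuousAt) hu h
  have m5 : AEStronglyMeasurable (fun x => deriv f (1 - u x)) volume :=
    aestronglyMeasurable_comp_of_le (g := fun t => deriv f (1 - t)) hb
      (fun t ht => (hf.hasDerivAt_deriv_one_sub ht).continuousAt) hu h
  have m6 : AEStronglyMeasurable (fun x => deriv (deriv f) (1 - u x)) volume :=
    aestronglyMeasurable_comp_of_le (g := fun t => deriv (deriv f) (1 - t)) hb
      (fun t ht => ContinuousAt.comp (f := fun t : ℝ => 1 - t)
        (hf.continuousAt_deriv_deriv (sub_pos.2 ht)) (by fun_prop)) hu h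
  simp only [dens0, dens1, dens2, dens3, div_eq_mul_inv, mul_inv, ← inv_pow]
  generalize h3 : (fun x => potential f (1 - u x)) = F0 at m3
  generalize h4 : (fun x => f (1 - u x)) = F1 at m4
  generalize h5 : (fun x => deriv f (1 - u x)) = F2 at m5
  generalize h6 : (fun x => deriv (deriv f) (1 - u x)) = F3 at m6
  generalize h2 : (fun x => (1 - u x)⁻¹) = F4 at m2
  simp only [congrFun h2, congrFun h3, congrFun h4, congrFun h5, congrFun h6]
  refine ⟨by fun_prop, by fun_prop, by fun_prop, by fun_prop⟩

end Measurability

/-- The densities of the energy and of its differentials for a pair and a direction. -/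
noncomputable def D0 (f : ℝ → ℝ) (P : Hydro) (x : ℝ) : ℝ :=
  dens0 f (P.1 x) (deriv P.1 x) (P.2 x)

noncomputable def D1 (f : ℝ → ℝ) (P ε : Hydro) (x : ℝ) : ℝ :=
  dens1 f (P.1 x) (deriv P.1 x) (P.2 x) (ε.1 x) (deriv ε.1 x) (ε.2 x)

noncomputable def D2 (f : ℝ → ℝ) (P ε : Hydro) (x : ℝ) : ℝ :=
  dens2 f (P.1 x) (deriv P.1 x) (P.2 x) (ε.1 x) (deriv ε.1 x) (ε.2 x)

noncomputable def D3 (f : ℝ → ℝ) (P ε : Hydro) (x : ℝ) : ℝ :=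
  dens3 f (P.1 x) (deriv P.1 x) (P.2 x) (ε.1 x) (deriv ε.1 x) (ε.2 x)

lemma abs_potential_le {f : ℝ → ℝ} (hf : Nonlinearity f) {P : Hydro} (hP : WeakX P) {b : ℝ}
    (hb0 : 0 ≤ b) (hb : b < 1) (h : ∀ x, P.1 x ≤ b) :
    ∃ B C, 0 ≤ B ∧ 0 ≤ C ∧ (∀ x, P.1 x ∈ Icc (-B) b) ∧
      ∀ x, |potential f (1 - P.1 x)| ≤ C * P.1 x ^ 2 := by
  obtain ⟨B, hB⟩ := hP.1.bdd
  have hB0 : 0 ≤ B := (abs_nonneg _).trans (hB 0)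
  obtain ⟨C, hC, hCb⟩ := exists_nonlinearity_bound hf hB0 hb0 hb
  have hm : ∀ x, P.1 x ∈ Icc (-B) b := fun x => ⟨(abs_le.1 (hB x)).1, h x⟩
  exact ⟨B, C, hB0, hC, hm, fun x => (hCb _ (hm x)).1⟩

/-- The energy as the integral of a single density. -/
lemma energy_eq_integral {f : ℝ → ℝ} (hf : Nonlinearity f) {P : Hydro} (hP : WeakX P) {b : ℝ}
    (hb0 : 0 ≤ b) (hb : b < 1) (h : ∀ x, P.1 x ≤ b) :
    Integrable (D0 f P) ∧ energy f P = ∫ x, D0 f P x := by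
  obtain ⟨B, C, hB, hC, hm, hF⟩ := abs_potential_le hf hP hb0 hb h
  have hu := hP.1.memLp.1
  have hp := hP.1.memLp_deriv.1
  have hv := hP.2.1
  have m2 : AEStronglyMeasurable (fun x => (1 - P.1 x)⁻¹) volume :=
    aestronglyMeasurable_comp_of_le (g := fun t => (1 - t)⁻¹) hb
      (fun t ht => ContinuousAt.inv₀ (by fun_prop) (sub_pos.2 ht).ne') hu h
  have m3 : AEStronglyMeasurable (fun x => potential f (1 - P.1 x)) volume :=
    aestronglyMeasurable_comp_of_le (g := fun t => potential f (1 - t)) hb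
      (fun t ht => (hf.hasDerivAt_potential_one_sub ht).continuousAt) hu h
  have i1 : Integrable (fun x => deriv P.1 x ^ 2 / (1 - P.1 x)) := by
    refine (hP.1.memLp_deriv.integrable_sq.const_mul (1 - b)⁻¹).mono' ?_
      (Eventually.of_forall fun x => ?_)
    · simp only [div_eq_mul_inv]; fun_prop
    · have h1 : 0 < 1 - P.1 x := by linarith [h x]
      rw [Real.norm_of_nonneg (by positivity), div_eq_inv_mul]
      exact mul_le_mul_of_nonneg_right (inv_anti₀ (sub_pos.2 hb) (by linarith [h x]))
        (sq_nonneg _)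
  have i2 : Integrable (fun x => (1 - P.1 x) * P.2 x ^ 2) := by
    refine (hP.2.integrable_sq.const_mul (1 + B)).mono' (by fun_prop)
      (Eventually.of_forall fun x => ?_)
    have h1 : 0 < 1 - P.1 x := by linarith [h x]
    rw [Real.norm_of_nonneg (by positivity)]
    exact mul_le_mul_of_nonneg_right (by linarith [(hm x).1]) (sq_nonneg _)
  have i3 : Integrable (fun x => potential f (1 - P.1 x)) :=
    (hP.1.memLp.integrable_sq.const_mul C).mono' m3 (Eventually.of_forall hF)
  have e : D0 f P = fun x => 1 / 8 * (deriv P.1 x ^ 2 / (1 - P.1 x))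
      + 1 / 2 * ((1 - P.1 x) * P.2 x ^ 2) + 1 / 2 * potential f (1 - P.1 x) := by
    ext x
    have h1 : 1 - P.1 x ≠ 0 := by linarith [h x]
    simp only [D0, dens0]
    field_simp
  rw [e]
  refine ⟨((i1.const_mul _).add (i2.const_mul _)).add (i3.const_mul _), ?_⟩
  have s1 := integral_add (i1.const_mul (1 / 8)) (i2.const_mul (1 / 2))
  have s2 := integral_add ((i1.const_mul (1 / 8)).add (i2.const_mul (1 / 2))) (i3.const_mul (1 / 2))
  simp only [Pi.add_apply] at s2
  rw [s2, s1, integral_const_mul, integral_const_mul, integral_const_mul, energy]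

/-- The energy along a line, with its first three derivatives. -/
lemma energy_line {f : ℝ → ℝ} (hf : Nonlinearity f) {P ε : Hydro} (hP : WeakX P) (hε : WeakX ε)
    {I : Set ℝ} (hI : IsOpen I) (hI2 : I ⊆ Ioo (-2) 2) {b : ℝ} (hb0 : 0 ≤ b) (hb : b < 1)
    (h : ∀ s ∈ I, ∀ x, P.1 x + s * ε.1 x ≤ b) :
    (∀ s ∈ I, Integrable (D1 f (P + s • ε) ε) ∧ Integrable (D2 f (P + s • ε) ε)) ∧
    (∀ s ∈ I, HasDerivAt (fun s => energy f (P + s • ε)) (∫ x, D1 f (P + s • ε) ε x) s) ∧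
    (∀ s ∈ I, HasDerivAt (fun s => ∫ x, D1 f (P + s • ε) ε x) (∫ x, D2 f (P + s • ε) ε x) s) ∧
    (∀ s ∈ I, HasDerivAt (fun s => ∫ x, D2 f (P + s • ε) ε x) (∫ x, D3 f (P + s • ε) ε x) s) ∧
    ContinuousOn (fun s => ∫ x, D3 f (P + s • ε) ε x) I := by
  obtain ⟨B1, hB1⟩ := hP.1.bdd
  obtain ⟨B2, hB2⟩ := hε.1.bdd
  have hB10 : 0 ≤ B1 := (abs_nonneg _).trans (hB1 0)
  have hB20 : 0 ≤ B2 := (abs_nonneg _).trans (hB2 0)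
  obtain ⟨C, hC, hbound⟩ := exists_dens_bound hf (B := B1 + 2 * B2) (by positivity) hb0 hb
  -- replace the derivative of the sum by the sum of derivatives
  have hderiv : ∀ᵐ x, ∀ s : ℝ, deriv (P + s • ε).1 x = deriv P.1 x + s * deriv ε.1 x := by
    filter_upwards [hP.1.ae_diff, hε.1.ae_diff] with x h1 h2 s
    exact (h1.hasDerivAt.add (h2.hasDerivAt.const_mul s)).deriv
  set e0 : ℝ → ℝ → ℝ := fun s x => dens0 f (P.1 x + s * ε.1 x) (deriv P.1 x + s * deriv ε.1 x)
    (P.2 x + s * ε.2 x) with he0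
  set e1 : ℝ → ℝ → ℝ := fun s x => dens1 f (P.1 x + s * ε.1 x) (deriv P.1 x + s * deriv ε.1 x)
    (P.2 x + s * ε.2 x) (ε.1 x) (deriv ε.1 x) (ε.2 x) with he1
  set e2 : ℝ → ℝ → ℝ := fun s x => dens2 f (P.1 x + s * ε.1 x) (deriv P.1 x + s * deriv ε.1 x)
    (P.2 x + s * ε.2 x) (ε.1 x) (deriv ε.1 x) (ε.2 x) with he2
  set e3 : ℝ → ℝ → ℝ := fun s x => dens3 f (P.1 x + s * ε.1 x) (deriv P.1 x + s * deriv ε.1 x)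
    (P.2 x + s * ε.2 x) (ε.1 x) (deriv ε.1 x) (ε.2 x) with he3
  have a0 : ∀ s, D0 f (P + s • ε) =ᵐ[volume] e0 s := fun s => by
    filter_upwards [hderiv] with x hx
    simp only [D0, hx s]; rfl
  have a1 : ∀ s, D1 f (P + s • ε) ε =ᵐ[volume] e1 s := fun s => by
    filter_upwards [hderiv] with x hx
    simp only [D1, hx s]; rfl
  have a2 : ∀ s, D2 f (P + s • ε) ε =ᵐ[volume] e2 s := fun s => by
    filter_upwards [hderiv] with x hx
    simp only [D2, hx s]; rfl
  have a3 : ∀ s, D3 f (P + s • ε) ε =ᵐ[volume] e3 s := fun s => by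
    filter_upwards [hderiv] with x hx
    simp only [D3, hx s]; rfl
  have hu := hP.1.memLp.1
  have hp := hP.1.memLp_deriv.1
  have hv := hP.2.1
  have ha := hε.1.memLp.1
  have hq := hε.1.memLp_deriv.1
  have hw := hε.2.1
  have hmeas := fun s (hs : s ∈ I) => aestronglyMeasurable_dens hf hb
    (hu.add (ha.const_mul s)) (hp.add (hq.const_mul s)) (hv.add (hw.const_mul s)) ha hq hw (h s hs)
  -- A single dominating function for all `s ∈ I`: since `|s| ≤ 2`, `(α + s β)² ≤ 2 α² + 8 β²`, and
  -- adding the squares of the direction gives at most the factor `10`.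
  set g : ℝ → ℝ := fun x => C * (10 * (P.1 x ^ 2 + deriv P.1 x ^ 2 + P.2 x ^ 2 + ε.1 x ^ 2
    + deriv ε.1 x ^ 2 + ε.2 x ^ 2)) with hg
  have hgi : Integrable g :=
    ((((((hP.1.memLp.integrable_sq.add hP.1.memLp_deriv.integrable_sq).add
      hP.2.integrable_sq).add hε.1.memLp.integrable_sq).add
      hε.1.memLp_deriv.integrable_sq).add hε.2.integrable_sq).const_mul 10).const_mul C
  have hle : ∀ s ∈ I, ∀ x, |e0 s x| ≤ g x ∧ |e1 s x| ≤ g x ∧ |e2 s x| ≤ g x ∧ |e3 s x| ≤ g x := by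
    intro s hs x
    have hs2 : |s| ≤ 2 := (abs_lt.2 (hI2 hs)).le
    have hsq : s ^ 2 ≤ 4 := by
      calc s ^ 2 = |s| ^ 2 := (sq_abs s).symm
        _ ≤ 2 ^ 2 := pow_le_pow_left₀ (abs_nonneg s) hs2 2
        _ = 4 := by norm_num
    have hmem : P.1 x + s * ε.1 x ∈ Icc (-(B1 + 2 * B2)) b := by
      refine ⟨?_, h s hs x⟩
      have h1 : |s * ε.1 x| ≤ 2 * B2 := by
        rw [abs_mul]; exact mul_le_mul hs2 (hB2 x) (abs_nonneg _) (by norm_num)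
      linarith [(abs_le.1 (hB1 x)).1, (abs_le.1 h1).1]
    have hsum : ∀ α β : ℝ, (α + s * β) ^ 2 ≤ 2 * α ^ 2 + 8 * β ^ 2 := fun α β => by
      have h1 : (s * β) ^ 2 ≤ 4 * β ^ 2 := by
        rw [mul_pow]; exact mul_le_mul_of_nonneg_right hsq (sq_nonneg β)
      nlinarith [sq_nonneg (α - s * β)]
    have hW : (P.1 x + s * ε.1 x) ^ 2 + (deriv P.1 x + s * deriv ε.1 x) ^ 2
        + (P.2 x + s * ε.2 x) ^ 2 + ε.1 x ^ 2 + deriv ε.1 x ^ 2 + ε.2 x ^ 2 ≤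
        10 * (P.1 x ^ 2 + deriv P.1 x ^ 2 + P.2 x ^ 2 + ε.1 x ^ 2
          + deriv ε.1 x ^ 2 + ε.2 x ^ 2) := by
      have := hsum (P.1 x) (ε.1 x)
      have := hsum (deriv P.1 x) (deriv ε.1 x)
      have := hsum (P.2 x) (ε.2 x)
      have := sq_nonneg (P.1 x)
      have := sq_nonneg (deriv P.1 x)
      have := sq_nonneg (P.2 x)
      have := sq_nonneg (ε.1 x)
      have := sq_nonneg (deriv ε.1 x)
      have := sq_nonneg (ε.2 x)
      linarith
    have hCW := mul_le_mul_of_nonneg_left hW hC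
    obtain ⟨k0, k1, k2, k3⟩ := hbound _ (deriv P.1 x + s * deriv ε.1 x) (P.2 x + s * ε.2 x)
      (ε.1 x) (deriv ε.1 x) (ε.2 x) hmem ((hB2 x).trans (by linarith))
    exact ⟨k0.trans hCW, k1.trans hCW, k2.trans hCW, k3.trans hCW⟩
  have hlt : ∀ s ∈ I, ∀ x, P.1 x + s * ε.1 x < 1 := fun s hs x => (h s hs x).trans_lt hb
  have i1 : ∀ s, ∫ x, D1 f (P + s • ε) ε x = ∫ x, e1 s x := fun s => integral_congr_ae (a1 s)
  have i2 : ∀ s, ∫ x, D2 f (P + s • ε) ε x = ∫ x, e2 s x := fun s => integral_congr_ae (a2 s)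
  have i3 : ∀ s, ∫ x, D3 f (P + s • ε) ε x = ∫ x, e3 s x := fun s => integral_congr_ae (a3 s)
  simp only [i1, i2, i3]
  refine ⟨fun s hs => ⟨?_, ?_⟩, fun s hs => ?_, fun s hs => ?_, fun s hs => ?_, fun s hs => ?_⟩
  · exact (hgi.mono' (hmeas s hs).2.1 (Eventually.of_forall fun x => (hle s hs x).2.1)).congr
      (a1 s).symm
  · exact (hgi.mono' (hmeas s hs).2.2.1 (Eventually.of_forall fun x => (hle s hs x).2.2.1)).congr
      (a2 s).symm
  · have hd := hasDerivAt_integral_family (e := e0) (e' := e1) hI (fun s hs => (hmeas s hs).1)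
      (fun s hs => (hmeas s hs).2.1) hgi (fun s hs => Eventually.of_forall fun x => (hle s hs x).1)
      (Eventually.of_forall fun x s hs => (hle s hs x).2.1)
      (Eventually.of_forall fun x s hs => hasDerivAt_dens0 hf (hlt s hs x)) hs
    refine hd.congr_of_eventuallyEq ?_
    filter_upwards [hI.mem_nhds hs] with t ht
    rw [(energy_eq_integral hf (hP.add_smul hε t) hb0 hb (h t ht)).2]
    exact integral_congr_ae (a0 t)
  · exact hasDerivAt_integral_family (e := e1) (e' := e2) hI (fun s hs => (hmeas s hs).2.1)
      (fun s hs => (hmeas s hs).2.2.1) hgi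
      (fun s hs => Eventually.of_forall fun x => (hle s hs x).2.1)
      (Eventually.of_forall fun x s hs => (hle s hs x).2.2.1)
      (Eventually.of_forall fun x s hs => hasDerivAt_dens1 hf (hlt s hs x)) hs
  · exact hasDerivAt_integral_family (e := e2) (e' := e3) hI (fun s hs => (hmeas s hs).2.2.1)
      (fun s hs => (hmeas s hs).2.2.2) hgi
      (fun s hs => Eventually.of_forall fun x => (hle s hs x).2.2.1)
      (Eventually.of_forall fun x s hs => (hle s hs x).2.2.2)
      (Eventually.of_forall fun x s hs => hasDerivAt_dens2 hf (hlt s hs x)) hs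
  · refine ContinuousAt.continuousWithinAt ?_
    exact continuousAt_of_dominated
      (Filter.eventually_of_mem (hI.mem_nhds hs) fun t ht => (hmeas t ht).2.2.2)
      (Filter.eventually_of_mem (hI.mem_nhds hs) fun t ht =>
        Eventually.of_forall fun x => (hle t ht x).2.2.2) hgi
      (Eventually.of_forall fun x => continuousAt_dens3 hf (hlt s hs x))

lemma iteratedDeriv_of_chain {φ φ1 φ2 φ3 : ℝ → ℝ} {I : Set ℝ} (hI : IsOpen I)
    (h1 : ∀ s ∈ I, HasDerivAt φ (φ1 s) s) (h2 : ∀ s ∈ I, HasDerivAt φ1 (φ2 s) s)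
    (h3 : ∀ s ∈ I, HasDerivAt φ2 (φ3 s) s) {s : ℝ} (hs : s ∈ I) :
    iteratedDeriv 1 φ s = φ1 s ∧ iteratedDeriv 2 φ s = φ2 s ∧ iteratedDeriv 3 φ s = φ3 s := by
  have e1 : ∀ t ∈ I, deriv φ t = φ1 t := fun t ht => (h1 t ht).deriv
  have e2 : ∀ t ∈ I, deriv (deriv φ) t = φ2 t := fun t ht => by
    rw [Filter.EventuallyEq.deriv_eq (Filter.eventually_of_mem (hI.mem_nhds ht) e1)]
    exact (h2 t ht).deriv
  have e3 : ∀ t ∈ I, deriv (deriv (deriv φ)) t = φ3 t := fun t ht => by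
    rw [Filter.EventuallyEq.deriv_eq (Filter.eventually_of_mem (hI.mem_nhds ht) e2)]
    exact (h3 t ht).deriv
  refine ⟨?_, ?_, ?_⟩
  · rw [iteratedDeriv_one]; exact e1 s hs
  · rw [iteratedDeriv_succ, iteratedDeriv_one]; exact e2 s hs
  · rw [iteratedDeriv_succ, iteratedDeriv_succ, iteratedDeriv_one]; exact e3 s hs

/-- Derivatives at a point of a line need an open interval on which the pair stays uniformly below
`1`; boundedness of `ε.1` provides it, at the price of half the gap `1 - b`. -/
lemma exists_line_room {P ε : Hydro} {b : ℝ} (hb : b < 1) (hε : WeakX ε)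
    (h0 : ∀ x, P.1 x ≤ b) : ∃ t b', 0 < t ∧ t ≤ 1 ∧ b' < 1 ∧ b ≤ b' ∧
      ∀ s ∈ Ioo (-t) t, ∀ x, P.1 x + s * ε.1 x ≤ b' := by
  obtain ⟨B, hB⟩ := hε.1.bdd
  have hB0 : 0 ≤ B := (abs_nonneg _).trans (hB 0)
  set t := min 1 ((1 - b) / (2 * (B + 1))) with ht
  have h1b : 0 < 1 - b := sub_pos.2 hb
  have ht0 : 0 < t := by positivity
  have ht2 : t * B ≤ (1 - b) / 2 := by
    have h1 : t * (B + 1) ≤ (1 - b) / (2 * (B + 1)) * (B + 1) :=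
      mul_le_mul_of_nonneg_right (min_le_right _ _) (by positivity)
    have h2 : (1 - b) / (2 * (B + 1)) * (B + 1) = (1 - b) / 2 := by field_simp
    nlinarith
  refine ⟨t, (1 + b) / 2, ht0, min_le_left _ _, by linarith, by linarith, fun s hs x => ?_⟩
  have h1 : |s * ε.1 x| ≤ t * B := by
    rw [abs_mul]; exact mul_le_mul (abs_lt.2 hs).le (hB x) (abs_nonneg _) ht0.le
  linarith [h0 x, (abs_le.1 h1).2]

/-- Integral formulas for the differentials of the energy. -/
lemma diagDeriv_energy {f : ℝ → ℝ} (hf : Nonlinearity f) {P ε : Hydro} (hP : WeakX P)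
    (hε : WeakX ε) {b : ℝ} (hb0 : 0 ≤ b) (hb : b < 1) (h : ∀ x, P.1 x ≤ b) :
    Integrable (D1 f P ε) ∧ Integrable (D2 f P ε) ∧
    diagDeriv 2 (energy f) P ε = ∫ x, D2 f P ε x ∧
    diagDeriv 3 (energy f) P ε = ∫ x, D3 f P ε x := by
  obtain ⟨t, b', ht, ht1, hb', hbb', hroom⟩ := exists_line_room hb hε h
  obtain ⟨k0, k1, k2, k3, -⟩ := energy_line hf hP hε isOpen_Ioo
    (Ioo_subset_Ioo (by linarith) (by linarith)) (hb0.trans hbb') hb' hroom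
  have h0 : (0 : ℝ) ∈ Ioo (-t) t := ⟨by linarith, ht⟩
  have := iteratedDeriv_of_chain isOpen_Ioo k1 k2 k3 h0
  have hk := k0 0 h0
  simp only [zero_smul, add_zero] at this hk
  exact ⟨hk.1, hk.2, this.2.1, this.2.2⟩

/-- Taylor's formula for the energy, with integral remainder. -/
lemma energy_taylor {f : ℝ → ℝ} (hf : Nonlinearity f) {P ε : Hydro} (hP : WeakX P)
    (hε : WeakX ε) {b : ℝ} (hb0 : 0 ≤ b) (hb : b < 1) (h : ∀ x, P.1 x ≤ b)
    (h' : ∀ x, (P + ε).1 x ≤ b) :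
    energy f (P + ε) = energy f P + (∫ x, D1 f P ε x) + 1 / 2 * (∫ x, D2 f P ε x)
      + remainder f P ε := by
  obtain ⟨t, b', ht, ht1, hb', hbb', hroom⟩ := exists_line_room hb hε h
  obtain ⟨t', b'', ht', ht1', hb'', hbb'', hroom'⟩ := exists_line_room hb hε h'
  set β := max b' b'' with hβ
  have hβ1 : β < 1 := max_lt hb' hb''
  -- On `[0, 1]` the bound follows by convexity from the two endpoints; beyond them the extra room
  -- is used.
  have hIroom : ∀ s ∈ Ioo (-t) (1 + t'), ∀ x, P.1 x + s * ε.1 x ≤ β := fun s hs x => by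
    rcases le_or_gt s 0 with hs0 | hs0
    · exact (hroom s ⟨hs.1, by linarith⟩ x).trans (le_max_left _ _)
    · rcases le_or_gt 1 s with hs1 | hs1
      · have h1 := hroom' (s - 1) ⟨by linarith, by linarith [hs.2]⟩ x
        have h2 : (P + ε).1 x = P.1 x + ε.1 x := rfl
        rw [h2] at h1
        have : P.1 x + s * ε.1 x ≤ b'' := by linarith
        exact this.trans (le_max_right _ _)
      · have h1 := h x
        have h2 : P.1 x + ε.1 x ≤ b := h' x
        have : P.1 x + s * ε.1 x ≤ b := by nlinarith
        exact this.trans (hbb'.trans (le_max_left _ _))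
  set I := Ioo (-t) (1 + t') with hI
  obtain ⟨-, k1, k2, k3, k4⟩ := energy_line hf hP hε (I := I) isOpen_Ioo
    (Ioo_subset_Ioo (by linarith) (by linarith)) (hb0.trans (hbb'.trans (le_max_left _ _))) hβ1
    hIroom
  set φ := fun s : ℝ => energy f (P + s • ε) with hφ
  set φ1 := fun s : ℝ => ∫ x, D1 f (P + s • ε) ε x with hφ1
  set φ2 := fun s : ℝ => ∫ x, D2 f (P + s • ε) ε x with hφ2
  set φ3 := fun s : ℝ => ∫ x, D3 f (P + s • ε) ε x with hφ3
  have hsub : uIcc (0 : ℝ) 1 ⊆ I := by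
    rw [uIcc_of_le zero_le_one]
    exact fun s hs => ⟨by linarith [hs.1], by linarith [hs.2]⟩
  -- In the derivative of this Taylor polynomial all terms but the third order one telescope.
  have hψ : ∀ s ∈ uIcc (0 : ℝ) 1, HasDerivAt
      (fun s => φ s + (1 - s) * φ1 s + (1 - s) ^ 2 / 2 * φ2 s) ((1 - s) ^ 2 / 2 * φ3 s) s := by
    intro s hs
    have l := (hasDerivAt_id s).const_sub 1
    refine (((k1 s (hsub hs)).add (l.mul (k2 s (hsub hs)))).add
      (((l.pow 2).div_const 2).mul (k3 s (hsub hs)))).congr_deriv ?_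
    simp only [Pi.pow_apply, id]
    push_cast
    ring
  have hint : IntervalIntegrable (fun s => (1 - s) ^ 2 / 2 * φ3 s) volume 0 1 := by
    refine ContinuousOn.intervalIntegrable ?_
    exact ContinuousOn.mul (by fun_prop) (k4.mono hsub)
  have hftc := intervalIntegral.integral_eq_sub_of_hasDerivAt hψ hint
  have hrem : remainder f P ε = ∫ s in (0 : ℝ)..1, (1 - s) ^ 2 / 2 * φ3 s := by
    refine intervalIntegral.integral_congr fun s hs => ?_
    have e : (fun r : ℝ => energy f (P + s • ε + r • ε)) = fun r => φ (s + r) := by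
      ext r; simp only [hφ, add_smul, add_assoc]
    simp only [diagDeriv, e]
    rw [iteratedDeriv_comp_const_add]
    simp only [add_zero]
    rw [(iteratedDeriv_of_chain isOpen_Ioo k1 k2 k3 (hsub hs)).2.2]
  rw [hrem, hftc]
  simp only [hφ, hφ1, hφ2, one_smul, zero_smul, add_zero]
  ring

/-! ### Cut-off functions -/

/-- `Φ` is a positive cut-off function such that `(√Φ)' = σ √Φ` with `|σ| ≤ τ`. -/
structure IsCutoff (τ : ℝ) (Φ σ : ℝ → ℝ) : Prop where
  pos : ∀ x, 0 < Φ x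
  le_one : ∀ x, Φ x ≤ 1
  sqrt_deriv : ∀ x, HasDerivAt (fun x => Real.sqrt (Φ x)) (σ x * Real.sqrt (Φ x)) x
  cont : Continuous σ
  bound : ∀ x, |σ x| ≤ τ

/-- Two solutions of `Z' = τ (1 - Z²)` satisfy `(X - Y)' = -τ (X + Y) (X - Y)`, so the logarithmic
derivative of the cut-off is at most `2 τ`, and that of its square root at most `τ`. The constants
`±1` are also solutions, which covers the two outermost gaps. -/
lemma IsCutoff.of_tanh {τ : ℝ} {X Y : ℝ → ℝ} (hτ : 0 < τ)
    (hX : ∀ x, HasDerivAt X (τ * (1 - X x ^ 2)) x) (hY : ∀ x, HasDerivAt Y (τ * (1 - Y x ^ 2)) x)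
    (hX1 : ∀ x, |X x| ≤ 1) (hY1 : ∀ x, |Y x| ≤ 1) (hXY : ∀ x, Y x < X x) :
    IsCutoff τ (fun x => 1 / 2 * (X x - Y x)) (fun x => -(τ / 2) * (X x + Y x)) := by
  have hXc : Continuous X := continuous_iff_continuousAt.2 fun x => (hX x).continuousAt
  have hYc : Continuous Y := continuous_iff_continuousAt.2 fun x => (hY x).continuousAt
  refine ⟨fun x => by linarith [hXY x], fun x => ?_, fun x => ?_, by fun_prop, fun x => ?_⟩
  · linarith [(abs_le.1 (hX1 x)).2, (abs_le.1 (hY1 x)).1]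
  · have hpos : 0 < 1 / 2 * (X x - Y x) := by linarith [hXY x]
    refine (((hX x).sub (hY x)).const_mul (1 / 2 : ℝ) |>.sqrt hpos.ne').congr_deriv ?_
    have hs : Real.sqrt (1 / 2 * (X x - Y x)) ≠ 0 := (Real.sqrt_pos.2 hpos).ne'
    simp only [Pi.sub_apply]
    rw [div_eq_iff (by positivity)]
    have := Real.mul_self_sqrt hpos.le
    linear_combination τ * (X x + Y x) * this
  · rw [abs_mul, abs_neg, abs_of_pos (by positivity)]
    have : |X x + Y x| ≤ 2 := (abs_add_le _ _).trans (by linarith [hX1 x, hY1 x])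
    nlinarith

lemma hasDerivAt_tanh_affine (τ b x : ℝ) : HasDerivAt (fun x => Real.tanh (τ * (x - b)))
    (τ * (1 - Real.tanh (τ * (x - b)) ^ 2)) x := by
  have h := (hasDerivAt_tanh (τ * (x - b))).comp x (((hasDerivAt_id x).sub_const b).const_mul τ)
  refine h.congr_deriv ?_
  simp only [mul_one]
  ring

lemma tanh_lt_tanh {x y : ℝ} (h : x < y) : Real.tanh x < Real.tanh y :=
  strictMono_of_hasDerivAt_pos hasDerivAt_tanh one_sub_tanh_sq_pos h

lemma half_one_sub_tanh_le (y : ℝ) : 1 / 2 * (1 - Real.tanh y) ≤ Real.exp (-(2 * y)) := by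
  have hc := Real.cosh_pos y
  rw [Real.tanh_eq_sinh_div_cosh]
  have h1 : 1 / 2 * (1 - Real.sinh y / Real.cosh y) = Real.exp (-y) / (2 * Real.cosh y) := by
    have := Real.cosh_sub_sinh y
    field_simp
    linarith
  rw [h1, div_le_iff₀ (by positivity)]
  have h2 : Real.exp y ≤ 2 * Real.cosh y := by
    rw [Real.cosh_eq]; linarith [Real.exp_pos (-y)]
  calc Real.exp (-y) = Real.exp (-(2 * y)) * Real.exp y := by rw [← Real.exp_add]; congr 1; ring
    _ ≤ _ := mul_le_mul_of_nonneg_left h2 (Real.exp_pos _).le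

lemma half_one_add_tanh_le (y : ℝ) : 1 / 2 * (1 + Real.tanh y) ≤ Real.exp (2 * y) := by
  have := half_one_sub_tanh_le (-y)
  rw [Real.tanh_neg] at this
  simpa using this

section Cutoffs

variable {N : ℕ} {τ L : ℝ} {a : Fin N → ℝ}

lemma Pos.lt_sub (hL : 0 < L) (ha : a ∈ Pos N L) {i j : Fin N} (hij : i < j) :
    L < a j - a i := by
  have key : ∀ (n : ℕ) (i j : Fin N), (j : ℕ) = i + 1 + n → L < a j - a i := by
    intro n
    induction n with
    | zero => intro i j h; exact ha i j (by omega)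
    | succ n ih =>
      intro i j h
      have hlt : (i : ℕ) + 1 < N := by have := j.isLt; omega
      have h1 := ha i ⟨i + 1, hlt⟩ rfl
      have h2 := ih ⟨i + 1, hlt⟩ j (by simp only; omega)
      linarith
  exact key ((j : ℕ) - i - 1) i j (by have : (i : ℕ) < j := hij; omega)

lemma Pos.le_abs_sub (hL : 0 < L) (ha : a ∈ Pos N L) {i j : Fin N} (hij : i ≠ j) :
    L ≤ |a i - a j| := by
  rcases lt_or_gt_of_ne hij with h | h
  · have := Pos.lt_sub hL ha h
    rw [abs_sub_comm]
    exact this.le.trans (le_abs_self _)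
  · exact (Pos.lt_sub hL ha h).le.trans (le_abs_self _)

lemma exists_isCutoff_sol (hτ : 0 < τ) (hL : 0 < L) (k : Fin N) :
    ∃ σ, IsCutoff τ (solCutoff τ L a k) σ := by
  have h := IsCutoff.of_tanh hτ (hasDerivAt_tanh_affine τ (a k - L / 4))
    (hasDerivAt_tanh_affine τ (a k + L / 4)) (fun x => (Real.abs_tanh_lt_one _).le)
    (fun x => (Real.abs_tanh_lt_one _).le)
    (fun x => tanh_lt_tanh (mul_lt_mul_of_pos_left (by linarith) hτ))
  have e : solCutoff τ L a k = fun x => 1 / 2 * (Real.tanh (τ * (x - (a k - L / 4)))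
      - Real.tanh (τ * (x - (a k + L / 4)))) := by
    ext x
    rw [solCutoff, sub_sub_eq_add_sub, sub_add_eq_add_sub, sub_sub]
  rw [e]
  exact ⟨_, h⟩

/-- The left part of a gap cut-off. -/
noncomputable def gapLeft (τ L : ℝ) (a : Fin N → ℝ) (k : Fin (N + 1)) (x : ℝ) : ℝ :=
  if h : 0 < (k : ℕ) then
    Real.tanh (τ * (x - a ⟨(k : ℕ) - 1, by have := k.isLt; omega⟩ - L / 4)) else 1

/-- The right part of a gap cut-off. -/
noncomputable def gapRight (τ L : ℝ) (a : Fin N → ℝ) (k : Fin (N + 1)) (x : ℝ) : ℝ :=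
  if h : (k : ℕ) < N then Real.tanh (τ * (x - a ⟨(k : ℕ), h⟩ + L / 4)) else -1

lemma gapCutoff_eq (k : Fin (N + 1)) (x : ℝ) :
    gapCutoff τ L a k x = 1 / 2 * (gapLeft τ L a k x - gapRight τ L a k x) := rfl

lemma abs_gapLeft_le (k : Fin (N + 1)) (x : ℝ) : |gapLeft τ L a k x| ≤ 1 := by
  unfold gapLeft
  split_ifs
  · exact (Real.abs_tanh_lt_one _).le
  · simp

lemma abs_gapRight_le (k : Fin (N + 1)) (x : ℝ) : |gapRight τ L a k x| ≤ 1 := by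
  unfold gapRight
  split_ifs
  · exact (Real.abs_tanh_lt_one _).le
  · simp

lemma exists_isCutoff_gap (hτ : 0 < τ) (hL : 0 < L) (ha : a ∈ Pos N L) (k : Fin (N + 1)) :
    ∃ σ, IsCutoff τ (gapCutoff τ L a k) σ := by
  refine ⟨_, IsCutoff.of_tanh (X := gapLeft τ L a k) (Y := gapRight τ L a k) hτ
    (fun x => ?_) (fun x => ?_) (abs_gapLeft_le k) (abs_gapRight_le k) (fun x => ?_)⟩
  · unfold gapLeft
    split_ifs with h
    · simp only [sub_sub]
      exact hasDerivAt_tanh_affine τ _ x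
    · simpa using hasDerivAt_const x (1 : ℝ)
  · unfold gapRight
    split_ifs with h
    · have := hasDerivAt_tanh_affine τ (a ⟨k, h⟩ - L / 4) x
      simpa only [sub_sub_eq_add_sub, sub_add, sub_sub] using this
    · simpa using hasDerivAt_const x (-1 : ℝ)
  · unfold gapLeft gapRight
    split_ifs with h1 h2 h2
    · refine tanh_lt_tanh (mul_lt_mul_of_pos_left ?_ hτ)
      have := ha ⟨(k : ℕ) - 1, by omega⟩ ⟨k, h1⟩ (by simp only; omega)
      linarith
    · exact Real.tanh_lt_one _
    · exact Real.neg_one_lt_tanh _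
    · norm_num

/-- Every hyperbolic tangent occurs once in a soliton cut-off and once, with opposite sign, in a gap
cut-off; only the outer constants `1` and `-(-1)` survive. -/
lemma sum_cutoffs (x : ℝ) :
    (∑ k, solCutoff τ L a k x) + ∑ k, gapCutoff τ L a k x = 1 := by
  have hl : ∑ k, gapLeft τ L a k x = 1 + ∑ k : Fin N, Real.tanh (τ * (x - a k - L / 4)) := by
    rw [Fin.sum_univ_succ]
    simp [gapLeft]
  have hr : ∑ k, gapRight τ L a k x = (∑ k : Fin N, Real.tanh (τ * (x - a k + L / 4))) + -1 := by
    rw [Fin.sum_univ_castSucc]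
    simp [gapRight]
  simp only [solCutoff, gapCutoff_eq, ← Finset.mul_sum, Finset.sum_sub_distrib, hl, hr]
  ring

lemma solCutoff_le (k : Fin N) (x : ℝ) :
    solCutoff τ L a k x ≤ Real.exp (-(2 * τ * (|x - a k| - L / 4))) := by
  rcases le_total 0 (x - a k) with h | h
  · rw [abs_of_nonneg h]
    have h1 := half_one_sub_tanh_le (τ * (x - a k - L / 4))
    have h2 := Real.tanh_lt_one (τ * (x - a k + L / 4))
    simp only [solCutoff]
    rw [← mul_assoc] at h1
    linarith
  · rw [abs_of_nonpos h]
    have h1 := half_one_add_tanh_le (τ * (x - a k + L / 4))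
    have h2 := Real.neg_one_lt_tanh (τ * (x - a k - L / 4))
    simp only [solCutoff]
    have e : -(2 * τ * (-(x - a k) - L / 4)) = 2 * (τ * (x - a k + L / 4)) := by ring
    rw [e]
    linarith

/-- With positions indexed from `0`, gap `k` lies left of soliton `j` exactly when `k ≤ j`. It then
ends at `a k - L / 4 ≤ a j - L / 4`, and `x` is at least `L / 8` beyond this edge, whence `2 τ L /
8`. The other case is the mirror image. -/
lemma gapCutoff_le (hτ : 0 < τ) (hL : 0 < L) (ha : a ∈ Pos N L) (k : Fin (N + 1)) (j : Fin N)
    {x : ℝ} (hx : |x - a j| < L / 8) : gapCutoff τ L a k x ≤ Real.exp (-(τ * L / 4)) := by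
  obtain ⟨hx1, hx2⟩ := abs_lt.1 hx
  have hle : ∀ i i' : Fin N, i ≤ i' → a i ≤ a i' := fun i i' h => by
    rcases h.eq_or_lt with rfl | h
    · exact le_rfl
    · linarith [Pos.lt_sub hL ha h]
  rw [gapCutoff_eq]
  by_cases hkj : (k : ℕ) ≤ j
  · have hkN : (k : ℕ) < N := hkj.trans_lt j.isLt
    have h1 : gapRight τ L a k x = Real.tanh (τ * (x - a ⟨k, hkN⟩ + L / 4)) := by
      simp [gapRight, hkN]
    have h2 := half_one_sub_tanh_le (τ * (x - a ⟨k, hkN⟩ + L / 4))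
    have h3 := (abs_le.1 (abs_gapLeft_le (τ := τ) (L := L) (a := a) k x)).2
    have h4 : a ⟨k, hkN⟩ ≤ a j := hle _ _ hkj
    have h5 : Real.exp (-(2 * (τ * (x - a ⟨k, hkN⟩ + L / 4)))) ≤ Real.exp (-(τ * L / 4)) := by
      apply Real.exp_le_exp.2
      nlinarith
    rw [h1]
    linarith
  · have hk0 : 0 < (k : ℕ) := by omega
    have hk1 : (k : ℕ) - 1 < N := by have := k.isLt; omega
    have h1 : gapLeft τ L a k x = Real.tanh (τ * (x - a ⟨(k : ℕ) - 1, hk1⟩ - L / 4)) := by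
      simp [gapLeft, hk0]
    have h2 := half_one_add_tanh_le (τ * (x - a ⟨(k : ℕ) - 1, hk1⟩ - L / 4))
    have h3 := (abs_le.1 (abs_gapRight_le (τ := τ) (L := L) (a := a) k x)).1
    have h4 : a j ≤ a ⟨(k : ℕ) - 1, hk1⟩ := hle _ _ (by
      show (j : ℕ) ≤ (k : ℕ) - 1
      omega)
    have h5 : Real.exp (2 * (τ * (x - a ⟨(k : ℕ) - 1, hk1⟩ - L / 4))) ≤
        Real.exp (-(τ * L / 4)) := by
      apply Real.exp_le_exp.2
      nlinarith
    rw [h1]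
    linarith

end Cutoffs

/-! ### Smooth functions of a finite sum of jets -/

/-- A box on which all jets of the chains take their values. -/
def box (β M : ℝ) : Set (ℝ × ℝ × ℝ) := Icc 0 β ×ˢ Icc (-M) M ×ˢ Icc (-M) M

/-- The open set of jets of non-vanishing pairs. -/
def jetDom : Set (ℝ × ℝ × ℝ) := {z | z.1 < 1}

lemma isOpen_jetDom : IsOpen jetDom := isOpen_lt continuous_fst continuous_const

lemma convex_box (β M : ℝ) : Convex ℝ (box β M) :=
  (convex_Icc _ _).prod ((convex_Icc _ _).prod (convex_Icc _ _))

lemma isCompact_box (β M : ℝ) : IsCompact (box β M) :=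
  isCompact_Icc.prod (isCompact_Icc.prod isCompact_Icc)

lemma box_subset {β M : ℝ} (hβ : β < 1) : box β M ⊆ jetDom := fun _ hz => hz.1.2.trans_lt hβ

lemma exists_lipschitz_box {F : Type*} [NormedAddCommGroup F] [NormedSpace ℝ F]
    {Ψ : ℝ × ℝ × ℝ → F} {β M : ℝ} (hβ : β < 1) (h : ContDiffOn ℝ 1 Ψ jetDom) :
    ∃ C, 0 ≤ C ∧ ∀ z ∈ box β M, ∀ z' ∈ box β M, ‖Ψ z - Ψ z'‖ ≤ C * ‖z - z'‖ := by
  obtain ⟨K, hK⟩ := (h.mono (box_subset hβ)).exists_lipschitzOnWith (by norm_num)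
    (convex_box β M) (isCompact_box β M)
  exact ⟨K, K.2, fun z hz z' hz' => by
    simpa [dist_eq_norm] using hK.dist_le_mul z hz z' hz'⟩

/-- Interaction of two jets. -/
lemma exists_interaction_box {Ψ : ℝ × ℝ × ℝ → ℝ} {β M : ℝ} (hβ : β < 1)
    (h : ContDiffOn ℝ 2 Ψ jetDom) (h0 : Ψ 0 = 0) :
    ∃ C, 0 ≤ C ∧ ∀ U V : ℝ × ℝ × ℝ, (0 : ℝ × ℝ × ℝ) ∈ box β M → U ∈ box β M → V ∈ box β M →
      U + V ∈ box β M → |Ψ (U + V) - Ψ U - Ψ V| ≤ C * (‖U‖ * ‖V‖) := by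
  have h1 : ContDiffOn ℝ 1 (fderiv ℝ Ψ) jetDom :=
    h.fderiv_of_isOpen isOpen_jetDom (by norm_num)
  obtain ⟨C, hC, hlip⟩ := exists_lipschitz_box (β := β) (M := M) hβ h1
  refine ⟨C, hC, fun U V h0m hU hV hUV => ?_⟩
  have hd : ∀ z ∈ jetDom, HasFDerivAt Ψ (fderiv ℝ Ψ z) z := fun z hz =>
    ((h.differentiableOn (by norm_num)).differentiableAt (isOpen_jetDom.mem_nhds hz)).hasFDerivAt
  -- Mean value inequality for `W ↦ Ψ (U + W) - Ψ W` from `0` to `V`: its differential is `O(‖U‖)`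
  -- because `fderiv ℝ Ψ` is Lipschitz. On the convex set `S` both base points stay in the box.
  set S : Set (ℝ × ℝ × ℝ) := {W | W ∈ box β M ∧ U + W ∈ box β M} with hS
  have hSc : Convex ℝ S := by
    have : S = box β M ∩ (fun W => U + W) ⁻¹' box β M := rfl
    rw [this]
    exact (convex_box β M).inter ((convex_box β M).translate_preimage_right U)
  have key := hSc.norm_image_sub_le_of_norm_hasFDerivWithin_le (𝕜 := ℝ)
    (f := fun W => Ψ (U + W) - Ψ W) (f' := fun W => fderiv ℝ Ψ (U + W) - fderiv ℝ Ψ W)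
    (C := C * ‖U‖) (x := 0) (y := V) (fun W hW => by
      have e1 := (hd (U + W) (box_subset hβ hW.2)).comp W
        ((hasFDerivAt_id W).const_add U)
      exact (e1.sub (hd W (box_subset hβ hW.1))).hasFDerivWithinAt)
    (fun W hW => by simpa using hlip _ hW.2 _ hW.1) ⟨h0m, by simpa using hU⟩ ⟨hV, hUV⟩
  simp only [add_zero, h0, sub_zero, Real.norm_eq_abs] at key
  rw [← mul_assoc]
  convert key using 2
  ring

/-- Interaction of finitely many jets. -/
lemma exists_interaction_sum {Ψ : ℝ × ℝ × ℝ → ℝ} {β M : ℝ} (hβ : β < 1)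
    (h : ContDiffOn ℝ 2 Ψ jetDom) (h0 : Ψ 0 = 0) :
    ∃ C, 0 ≤ C ∧ ∀ (ι : Type) [DecidableEq ι] (s : Finset ι) (U : ι → ℝ × ℝ × ℝ),
      (∀ t ⊆ s, ∑ k ∈ t, U k ∈ box β M) →
      |Ψ (∑ k ∈ s, U k) - ∑ k ∈ s, Ψ (U k)| ≤
        C * ∑ k ∈ s, ∑ j ∈ s.erase k, ‖U j‖ * ‖U k‖ := by
  obtain ⟨C, hC, hint⟩ := exists_interaction_box (M := M) hβ h h0
  refine ⟨C, hC, fun ι _ s U => ?_⟩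
  induction s using Finset.induction_on with
  | empty => simp [h0]
  | insert i s hi ih =>
    intro hbox
    have ih' := ih fun t ht => hbox t (ht.trans (Finset.subset_insert _ _))
    have e := hint (U i) (∑ k ∈ s, U k) (by simpa using hbox ∅ (by simp))
      (by simpa using hbox {i} (by simp)) (hbox s (Finset.subset_insert _ _))
      (by simpa [Finset.sum_insert hi] using hbox (insert i s) subset_rfl)
    rw [Finset.sum_insert hi, Finset.sum_insert hi]
    have h1 : |Ψ (U i + ∑ k ∈ s, U k) - (Ψ (U i) + ∑ k ∈ s, Ψ (U k))| ≤
        C * (‖U i‖ * ‖∑ k ∈ s, U k‖) + C * ∑ k ∈ s, ∑ j ∈ s.erase k, ‖U j‖ * ‖U k‖ := by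
      refine le_trans ?_ (add_le_add e ih')
      refine le_trans (le_of_eq ?_) (abs_add_le _ _)
      congr 1; ring
    refine h1.trans ?_
    rw [← mul_add]
    refine mul_le_mul_of_nonneg_left ?_ hC
    rw [Finset.sum_insert hi, Finset.erase_insert hi]
    refine add_le_add ?_ ?_
    · calc ‖U i‖ * ‖∑ k ∈ s, U k‖ ≤ ‖U i‖ * ∑ k ∈ s, ‖U k‖ :=
            mul_le_mul_of_nonneg_left (norm_sum_le _ _) (norm_nonneg _)
        _ = ∑ k ∈ s, ‖U k‖ * ‖U i‖ := by rw [Finset.mul_sum]; simp only [mul_comm]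
    · refine Finset.sum_le_sum fun k _ => ?_
      exact Finset.sum_le_sum_of_subset_of_nonneg
        (Finset.erase_subset_erase _ (Finset.subset_insert _ _)) fun j _ _ => by positivity

/-! ### Regularity of the densities as functions of the jet -/

section Coefficients

variable {f : ℝ → ℝ}

lemma contDiffOn_comp_one_sub {g : ℝ → ℝ} {n : WithTop ℕ∞} (hg : ContDiffOn ℝ n g (Ioi 0)) :
    ContDiffOn ℝ n (fun z : ℝ × ℝ × ℝ => g (1 - z.1)) jetDom :=
  hg.comp (contDiff_const.sub contDiff_fst).contDiffOn fun _ hz => mem_Ioi.2 (sub_pos.2 hz)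

lemma contDiffOn_inv_one_sub {n : WithTop ℕ∞} :
    ContDiffOn ℝ n (fun z : ℝ × ℝ × ℝ => (1 - z.1)⁻¹) jetDom :=
  (contDiff_const.sub contDiff_fst).contDiffOn.inv fun _ hz => (sub_pos.2 hz).ne'

lemma contDiff_jet_p {n : WithTop ℕ∞} : ContDiff ℝ n (fun z : ℝ × ℝ × ℝ => z.2.1) :=
  contDiff_fst.comp contDiff_snd

lemma contDiff_jet_v {n : WithTop ℕ∞} : ContDiff ℝ n (fun z : ℝ × ℝ × ℝ => z.2.2) :=
  contDiff_snd.comp contDiff_snd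

lemma contDiffOn_dens0 (hf : Nonlinearity f) :
    ContDiffOn ℝ 2 (fun z : ℝ × ℝ × ℝ => dens0 f z.1 z.2.1 z.2.2) jetDom := by
  have h1 := contDiffOn_comp_one_sub (hf.contDiffOn_potential.of_le
    (show (2 : WithTop ℕ∞) ≤ 4 by norm_num))
  have h2 : ContDiffOn ℝ 2 (fun z : ℝ × ℝ × ℝ => 8⁻¹ * (z.2.1 ^ 2 * (1 - z.1)⁻¹)
      + 2⁻¹ * ((1 - z.1) * z.2.2 ^ 2) + 2⁻¹ * potential f (1 - z.1)) jetDom :=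
    ((contDiffOn_const.mul ((contDiff_jet_p.pow 2).contDiffOn.mul contDiffOn_inv_one_sub)).add
      (contDiffOn_const.mul ((contDiff_const.sub contDiff_fst).mul
        (contDiff_jet_v.pow 2)).contDiffOn)).add (contDiffOn_const.mul h1)
  refine h2.congr fun z hz => ?_
  have : 1 - z.1 ≠ 0 := (sub_pos.2 hz).ne'
  simp only [dens0]
  field_simp

/-- The coefficients of the first differential. -/
noncomputable def coefQ (z : ℝ × ℝ × ℝ) : ℝ := z.2.1 / (4 * (1 - z.1))

noncomputable def coefA (f : ℝ → ℝ) (z : ℝ × ℝ × ℝ) : ℝ :=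
  z.2.1 ^ 2 / (8 * (1 - z.1) ^ 2) - z.2.2 ^ 2 / 2 + f (1 - z.1) / 2

noncomputable def coefW (z : ℝ × ℝ × ℝ) : ℝ := (1 - z.1) * z.2.2

lemma dens1_eq (z : ℝ × ℝ × ℝ) (a q w : ℝ) :
    dens1 f z.1 z.2.1 z.2.2 a q w = coefQ z * q + coefA f z * a + coefW z * w := by
  simp only [dens1, coefQ, coefA, coefW]; ring

lemma contDiffOn_coefQ : ContDiffOn ℝ 2 coefQ jetDom := by
  have h2 : ContDiffOn ℝ 2 (fun z : ℝ × ℝ × ℝ => 4⁻¹ * (z.2.1 * (1 - z.1)⁻¹)) jetDom :=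
    contDiffOn_const.mul (contDiff_jet_p.contDiffOn.mul contDiffOn_inv_one_sub)
  refine h2.congr fun z hz => ?_
  have : 1 - z.1 ≠ 0 := (sub_pos.2 hz).ne'
  simp only [coefQ]
  field_simp

lemma contDiffOn_coefA (hf : Nonlinearity f) : ContDiffOn ℝ 2 (coefA f) jetDom := by
  have h1 := contDiffOn_comp_one_sub (hf.contDiffOn_pos.of_le
    (show (2 : WithTop ℕ∞) ≤ 3 by norm_num))
  have h2 : ContDiffOn ℝ 2 (fun z : ℝ × ℝ × ℝ => 8⁻¹ * (z.2.1 ^ 2 * ((1 - z.1)⁻¹) ^ 2)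
      - 2⁻¹ * z.2.2 ^ 2 + 2⁻¹ * f (1 - z.1)) jetDom :=
    ((contDiffOn_const.mul ((contDiff_jet_p.pow 2).contDiffOn.mul
      (contDiffOn_inv_one_sub.pow 2))).sub
      (contDiffOn_const.mul (contDiff_jet_v.pow 2).contDiffOn)).add (contDiffOn_const.mul h1)
  refine h2.congr fun z hz => ?_
  have : 1 - z.1 ≠ 0 := (sub_pos.2 hz).ne'
  simp only [coefA]
  field_simp

lemma contDiffOn_coefW : ContDiffOn ℝ 2 coefW jetDom :=
  ((contDiff_const.sub contDiff_fst).mul contDiff_jet_v).contDiffOn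

/-- The coefficients of the second differential. -/
noncomputable def coefQQ (z : ℝ × ℝ × ℝ) : ℝ := 1 / (4 * (1 - z.1))

noncomputable def coefQA (z : ℝ × ℝ × ℝ) : ℝ :=
  z.2.1 / (2 * (1 - z.1) ^ 2)

noncomputable def coefAA (f : ℝ → ℝ) (z : ℝ × ℝ × ℝ) : ℝ :=
  z.2.1 ^ 2 / (4 * (1 - z.1) ^ 3) - deriv f (1 - z.1) / 2

lemma dens2_eq {z : ℝ × ℝ × ℝ} (hz : z ∈ jetDom) (a q w : ℝ) :
    dens2 f z.1 z.2.1 z.2.2 a q w = coefQQ z * q ^ 2 + coefQA z * (q * a) + coefAA f z * a ^ 2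
      - 2 * z.2.2 * (a * w) + (1 - z.1) * w ^ 2 := by
  have : 1 - z.1 ≠ 0 := (sub_pos.2 hz).ne'
  simp only [dens2, coefQQ, coefQA, coefAA]
  field_simp
  ring

lemma contDiffOn_coefQQ : ContDiffOn ℝ 1 coefQQ jetDom := by
  have h2 : ContDiffOn ℝ 1 (fun z : ℝ × ℝ × ℝ => 4⁻¹ * (1 - z.1)⁻¹) jetDom :=
    contDiffOn_const.mul contDiffOn_inv_one_sub
  refine h2.congr fun z hz => ?_
  have : 1 - z.1 ≠ 0 := (sub_pos.2 hz).ne'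
  simp only [coefQQ]
  field_simp

lemma contDiffOn_coefQA : ContDiffOn ℝ 1 coefQA jetDom := by
  have h2 : ContDiffOn ℝ 1 (fun z : ℝ × ℝ × ℝ => 2⁻¹ * (z.2.1 * ((1 - z.1)⁻¹) ^ 2)) jetDom :=
    contDiffOn_const.mul (contDiff_jet_p.contDiffOn.mul (contDiffOn_inv_one_sub.pow 2))
  refine h2.congr fun z hz => ?_
  have : 1 - z.1 ≠ 0 := (sub_pos.2 hz).ne'
  simp only [coefQA]
  field_simp

lemma contDiffOn_coefAA (hf : Nonlinearity f) : ContDiffOn ℝ 1 (coefAA f) jetDom := by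
  have h1 := contDiffOn_comp_one_sub (hf.contDiffOn_deriv.of_le
    (show (1 : WithTop ℕ∞) ≤ 2 by norm_num))
  have h2 : ContDiffOn ℝ 1 (fun z : ℝ × ℝ × ℝ => 4⁻¹ * (z.2.1 ^ 2 * ((1 - z.1)⁻¹) ^ 3)
      - 2⁻¹ * deriv f (1 - z.1)) jetDom :=
    (contDiffOn_const.mul ((contDiff_jet_p.pow 2).contDiffOn.mul
      (contDiffOn_inv_one_sub.pow 3))).sub (contDiffOn_const.mul h1)
  refine h2.congr fun z hz => ?_
  have : 1 - z.1 ≠ 0 := (sub_pos.2 hz).ne'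
  simp only [coefAA]
  field_simp

/-- The second differential is Lipschitz with respect to the base point. -/
lemma exists_dens2_lipschitz (hf : Nonlinearity f) {β M : ℝ} (hβ : β < 1) :
    ∃ C, 0 ≤ C ∧ ∀ z ∈ box β M, ∀ z' ∈ box β M, ∀ a q w : ℝ,
      |dens2 f z.1 z.2.1 z.2.2 a q w - dens2 f z'.1 z'.2.1 z'.2.2 a q w| ≤
        C * ‖z - z'‖ * (a ^ 2 + q ^ 2 + w ^ 2) := by
  obtain ⟨C1, hC1, h1⟩ := exists_lipschitz_box (M := M) hβ contDiffOn_coefQQ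
  obtain ⟨C2, hC2, h2⟩ := exists_lipschitz_box (M := M) hβ contDiffOn_coefQA
  obtain ⟨C3, hC3, h3⟩ := exists_lipschitz_box (M := M) hβ (contDiffOn_coefAA hf)
  refine ⟨C1 + C2 + C3 + 3, by positivity, fun z hz z' hz' a q w => ?_⟩
  rw [dens2_eq (box_subset hβ hz), dens2_eq (box_subset hβ hz')]
  have k1 := h1 z hz z' hz'
  have k2 := h2 z hz z' hz'
  have k3 := h3 z hz z' hz'
  have k4 : |z.2.2 - z'.2.2| ≤ ‖z - z'‖ :=
    (norm_snd_le (z - z').2).trans (norm_snd_le (z - z'))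
  have k5 : |z.1 - z'.1| ≤ ‖z - z'‖ := norm_fst_le (z - z')
  rw [Real.norm_eq_abs] at k1 k2 k3
  set d := ‖z - z'‖ with hd
  have hd0 : 0 ≤ d := norm_nonneg _
  set W := a ^ 2 + q ^ 2 + w ^ 2 with hW
  have sa := sq_nonneg a
  have sq := sq_nonneg q
  have sw := sq_nonneg w
  have e1 : |(coefQQ z - coefQQ z') * q ^ 2| ≤ C1 * d * W := by
    rw [abs_mul, abs_of_nonneg sq]
    exact mul_le_mul k1 (by rw [hW]; linarith) sq (by positivity)
  have e2 : |(coefQA z - coefQA z') * (q * a)| ≤ C2 * d * W := by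
    rw [abs_mul]
    exact mul_le_mul k2 ((abs_mul_le_half_sq q a).trans (by rw [hW]; linarith)) (abs_nonneg _)
      (by positivity)
  have e3 : |(coefAA f z - coefAA f z') * a ^ 2| ≤ C3 * d * W := by
    rw [abs_mul, abs_of_nonneg sa]
    exact mul_le_mul k3 (by rw [hW]; linarith) sa (by positivity)
  have e4 : |(z.2.2 - z'.2.2) * (a * w)| ≤ d * W := by
    rw [abs_mul]
    exact mul_le_mul k4 ((abs_mul_le_half_sq a w).trans (by rw [hW]; linarith)) (abs_nonneg _) hd0
  have e5 : |(z.1 - z'.1) * w ^ 2| ≤ d * W := by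
    rw [abs_mul, abs_of_nonneg sw]
    exact mul_le_mul k5 (by rw [hW]; linarith) sw hd0
  rw [abs_le] at e1 e2 e3 e4 e5 ⊢
  constructor <;> linarith

/-- Effect of replacing the derivative `q` by `q + σ a` in the second differential. -/
lemma exists_dens2_shift {β M : ℝ} (hβ0 : 0 ≤ β) (hβ : β < 1)
    (hM : 0 ≤ M) (T : ℝ) :
    ∃ C, 0 ≤ C ∧ ∀ z ∈ box β M, ∀ a q w σ τ : ℝ, |σ| ≤ τ → τ ≤ T →
      |dens2 f z.1 z.2.1 z.2.2 a (q + σ * a) w - dens2 f z.1 z.2.1 z.2.2 a q w| ≤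
        C * τ * (a ^ 2 + q ^ 2 + w ^ 2) := by
  obtain ⟨C1, hb1⟩ := (isCompact_box β M).exists_bound_of_continuousOn
    (contDiffOn_coefQQ.continuousOn.mono (box_subset hβ))
  obtain ⟨C2, hb2⟩ := (isCompact_box β M).exists_bound_of_continuousOn
    (contDiffOn_coefQA.continuousOn.mono (box_subset hβ))
  have h0 : (0 : ℝ × ℝ × ℝ) ∈ box β M :=
    ⟨⟨le_rfl, hβ0⟩, ⟨by simpa using hM, hM⟩, ⟨by simpa using hM, hM⟩⟩
  have hC1 : 0 ≤ C1 := (norm_nonneg _).trans (hb1 0 h0)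
  have hC2 : 0 ≤ C2 := (norm_nonneg _).trans (hb2 0 h0)
  refine ⟨C1 * (1 + |T|) + C2, by positivity, fun z hz a q w σ τ hσ hT => ?_⟩
  rw [dens2_eq (box_subset hβ hz), dens2_eq (box_subset hβ hz)]
  have k1 := hb1 z hz
  have k2 := hb2 z hz
  rw [Real.norm_eq_abs] at k1 k2
  have hτ : 0 ≤ τ := (abs_nonneg σ).trans hσ
  set W := a ^ 2 + q ^ 2 + w ^ 2 with hW
  have sa := sq_nonneg a
  have sq := sq_nonneg q
  have sw := sq_nonneg w
  have hW0 : 0 ≤ W := by positivity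
  -- Only the coefficients of `q²` and `q a` see the shift, and every term they produce carries a
  -- factor `σ`.
  have e1 : |coefQQ z * (σ * (2 * (q * a) + σ * a ^ 2))| ≤ C1 * (τ * (W + |T| * W)) := by
    rw [abs_mul, abs_mul]
    refine mul_le_mul k1 (mul_le_mul hσ ?_ (abs_nonneg _) hτ) (by positivity) hC1
    have h1 : |σ| ≤ |T| := hσ.trans (hT.trans (le_abs_self T))
    have h2 : |σ * a ^ 2| ≤ |T| * a ^ 2 := by
      rw [abs_mul, abs_of_nonneg sa]; exact mul_le_mul_of_nonneg_right h1 sa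
    have h3 := abs_mul_le_half_sq q a
    have h4 : |T| * a ^ 2 ≤ |T| * W := mul_le_mul_of_nonneg_left (by rw [hW]; linarith)
      (abs_nonneg T)
    calc |2 * (q * a) + σ * a ^ 2| ≤ |2 * (q * a)| + |σ * a ^ 2| := abs_add_le _ _
      _ ≤ W + |T| * W := by
        rw [abs_mul, abs_two]
        refine add_le_add ?_ (h2.trans h4)
        rw [hW]; linarith
  have e2 : |coefQA z * (σ * a ^ 2)| ≤ C2 * (τ * W) := by
    rw [abs_mul, abs_mul, abs_of_nonneg sa]
    exact mul_le_mul k2 (mul_le_mul hσ (by rw [hW]; linarith) sa hτ) (by positivity) hC2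
  rw [abs_le] at e1 e2 ⊢
  constructor <;> linarith

end Coefficients

/-! ### Chains of localised pairs -/

/-- The jet `(η, η', v)` of a pair. -/
noncomputable def jet (P : Hydro) (x : ℝ) : ℝ × ℝ × ℝ := (P.1 x, deriv P.1 x, P.2 x)

/-- A family of exponentially localised pairs centred at well separated points. -/
structure IsFamily (K s β ν L : ℝ) {N : ℕ} (νs a : Fin N → ℝ) (P : Fin N → Hydro) : Prop where
  K_nonneg : 0 ≤ K
  β_nonneg : 0 ≤ β
  ν_pos : 0 < ν
  ν_le : ∀ k, ν ≤ νs k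
  le_s : ∀ k, νs k ≤ s
  sep : ∀ j k, j ≠ k → L ≤ |a j - a k|
  L_pos : 0 < L
  weakX : ∀ k, WeakX (P k)
  diff : ∀ k, Differentiable ℝ (P k).1
  nonneg : ∀ k x, 0 ≤ (P k).1 x
  bound : ∀ k x, ‖jet (P k) x‖ ≤ K * νs k ^ 2 * Real.exp (-(1 / 4 * νs k * |x - a k|))
  le : ∀ x, (∑ k, P k).1 x ≤ β

lemma sum_hydro_fst {N : ℕ} (P : Fin N → Hydro) (t : Finset (Fin N)) (x : ℝ) :
    (∑ k ∈ t, P k).1 x = ∑ k ∈ t, (P k).1 x := by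
  rw [Prod.fst_sum, Finset.sum_apply]

lemma sum_hydro_snd {N : ℕ} (P : Fin N → Hydro) (t : Finset (Fin N)) (x : ℝ) :
    (∑ k ∈ t, P k).2 x = ∑ k ∈ t, (P k).2 x := by
  rw [Prod.snd_sum, Finset.sum_apply]

lemma weakX_sum {N : ℕ} {P : Fin N → Hydro} (h : ∀ k, WeakX (P k)) (t : Finset (Fin N)) :
    WeakX (∑ k ∈ t, P k) := by
  induction t using Finset.induction_on with
  | empty => simpa using weakX_zero
  | insert i t hi ih =>
    rw [Finset.sum_insert hi]
    simpa using (h i).add_smul ih 1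

namespace IsFamily

variable {K s β ν L : ℝ} {N : ℕ} {νs a : Fin N → ℝ} {P : Fin N → Hydro}

lemma νs_pos (h : IsFamily K s β ν L νs a P) (k : Fin N) : 0 < νs k := h.ν_pos.trans_le (h.ν_le k)

lemma jet_sum (h : IsFamily K s β ν L νs a P) (x : ℝ) :
    jet (∑ k, P k) x = ∑ k, jet (P k) x := by
  have h1 : (∑ k, P k).1 = fun x => ∑ k, (P k).1 x := funext fun x => sum_hydro_fst P _ x
  have h2 : deriv (∑ k, P k).1 x = ∑ k, deriv (P k).1 x := by
    rw [h1, deriv_fun_sum fun k _ => h.diff k x]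
  refine Prod.ext ?_ (Prod.ext ?_ ?_)
  · simp only [jet, sum_hydro_fst, Prod.fst_sum]
  · change deriv (∑ k, P k).1 x = _
    rw [h2]
    simp only [jet, Prod.snd_sum, Prod.fst_sum]
  · simp only [jet, sum_hydro_snd, Prod.snd_sum]

lemma norm_jet_le (h : IsFamily K s β ν L νs a P) (k : Fin N) (x : ℝ) :
    ‖jet (P k) x‖ ≤ K * s ^ 2 := by
  have h1 := h.νs_pos k
  refine (h.bound k x).trans ?_
  have h2 : Real.exp (-(1 / 4 * νs k * |x - a k|)) ≤ 1 := by
    apply Real.exp_le_one_iff.2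
    have : 0 ≤ 1 / 4 * νs k * |x - a k| := by positivity
    linarith
  have h3 : νs k ^ 2 ≤ s ^ 2 := pow_le_pow_left₀ h1.le (h.le_s k) 2
  have hK := h.K_nonneg
  calc K * νs k ^ 2 * Real.exp (-(1 / 4 * νs k * |x - a k|)) ≤ K * s ^ 2 * 1 := by gcongr
    _ = _ := mul_one _

/-- Since each `η` is nonnegative, a partial sum lies between `0` and the full sum, hence below `β`.
The inductive interaction estimate needs this for all partial sums. -/
lemma sum_jet_mem_box (h : IsFamily K s β ν L νs a P) (t : Finset (Fin N)) (x : ℝ) :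
    ∑ k ∈ t, jet (P k) x ∈ box β (N * (K * s ^ 2)) := by
  have hK := h.K_nonneg
  have hnorm : ‖∑ k ∈ t, jet (P k) x‖ ≤ N * (K * s ^ 2) := by
    calc ‖∑ k ∈ t, jet (P k) x‖ ≤ ∑ k ∈ t, K * s ^ 2 :=
          norm_sum_le_of_le _ fun k _ => h.norm_jet_le k x
      _ ≤ ∑ _k : Fin N, K * s ^ 2 :=
          Finset.sum_le_sum_of_subset_of_nonneg (Finset.subset_univ t) fun _ _ _ => by positivity
      _ = _ := by simp
  have h2 := (norm_snd_le (∑ k ∈ t, jet (P k) x)).trans hnorm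
  refine ⟨⟨?_, ?_⟩, abs_le.1 ((norm_fst_le _).trans h2), abs_le.1 ((norm_snd_le _).trans h2)⟩
  · rw [Prod.fst_sum]
    exact Finset.sum_nonneg fun k _ => h.nonneg k x
  · rw [Prod.fst_sum]
    have h3 := h.le x
    rw [sum_hydro_fst] at h3
    exact (Finset.sum_le_sum_of_subset_of_nonneg (Finset.subset_univ t)
      fun k _ _ => h.nonneg k x).trans h3

lemma jet_mem_box (h : IsFamily K s β ν L νs a P) (k : Fin N) (x : ℝ) :
    jet (P k) x ∈ box β (N * (K * s ^ 2)) := by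
  simpa using h.sum_jet_mem_box {k} x

lemma zero_mem_box (h : IsFamily K s β ν L νs a P) :
    (0 : ℝ × ℝ × ℝ) ∈ box β (N * (K * s ^ 2)) := by
  simpa using h.sum_jet_mem_box ∅ 0

lemma le_single (h : IsFamily K s β ν L νs a P) (k : Fin N) (x : ℝ) : (P k).1 x ≤ β :=
  (h.jet_mem_box k x).1.2

/-- The function controlling all interactions. -/
noncomputable def weight {N : ℕ} (νs a : Fin N → ℝ) (x : ℝ) : ℝ :=
  ∑ k, νs k * Real.exp (-(1 / 8 * νs k * |x - a k|))

lemma continuous_weight : Continuous (weight νs a) := by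
  unfold weight
  fun_prop

lemma weight_nonneg (h : IsFamily K s β ν L νs a P) (x : ℝ) : 0 ≤ weight νs a x :=
  Finset.sum_nonneg fun k _ => mul_nonneg (h.νs_pos k).le (Real.exp_pos _).le

lemma weight_le (h : IsFamily K s β ν L νs a P) (x : ℝ) : weight νs a x ≤ N * s := by
  calc weight νs a x ≤ ∑ _k : Fin N, s := by
        refine Finset.sum_le_sum fun k _ => ?_
        have h1 := h.νs_pos k
        have h2 : Real.exp (-(1 / 8 * νs k * |x - a k|)) ≤ 1 := by
          apply Real.exp_le_one_iff.2
          have : 0 ≤ 1 / 8 * νs k * |x - a k| := by positivity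
          linarith
        calc νs k * Real.exp (-(1 / 8 * νs k * |x - a k|)) ≤ νs k * 1 := by gcongr
          _ ≤ s := by rw [mul_one]; exact h.le_s k
    _ = _ := by simp

/-- The prefactor `νs k` compensates for the width of the exponential, so each term has integral
`16` whatever the speed. This keeps the constants bounded as the speeds approach `c_s`. -/
lemma integrable_weight (h : IsFamily K s β ν L νs a P) :
    Integrable (weight νs a) ∧ ∫ x, weight νs a x = 16 * N := by
  have hk : ∀ k, Integrable (fun x => νs k * Real.exp (-(1 / 8 * νs k * |x - a k|))) := fun k =>
    ((integrable_exp_neg_abs (b := 1 / 8 * νs k)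
      (by have := h.νs_pos k; positivity)).comp_sub_right (a k)).const_mul _
  refine ⟨integrable_finsetSum _ fun k _ => hk k, ?_⟩
  unfold weight
  rw [integral_finsetSum _ fun k _ => hk k]
  have : ∀ k, ∫ x, νs k * Real.exp (-(1 / 8 * νs k * |x - a k|)) = 16 := fun k => by
    have h1 := h.νs_pos k
    rw [integral_const_mul,
      integral_sub_right_eq_self (fun x => Real.exp (-(1 / 8 * νs k * |x|))) (a k),
      (integrable_and_integral_exp_neg_abs (b := 1 / 8 * νs k) (by positivity)).2]
    field_simp
    norm_num
  simp only [this]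
  simp [mul_comm]

/-- The square of the weight is at most its supremum, `N s`, times the weight itself. -/
lemma memLp_weight (h : IsFamily K s β ν L νs a P) :
    MemLp (weight νs a) 2 volume ∧ ∫ x, weight νs a x ^ 2 ≤ 16 * N * (N * s) := by
  obtain ⟨hi, hI⟩ := h.integrable_weight
  have hsq : ∀ x, weight νs a x ^ 2 ≤ N * s * weight νs a x := fun x => by
    rw [pow_two]
    exact mul_le_mul_of_nonneg_right (h.weight_le x) (h.weight_nonneg x)
  have h2 : Integrable (fun x => weight νs a x ^ 2) :=
    (hi.const_mul (N * s)).mono' (continuous_weight.pow 2).aestronglyMeasurable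
      (Eventually.of_forall fun x => by
        rw [Real.norm_of_nonneg (sq_nonneg _)]; exact hsq x)
  refine ⟨(memLp_two_iff_integrable_sq continuous_weight.aestronglyMeasurable).2 h2, ?_⟩
  calc ∫ x, weight νs a x ^ 2 ≤ ∫ x, N * s * weight νs a x :=
        integral_mono h2 (hi.const_mul _) hsq
    _ = _ := by rw [integral_const_mul, hI]; ring

/-- Pointwise bound on all interactions. -/
lemma interaction_le (h : IsFamily K s β ν L νs a P) (x : ℝ) :
    ∑ k, ∑ j ∈ Finset.univ.erase k, ‖jet (P j) x‖ * ‖jet (P k) x‖ ≤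
      N * (K ^ 2 * s ^ 3) * Real.exp (-(1 / 8 * ν * L)) * weight νs a x := by
  have hK := h.K_nonneg
  have hpair : ∀ k, ∀ j ∈ Finset.univ.erase k, ‖jet (P j) x‖ * ‖jet (P k) x‖ ≤
      K ^ 2 * s ^ 3 * Real.exp (-(1 / 8 * ν * L)) *
        (νs k * Real.exp (-(1 / 8 * νs k * |x - a k|))) := by
    intro k j hj
    have hjk : j ≠ k := Finset.ne_of_mem_erase hj
    have hs : 0 < s := (h.νs_pos k).trans_le (h.le_s k)
    have p1 := h.νs_pos j
    have p2 := h.νs_pos k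
    -- Half of each exponent is traded for `exp(-ν L / 8)` through `L ≤ |x - a j| + |x - a k|`; the
    -- other half at `a k` is kept for integrability.
    have e1 : Real.exp (-(1 / 4 * νs j * |x - a j|)) * Real.exp (-(1 / 4 * νs k * |x - a k|)) ≤
        Real.exp (-(1 / 8 * ν * L)) * Real.exp (-(1 / 8 * νs k * |x - a k|)) := by
      rw [← Real.exp_add, ← Real.exp_add]
      apply Real.exp_le_exp.2
      have t1 : L ≤ |x - a j| + |x - a k| := by
        refine (h.sep j k hjk).trans ?_
        have := abs_sub (x - a k) (x - a j)
        have e : x - a k - (x - a j) = a j - a k := by ring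
        rw [e] at this
        linarith
      have t2 : ν * |x - a j| ≤ νs j * |x - a j| :=
        mul_le_mul_of_nonneg_right (h.ν_le j) (abs_nonneg _)
      have t3 : ν * |x - a k| ≤ νs k * |x - a k| :=
        mul_le_mul_of_nonneg_right (h.ν_le k) (abs_nonneg _)
      have t4 : ν * L ≤ ν * (|x - a j| + |x - a k|) := mul_le_mul_of_nonneg_left t1 h.ν_pos.le
      have t5 : 0 ≤ νs j * |x - a j| := by positivity
      linarith
    calc ‖jet (P j) x‖ * ‖jet (P k) x‖ ≤ (K * νs j ^ 2 * Real.exp (-(1 / 4 * νs j * |x - a j|))) *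
          (K * νs k ^ 2 * Real.exp (-(1 / 4 * νs k * |x - a k|))) :=
          mul_le_mul (h.bound j x) (h.bound k x) (norm_nonneg _) (by positivity)
      -- Of the four powers of `νs`, three are bounded by `s ^ 3` and one is kept as the prefactor
      -- of the weight.
      _ = K ^ 2 * (νs j ^ 2 * νs k) * νs k * (Real.exp (-(1 / 4 * νs j * |x - a j|)) *
          Real.exp (-(1 / 4 * νs k * |x - a k|))) := by ring
      _ ≤ K ^ 2 * (s ^ 2 * s) * νs k * (Real.exp (-(1 / 8 * ν * L)) *
          Real.exp (-(1 / 8 * νs k * |x - a k|))) := by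
          have := h.le_s j
          have := h.le_s k
          gcongr
      _ = _ := by ring
  calc _ ≤ ∑ k, ∑ _j : Fin N, K ^ 2 * s ^ 3 * Real.exp (-(1 / 8 * ν * L)) *
        (νs k * Real.exp (-(1 / 8 * νs k * |x - a k|))) := by
        refine Finset.sum_le_sum fun k _ => (Finset.sum_le_sum (hpair k)).trans ?_
        refine Finset.sum_le_sum_of_subset_of_nonneg (Finset.erase_subset _ _) fun j _ _ => ?_
        have hs : 0 < s := (h.νs_pos k).trans_le (h.le_s k)
        have p2 := h.νs_pos k
        positivity
    _ = _ := by
        simp only [Finset.sum_const, Finset.card_univ, Fintype.card_fin, nsmul_eq_mul, weight,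
          Finset.mul_sum]
        exact Finset.sum_congr rfl fun k _ => by ring

/-- Interaction estimate for a smooth function of the jet which vanishes at the origin. -/
lemma exists_interaction (N : ℕ) (K s β : ℝ) (hβ : β < 1) {Ψ : ℝ × ℝ × ℝ → ℝ}
    (hΨ : ContDiffOn ℝ 2 Ψ jetDom) (h0 : Ψ 0 = 0) : ∃ C, 0 ≤ C ∧
    ∀ (ν L : ℝ) (νs a : Fin N → ℝ) (P : Fin N → Hydro), IsFamily K s β ν L νs a P →
      ∀ x, |Ψ (jet (∑ k, P k) x) - ∑ k, Ψ (jet (P k) x)| ≤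
        C * (Real.exp (-(1 / 8 * ν * L)) * weight νs a x) := by
  obtain ⟨C, hC, hint⟩ := exists_interaction_sum (M := N * (K * s ^ 2)) hβ hΨ h0
  -- The absolute value keeps the constant nonnegative for every real `s`, also when no family
  -- exists.
  refine ⟨C * (N * (K ^ 2 * |s| ^ 3)), by positivity, fun ν L νs a P h x => ?_⟩
  rw [h.jet_sum]
  refine (hint (Fin N) Finset.univ (fun k => jet (P k) x)
    fun t _ => h.sum_jet_mem_box t x).trans ?_
  have h1 := h.interaction_le x
  have h2 : N * (K ^ 2 * s ^ 3) ≤ N * (K ^ 2 * |s| ^ 3) := by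
    rw [← abs_pow]
    gcongr
    exact le_abs_self _
  have h3 : 0 ≤ Real.exp (-(1 / 8 * ν * L)) * weight νs a x :=
    mul_nonneg (Real.exp_pos _).le (h.weight_nonneg x)
  have h4 := mul_le_mul_of_nonneg_right h2 h3
  rw [mul_assoc C]
  refine mul_le_mul_of_nonneg_left ?_ hC
  linarith

end IsFamily

/-! ### Interaction estimates for the energy and its gradient -/

open IsFamily

/-- The energy of a chain is almost the sum of the energies. -/
lemma exists_energy_interaction {f : ℝ → ℝ} (hf : Nonlinearity f) (N : ℕ) (K s β : ℝ)
    (hβ : β < 1) : ∃ C, 0 ≤ C ∧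
    ∀ (ν L : ℝ) (νs a : Fin N → ℝ) (P : Fin N → Hydro), IsFamily K s β ν L νs a P →
      |energy f (∑ k, P k) - ∑ k, energy f (P k)| ≤ C * Real.exp (-(1 / 8 * ν * L)) := by
  obtain ⟨C, hC, hint⟩ := exists_interaction N K s β hβ (contDiffOn_dens0 hf)
    (by simp [dens0, Nonlinearity.potential_one])
  refine ⟨C * (16 * N), by positivity, fun ν L νs a P h => ?_⟩
  obtain ⟨i0, e0⟩ := energy_eq_integral hf (weakX_sum h.weakX Finset.univ) h.β_nonneg hβ h.le
  have hk := fun k => energy_eq_integral hf (h.weakX k) h.β_nonneg hβ (h.le_single k)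
  rw [e0, Finset.sum_congr rfl fun k _ => (hk k).2, ← integral_finsetSum _ fun k _ => (hk k).1,
    ← integral_sub i0 (integrable_finsetSum _ fun k _ => (hk k).1)]
  obtain ⟨hi, hI⟩ := h.integrable_weight
  have := norm_integral_le_of_norm_le
    ((hi.const_mul (Real.exp (-(1 / 8 * ν * L)))).const_mul C)
    (f := fun x => D0 f (∑ k, P k) x - ∑ k, D0 f (P k) x)
    (Eventually.of_forall fun x => hint ν L νs a P h x)
  rw [integral_const_mul, integral_const_mul, hI, Real.norm_eq_abs] at this
  refine this.trans (le_of_eq ?_)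
  ring

lemma sq_normX (ε : Hydro) : normX ε ^ 2 =
    (∫ x, ε.1 x ^ 2) + (∫ x, deriv ε.1 x ^ 2) + ∫ x, ε.2 x ^ 2 :=
  Real.sq_sqrt (add_nonneg (add_nonneg (integral_nonneg fun _ => sq_nonneg _)
    (integral_nonneg fun _ => sq_nonneg _)) (integral_nonneg fun _ => sq_nonneg _))

lemma normX_nonneg (ε : Hydro) : 0 ≤ normX ε := Real.sqrt_nonneg _

/-- Cauchy-Schwarz inequality for real functions. -/
lemma integral_mul_abs_le {g h : ℝ → ℝ} {A B : ℝ} (hg : MemLp g 2 volume) (hh : MemLp h 2 volume)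
    (hg0 : ∀ x, 0 ≤ g x) (hA : 0 ≤ A) (hB : 0 ≤ B) (h1 : ∫ x, g x ^ 2 ≤ A ^ 2)
    (h2 : ∫ x, h x ^ 2 ≤ B ^ 2) : ∫ x, g x * |h x| ≤ A * B := by
  have key := integral_mul_le_Lp_mul_Lq_of_nonneg (μ := volume) (p := 2) (q := 2)
    (by norm_num [Real.holderConjugate_iff]) (f := g) (g := fun x => |h x|)
    (Eventually.of_forall hg0) (Eventually.of_forall fun x => abs_nonneg _)
    (by rw [ENNReal.ofReal_ofNat]; exact hg) (by rw [ENNReal.ofReal_ofNat]; exact hh.norm)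
  simp only [Real.rpow_two, sq_abs, ← Real.sqrt_eq_rpow] at key
  refine key.trans (mul_le_mul ?_ ?_ (Real.sqrt_nonneg _) hA)
  · rw [Real.sqrt_le_left hA]; exact h1
  · rw [Real.sqrt_le_left hB]; exact h2

/-- The first differential of the energy at a chain is almost the sum of the differentials. -/
lemma exists_gradient_interaction {f : ℝ → ℝ} (hf : Nonlinearity f) (N : ℕ) (K s β : ℝ)
    (hβ : β < 1) : ∃ C, 0 ≤ C ∧
    ∀ (ν L : ℝ) (νs a : Fin N → ℝ) (P : Fin N → Hydro), IsFamily K s β ν L νs a P →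
      ∀ ε : Hydro, WeakX ε → |(∫ x, D1 f (∑ k, P k) ε x) - ∑ k, ∫ x, D1 f (P k) ε x| ≤
        C * Real.exp (-(1 / 8 * ν * L)) * normX ε := by
  obtain ⟨C1, hC1, hint1⟩ := exists_interaction N K s β hβ contDiffOn_coefQ (by simp [coefQ])
  obtain ⟨C2, hC2, hint2⟩ := exists_interaction N K s β hβ (contDiffOn_coefA hf)
    (by simp [coefA, hf.vanish])
  -- The differential is linear in the direction, so it suffices that its three coefficients
  -- decouple; the direction is then paired with the weight by Cauchy-Schwarz.
  obtain ⟨C3, hC3, hint3⟩ := exists_interaction N K s β hβ contDiffOn_coefW (by simp [coefW])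
  set A := Real.sqrt (16 * N * (N * |s|)) with hA
  refine ⟨(C1 + C2 + C3) * A, by positivity, fun ν L νs a P h ε hε => ?_⟩
  have hk := fun k => (diagDeriv_energy hf (h.weakX k) hε h.β_nonneg hβ (h.le_single k)).1
  have h0 := (diagDeriv_energy hf (weakX_sum h.weakX Finset.univ) hε h.β_nonneg hβ h.le).1
  rw [← integral_finsetSum _ fun k _ => hk k,
    ← integral_sub h0 (integrable_finsetSum _ fun k _ => hk k)]
  set E := Real.exp (-(1 / 8 * ν * L)) with hE
  set W := weight νs a with hW
  obtain ⟨hWL, hWI⟩ := h.memLp_weight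
  have hpt : ∀ x, ‖D1 f (∑ k, P k) ε x - ∑ k, D1 f (P k) ε x‖ ≤
      E * (C1 * (W x * |deriv ε.1 x|) + C2 * (W x * |ε.1 x|) + C3 * (W x * |ε.2 x|)) := by
    intro x
    have e : D1 f (∑ k, P k) ε x - ∑ k, D1 f (P k) ε x =
        (coefQ (jet (∑ k, P k) x) - ∑ k, coefQ (jet (P k) x)) * deriv ε.1 x
        + (coefA f (jet (∑ k, P k) x) - ∑ k, coefA f (jet (P k) x)) * ε.1 x
        + (coefW (jet (∑ k, P k) x) - ∑ k, coefW (jet (P k) x)) * ε.2 x := by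
      have e1 : ∀ Q : Hydro, D1 f Q ε x = coefQ (jet Q x) * deriv ε.1 x
          + coefA f (jet Q x) * ε.1 x + coefW (jet Q x) * ε.2 x := fun Q =>
        dens1_eq (jet Q x) _ _ _
      simp only [e1, Finset.sum_add_distrib, ← Finset.sum_mul]
      ring
    rw [e]
    refine (norm_add₃_le).trans ?_
    simp only [norm_mul, Real.norm_eq_abs]
    have k1 := mul_le_mul_of_nonneg_right (hint1 ν L νs a P h x) (abs_nonneg (deriv ε.1 x))
    have k2 := mul_le_mul_of_nonneg_right (hint2 ν L νs a P h x) (abs_nonneg (ε.1 x))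
    have k3 := mul_le_mul_of_nonneg_right (hint3 ν L νs a P h x) (abs_nonneg (ε.2 x))
    simp only [← hE, ← hW] at k1 k2 k3
    linarith
  have j1 : Integrable (fun x => W x * |deriv ε.1 x|) := hWL.integrable_mul hε.1.memLp_deriv.abs
  have j2 : Integrable (fun x => W x * |ε.1 x|) := hWL.integrable_mul hε.1.memLp.abs
  have j3 : Integrable (fun x => W x * |ε.2 x|) := hWL.integrable_mul hε.2.abs
  have hA2 : ∫ x, W x ^ 2 ≤ A ^ 2 := by
    rw [hA, Real.sq_sqrt (by positivity)]
    refine hWI.trans ?_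
    gcongr
    exact le_abs_self s
  have n1 := integral_nonneg (μ := volume) (f := fun x => ε.1 x ^ 2) fun _ => sq_nonneg _
  have n2 := integral_nonneg (μ := volume) (f := fun x => deriv ε.1 x ^ 2) fun _ => sq_nonneg _
  have n3 := integral_nonneg (μ := volume) (f := fun x => ε.2 x ^ 2) fun _ => sq_nonneg _
  have hn := sq_normX ε
  have b1 := integral_mul_abs_le hWL hε.1.memLp_deriv h.weight_nonneg (Real.sqrt_nonneg _)
    (normX_nonneg ε) hA2 (by linarith)
  have b2 := integral_mul_abs_le hWL hε.1.memLp h.weight_nonneg (Real.sqrt_nonneg _)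
    (normX_nonneg ε) hA2 (by linarith)
  have b3 := integral_mul_abs_le hWL hε.2 h.weight_nonneg (Real.sqrt_nonneg _)
    (normX_nonneg ε) hA2 (by linarith)
  have hle := norm_integral_le_of_norm_le
    ((((j1.const_mul C1).add (j2.const_mul C2)).add (j3.const_mul C3)).const_mul E)
    (Eventually.of_forall hpt)
  have hsplit : ∫ x, (C1 * (W x * |deriv ε.1 x|) + C2 * (W x * |ε.1 x|)
      + C3 * (W x * |ε.2 x|)) = C1 * (∫ x, W x * |deriv ε.1 x|) + C2 * (∫ x, W x * |ε.1 x|)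
      + C3 * ∫ x, W x * |ε.2 x| := by
    have s1 := integral_add (j1.const_mul C1) (j2.const_mul C2)
    have s2 := integral_add ((j1.const_mul C1).add (j2.const_mul C2)) (j3.const_mul C3)
    simp only [Pi.add_apply] at s2
    rw [s2, s1, integral_const_mul, integral_const_mul, integral_const_mul]
  rw [integral_const_mul, Real.norm_eq_abs] at hle
  refine hle.trans ?_
  simp only [Pi.add_apply]
  rw [hsplit]
  calc _ ≤ E * (C1 * (A * normX ε) + C2 * (A * normX ε) + C3 * (A * normX ε)) := by gcongr
    _ = _ := by ring

/-! ### Localisation of the second differential -/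

/-- Multiplication of a pair by a function. -/
def mulCut (χ : ℝ → ℝ) (ε : Hydro) : Hydro := (fun x => ε.1 x * χ x, fun x => ε.2 x * χ x)

section Localisation

variable {f : ℝ → ℝ} {τ : ℝ} {Φ σ : ℝ → ℝ} {ε : Hydro}

lemma IsCutoff.sqrt_le_one (h : IsCutoff τ Φ σ) (x : ℝ) : Real.sqrt (Φ x) ≤ 1 :=
  Real.sqrt_le_one.2 (h.le_one x)

lemma IsCutoff.continuous_sqrt (h : IsCutoff τ Φ σ) : Continuous fun x => Real.sqrt (Φ x) :=
  continuous_iff_continuousAt.2 fun x => (h.sqrt_deriv x).continuousAt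

lemma memLp_mul_of_bounded {g χ : ℝ → ℝ} {C : ℝ} (hg : MemLp g 2 volume) (hχ : Continuous χ)
    (hb : ∀ x, |χ x| ≤ C) : MemLp (fun x => g x * χ x) 2 volume := by
  refine hg.of_le_mul (c := C) (hg.1.mul hχ.aestronglyMeasurable) (Eventually.of_forall fun x => ?_)
  rw [norm_mul, mul_comm, Real.norm_eq_abs (χ x)]
  exact mul_le_mul_of_nonneg_right (hb x) (norm_nonneg _)

lemma IsCutoff.deriv_mul (h : IsCutoff τ Φ σ) (hε : WeakH1 ε.1) :
    ∀ᵐ x, HasDerivAt (mulCut (fun x => Real.sqrt (Φ x)) ε).1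
      ((deriv ε.1 x + σ x * ε.1 x) * Real.sqrt (Φ x)) x := by
  filter_upwards [hε.ae_diff] with x hx
  refine (hx.hasDerivAt.mul (h.sqrt_deriv x)).congr_deriv ?_
  ring

lemma IsCutoff.weakX_mulCut (h : IsCutoff τ Φ σ) (hε : WeakX ε) :
    WeakX (mulCut (fun x => Real.sqrt (Φ x)) ε) := by
  have hχ : ∀ x, |Real.sqrt (Φ x)| ≤ 1 := fun x => by
    rw [abs_of_nonneg (Real.sqrt_nonneg _)]; exact h.sqrt_le_one x
  have hd := h.deriv_mul hε.1
  refine ⟨⟨?_, memLp_mul_of_bounded hε.1.memLp h.continuous_sqrt hχ, ?_, ?_⟩,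
    memLp_mul_of_bounded hε.2 h.continuous_sqrt hχ⟩
  · filter_upwards [hd] with x hx using hx.differentiableAt
  · have h1 : MemLp (fun x => (deriv ε.1 x + ε.1 x * σ x) * Real.sqrt (Φ x)) 2 volume :=
      memLp_mul_of_bounded (hε.1.memLp_deriv.add (memLp_mul_of_bounded hε.1.memLp h.cont h.bound))
        h.continuous_sqrt hχ
    refine (memLp_congr_ae ?_).1 h1
    filter_upwards [hd] with x hx
    rw [hx.deriv, mul_comm (σ x)]
  · obtain ⟨B, hB⟩ := hε.1.bdd
    refine ⟨B, fun x => ?_⟩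
    simp only [mulCut]
    rw [abs_mul]
    exact (mul_le_of_le_one_right (abs_nonneg _) (hχ x)).trans (hB x)

/-- Homogeneity takes the factor `√Φ` out of a localised direction as the weight `Φ`. -/
lemma dens2_scale (f : ℝ → ℝ) (u p v a q w r : ℝ) :
    dens2 f u p v (a * r) (q * r) (w * r) = r ^ 2 * dens2 f u p v a q w := by
  simp only [dens2]; ring

/-- The second differential in a localised direction. -/
lemma diagDeriv_mulCut (hf : Nonlinearity f) (h : IsCutoff τ Φ σ) (hε : WeakX ε) {V : Hydro}
    (hV : WeakX V) {b : ℝ} (hb0 : 0 ≤ b) (hb : b < 1) (hVb : ∀ x, V.1 x ≤ b) :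
    Integrable (fun x => Φ x * dens2 f (V.1 x) (deriv V.1 x) (V.2 x) (ε.1 x)
      (deriv ε.1 x + σ x * ε.1 x) (ε.2 x)) ∧
    diagDeriv 2 (energy f) V (mulCut (fun x => Real.sqrt (Φ x)) ε) =
      ∫ x, Φ x * dens2 f (V.1 x) (deriv V.1 x) (V.2 x) (ε.1 x)
      (deriv ε.1 x + σ x * ε.1 x) (ε.2 x) := by
  obtain ⟨-, hi, he, -⟩ := diagDeriv_energy hf hV (h.weakX_mulCut hε) hb0 hb hVb
  have hae : D2 f V (mulCut (fun x => Real.sqrt (Φ x)) ε) =ᵐ[volume]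
      fun x => Φ x * dens2 f (V.1 x) (deriv V.1 x) (V.2 x) (ε.1 x)
      (deriv ε.1 x + σ x * ε.1 x) (ε.2 x) := by
    filter_upwards [h.deriv_mul hε.1] with x hx
    have hd := hx.deriv
    simp only [D2]
    rw [hd]
    simp only [mulCut, dens2_scale, Real.sq_sqrt (h.pos x).le]
  exact ⟨hi.congr hae, by rw [he]; exact integral_congr_ae hae⟩

/-- Localisation of the second differential by means of a partition of unity. -/
lemma exists_localisation (hf : Nonlinearity f) {β M : ℝ} (hβ0 : 0 ≤ β) (hβ : β < 1) (hM : 0 ≤ M)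
    (T : ℝ) : ∃ C, 0 ≤ C ∧ ∀ (ι : Type) [Fintype ι] (R : Hydro) (V : ι → Hydro)
      (Φ σ : ι → ℝ → ℝ) (τ δ : ℝ) (ε : Hydro), τ ≤ T → WeakX R → (∀ i, WeakX (V i)) → WeakX ε →
      (∀ x, jet R x ∈ box β M) → (∀ i x, jet (V i) x ∈ box β M) →
      (∀ i, IsCutoff τ (Φ i) (σ i)) → (∀ x, ∑ i, Φ i x = 1) →
      (∀ i x, Φ i x * ‖jet R x - jet (V i) x‖ ≤ δ) →
      |(∫ x, D2 f R ε x) - ∑ i, diagDeriv 2 (energy f) (V i)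
          (mulCut (fun x => Real.sqrt (Φ i x)) ε)| ≤
        Fintype.card ι * (C * (δ + τ)) * normX ε ^ 2 := by
  obtain ⟨C1, hC1, h1⟩ := exists_dens2_lipschitz (M := M) hf hβ
  obtain ⟨C2, hC2, h2⟩ := exists_dens2_shift (f := f) hβ0 hβ hM T
  refine ⟨C1 + C2, by positivity, ?_⟩
  intro ι _ R V Φ σ τ δ ε hτT hR hV hε hRb hVb hcut hsum hclose
  have hk := fun i => diagDeriv_mulCut hf (hcut i) hε (hV i) hβ0 hβ fun x => (hVb i x).1.2
  have h0 := (diagDeriv_energy hf hR hε hβ0 hβ fun x => (hRb x).1.2).2.1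
  rw [Finset.sum_congr rfl fun i _ => (hk i).2, ← integral_finsetSum _ fun i _ => (hk i).1,
    ← integral_sub h0 (integrable_finsetSum _ fun i _ => (hk i).1)]
  set W : ℝ → ℝ := fun x => ε.1 x ^ 2 + deriv ε.1 x ^ 2 + ε.2 x ^ 2 with hW
  have hW0 : ∀ x, 0 ≤ W x := fun x => by positivity
  have i1 := hε.1.memLp.integrable_sq
  have i2 := hε.1.memLp_deriv.integrable_sq
  have i3 := hε.2.integrable_sq
  have hWI : Integrable W := (i1.add i2).add i3
  have hWn : ∫ x, W x = normX ε ^ 2 := by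
    have s1 := integral_add i1 i2
    have s2 := integral_add (i1.add i2) i3
    simp only [Pi.add_apply] at s2
    rw [sq_normX, ← s1, ← s2]
  have hpt : ∀ x, ‖D2 f R ε x - ∑ i, Φ i x * dens2 f ((V i).1 x) (deriv (V i).1 x) ((V i).2 x)
      (ε.1 x) (deriv ε.1 x + σ i x * ε.1 x) (ε.2 x)‖ ≤
      Fintype.card ι * ((C1 + C2) * (δ + τ)) * W x := by
    intro x
    -- After inserting the partition of unity, each piece is compared in two moves: the change of
    -- base point costs `Φ i ‖jet R - jet (V i)‖ ≤ δ`, and the derivative falling on `√Φ` costs `τ`.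
    have e : D2 f R ε x = ∑ i, Φ i x * D2 f R ε x := by
      rw [← Finset.sum_mul, hsum, one_mul]
    rw [e, ← Finset.sum_sub_distrib]
    have hterm : ∀ i ∈ Finset.univ, ‖Φ i x * D2 f R ε x
        - Φ i x * dens2 f ((V i).1 x) (deriv (V i).1 x) ((V i).2 x)
      (ε.1 x) (deriv ε.1 x + σ i x * ε.1 x) (ε.2 x)‖ ≤ ((C1 + C2) * (δ + τ)) * W x := by
      intro i _
      have hΦ0 := ((hcut i).pos x).le
      have hτ0 : 0 ≤ τ := (abs_nonneg _).trans ((hcut i).bound x)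
      have hδ0 : 0 ≤ δ := (mul_nonneg hΦ0 (norm_nonneg _)).trans (hclose i x)
      have k1 := h1 _ (hRb x) _ (hVb i x) (ε.1 x) (deriv ε.1 x) (ε.2 x)
      have k2 := h2 _ (hVb i x) (ε.1 x) (deriv ε.1 x) (ε.2 x) (σ i x) τ ((hcut i).bound x) hτT
      have hWx : ε.1 x ^ 2 + deriv ε.1 x ^ 2 + ε.2 x ^ 2 = W x := rfl
      rw [hWx] at k1 k2
      rw [← mul_sub, norm_mul, Real.norm_eq_abs, abs_of_nonneg hΦ0, Real.norm_eq_abs]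
      have k3 : |D2 f R ε x - dens2 f ((V i).1 x) (deriv (V i).1 x) ((V i).2 x)
          (ε.1 x) (deriv ε.1 x + σ i x * ε.1 x) (ε.2 x)| ≤
          C1 * ‖jet R x - jet (V i) x‖ * W x + C2 * τ * W x := by
        refine (abs_sub_le _ (dens2 f ((V i).1 x) (deriv (V i).1 x) ((V i).2 x)
          (ε.1 x) (deriv ε.1 x) (ε.2 x)) _).trans (add_le_add k1 ?_)
        rw [abs_sub_comm]; exact k2
      have k4 := mul_le_mul_of_nonneg_left k3 hΦ0
      have k5 : Φ i x * ‖jet R x - jet (V i) x‖ * (C1 * W x) ≤ δ * (C1 * W x) :=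
        mul_le_mul_of_nonneg_right (hclose i x) (mul_nonneg hC1 (hW0 x))
      have k6 : Φ i x * (C2 * τ * W x) ≤ 1 * (C2 * τ * W x) :=
        mul_le_mul_of_nonneg_right ((hcut i).le_one x)
          (mul_nonneg (mul_nonneg hC2 hτ0) (hW0 x))
      have k7 : 0 ≤ C2 * δ * W x := mul_nonneg (mul_nonneg hC2 hδ0) (hW0 x)
      have k8 : 0 ≤ C1 * τ * W x := mul_nonneg (mul_nonneg hC1 hτ0) (hW0 x)
      nlinarith
    refine (norm_sum_le_of_le _ hterm).trans (le_of_eq ?_)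
    simp only [Finset.sum_const, Finset.card_univ, nsmul_eq_mul]
    ring
  have hle := norm_integral_le_of_norm_le (hWI.const_mul _) (Eventually.of_forall hpt)
  rw [integral_const_mul, hWn] at hle
  exact hle

end Localisation

/-- A cut-off which is small near `a j` and bounded by `1` makes the `j`-th pair small. -/
lemma IsFamily.cutoff_mul_le {K s β ν L τ Φ x : ℝ} {N : ℕ} {νs a : Fin N → ℝ}
    {P : Fin N → Hydro} (h : IsFamily K s β ν L νs a P) (hτν : 2 * τ < ν)
    (j : Fin N) (hΦ1 : Φ ≤ 1)
    (hΦ : |x - a j| < L / 8 → Φ ≤ Real.exp (-(τ * L / 16))) :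
    Φ * ‖jet (P j) x‖ ≤ K * s ^ 2 * Real.exp (-(τ * L / 16)) := by
  have hK := h.K_nonneg
  rcases lt_or_ge |x - a j| (L / 8) with hx | hx
  · calc Φ * ‖jet (P j) x‖ ≤ Real.exp (-(τ * L / 16)) * (K * s ^ 2) :=
        mul_le_mul (hΦ hx) (h.norm_jet_le j x) (norm_nonneg _) (Real.exp_pos _).le
      _ = _ := mul_comm _ _
  -- Away from `a j` the soliton itself is small: `νs j |x - a j| / 4 ≥ (2 τ) (L / 8) / 4 = τ L /
  -- 16`.
  · have h1 : Real.exp (-(1 / 4 * νs j * |x - a j|)) ≤ Real.exp (-(τ * L / 16)) := by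
      apply Real.exp_le_exp.2
      have h2 : 2 * τ ≤ νs j := hτν.le.trans (h.ν_le j)
      have h3 : 2 * τ * (L / 8) ≤ νs j * |x - a j| :=
        mul_le_mul h2 hx (by have := h.L_pos; positivity) (h.νs_pos j).le
      linarith
    have h4 : νs j ^ 2 ≤ s ^ 2 := pow_le_pow_left₀ (h.νs_pos j).le (h.le_s j) 2
    calc Φ * ‖jet (P j) x‖ ≤ 1 * (K * νs j ^ 2 * Real.exp (-(1 / 4 * νs j * |x - a j|))) :=
        mul_le_mul hΦ1 (h.bound j x) (norm_nonneg _) zero_le_one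
      _ ≤ 1 * (K * s ^ 2 * Real.exp (-(τ * L / 16))) := by gcongr
      _ = _ := one_mul _

lemma jet_zero (x : ℝ) : jet 0 x = 0 := by
  have : deriv (0 : ℝ → ℝ) x = 0 := deriv_const x 0
  simp [jet, this]

/-- Localisation of the second differential of the energy around the members of a chain. -/
lemma exists_hessian_localisation {f : ℝ → ℝ} (hf : Nonlinearity f) (N : ℕ) {K s β : ℝ}
    (hK : 0 ≤ K) (hβ0 : 0 ≤ β) (hβ : β < 1) : ∃ C, 0 ≤ C ∧
    ∀ (ν L τ : ℝ) (νs a : Fin N → ℝ) (P : Fin N → Hydro), IsFamily K s β ν L νs a P →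
      a ∈ Pos N L → 0 < τ → 2 * τ < ν → ν ≤ s → ∀ ε : Hydro, WeakX ε →
      |(∫ x, D2 f (∑ k, P k) ε x) -
        (∑ k, diagDeriv 2 (energy f) (P k) (mulCut (fun x => Real.sqrt (solCutoff τ L a k x)) ε)
        + ∑ k, diagDeriv 2 (energy f) 0 (mulCut (fun x => Real.sqrt (gapCutoff τ L a k x)) ε))| ≤
        C * (Real.exp (-(τ * L / 16)) + τ) * normX ε ^ 2 := by
  obtain ⟨C, hC, hloc⟩ := exists_localisation hf (M := N * (K * s ^ 2)) hβ0 hβ (by positivity) s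
  refine ⟨(N + (N + 1)) * (C * (N * (K * s ^ 2) + 1)), by positivity, ?_⟩
  intro ν L τ νs a P h ha hτ hτν hνs ε hε
  have hL := h.L_pos
  choose σ1 hσ1 using fun k => exists_isCutoff_sol (a := a) hτ hL k
  choose σ2 hσ2 using fun k => exists_isCutoff_gap hτ hL ha k
  set E := Real.exp (-(τ * L / 16)) with hE
  have hE0 : 0 < E := Real.exp_pos _
  -- The partition is indexed by solitons and gaps, with base point `P k` around a soliton and `0`
  -- in a gap.
  have key := hloc (Fin N ⊕ Fin (N + 1)) (∑ k, P k) (Sum.elim P fun _ => 0)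
    (Sum.elim (solCutoff τ L a) (gapCutoff τ L a)) (Sum.elim σ1 σ2) τ (N * (K * s ^ 2) * E) ε
    (by linarith) (weakX_sum h.weakX _)
    (by rintro (i | i); exacts [h.weakX i, weakX_zero]) hε
    (fun x => by rw [h.jet_sum]; exact h.sum_jet_mem_box _ x)
    (by
      rintro (i | i) x
      · exact h.jet_mem_box i x
      · simp only [Sum.elim_inr, jet_zero]; exact h.zero_mem_box)
    (by rintro (i | i); exacts [hσ1 i, hσ2 i])
    (fun x => by simpa [Fintype.sum_sum_type] using sum_cutoffs x)
    (by
      rintro (i | i) x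
      · simp only [Sum.elim_inl]
        rw [h.jet_sum, ← Finset.add_sum_erase _ _ (Finset.mem_univ i), add_sub_cancel_left]
        have hpos := ((hσ1 i).pos x).le
        calc solCutoff τ L a i x * ‖∑ j ∈ Finset.univ.erase i, jet (P j) x‖
            ≤ solCutoff τ L a i x * ∑ j ∈ Finset.univ.erase i, ‖jet (P j) x‖ :=
              mul_le_mul_of_nonneg_left (norm_sum_le _ _) hpos
          _ = ∑ j ∈ Finset.univ.erase i, solCutoff τ L a i x * ‖jet (P j) x‖ := Finset.mul_sum _ _ _
          _ ≤ ∑ j ∈ Finset.univ.erase i, K * s ^ 2 * E := by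
              refine Finset.sum_le_sum fun j hj => ?_
              have hji : j ≠ i := Finset.ne_of_mem_erase hj
              refine h.cutoff_mul_le hτν j ((hσ1 i).le_one x) fun hx => ?_
              refine (solCutoff_le i x).trans (Real.exp_le_exp.2 ?_)
              -- Near `a j` the point `x` is far from `a i`, so the cut-off around soliton `i` is
              -- small there.
              have h1 : L ≤ |x - a j| + |x - a i| := by
                refine (h.sep j i hji).trans ?_
                have := abs_sub (x - a i) (x - a j)
                have e : x - a i - (x - a j) = a j - a i := by ring
                rw [e] at this
                linarith
              have h2 : L / 8 ≤ |x - a i| - L / 4 := by linarith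
              have h3 : τ * (L / 8) ≤ τ * (|x - a i| - L / 4) := mul_le_mul_of_nonneg_left h2 hτ.le
              have h4 : 0 ≤ τ * L := by positivity
              linarith
          _ ≤ ∑ _j : Fin N, K * s ^ 2 * E :=
              Finset.sum_le_sum_of_subset_of_nonneg (Finset.erase_subset _ _)
                fun _ _ _ => by positivity
          _ = _ := by simp; ring
      · simp only [Sum.elim_inr, jet_zero, sub_zero]
        rw [h.jet_sum]
        have hpos := ((hσ2 i).pos x).le
        calc gapCutoff τ L a i x * ‖∑ j, jet (P j) x‖
            ≤ gapCutoff τ L a i x * ∑ j, ‖jet (P j) x‖ :=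
              mul_le_mul_of_nonneg_left (norm_sum_le _ _) hpos
          _ = ∑ j, gapCutoff τ L a i x * ‖jet (P j) x‖ := Finset.mul_sum _ _ _
          _ ≤ ∑ _j : Fin N, K * s ^ 2 * E := by
              refine Finset.sum_le_sum fun j _ => ?_
              refine h.cutoff_mul_le hτν j ((hσ2 i).le_one x) fun hx => ?_
              refine (gapCutoff_le hτ hL ha i j hx).trans (Real.exp_le_exp.2 ?_)
              have h4 : 0 ≤ τ * L := by positivity
              linarith
          _ = _ := by simp; ring)
  simp only [Fintype.sum_sum_type, Sum.elim_inl, Sum.elim_inr, Fintype.card_sum,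
    Fintype.card_fin] at key
  refine key.trans ?_
  push_cast
  have h1 : N * (K * s ^ 2) * E + τ ≤ (N * (K * s ^ 2) + 1) * (E + τ) := by
    have : 0 ≤ N * (K * s ^ 2) * τ := by positivity
    nlinarith
  calc ((N : ℝ) + (N + 1)) * (C * (N * (K * s ^ 2) * E + τ)) * normX ε ^ 2
      ≤ (N + (N + 1)) * (C * ((N * (K * s ^ 2) + 1) * (E + τ))) * normX ε ^ 2 := by gcongr
    _ = _ := by ring

/-! ### Translations -/

lemma MemH1.comp_sub_const {u : ℝ → ℝ} (hu : MemH1 u) (a : ℝ) : MemH1 fun x => u (x - a) := by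
  obtain ⟨h0, g, hg, h⟩ := hu
  have mp : MeasurePreserving (fun x : ℝ => x - a) volume volume :=
    measurePreserving_sub_right volume a
  refine ⟨h0.comp_measurePreserving mp, fun x => g (x - a), hg.comp_measurePreserving mp,
    fun x y => ?_⟩
  rw [h, intervalIntegral.integral_comp_sub_right]

lemma translate_mem_XSpace {P : Hydro} (hP : P ∈ XSpace) (a : ℝ) : translate a P ∈ XSpace :=
  ⟨hP.1.comp_sub_const a,
    hP.2.comp_measurePreserving (measurePreserving_sub_right volume a)⟩

lemma sub_mem_XSpace {P R : Hydro} (hP : P ∈ XSpace) (hR : R ∈ XSpace) : P - R ∈ XSpace := by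
  refine ⟨?_, hP.2.sub hR.2⟩
  have := hP.1.add hR.1.neg
  simp only [← sub_eq_add_neg] at this
  exact this

lemma sum_mem_XSpace {N : ℕ} {P : Fin N → Hydro} (h : ∀ k, P k ∈ XSpace) (t : Finset (Fin N)) :
    ∑ k ∈ t, P k ∈ XSpace := by
  induction t using Finset.induction_on with
  | empty =>
    refine ⟨⟨MemLp.zero', 0, MemLp.zero', fun x y => ?_⟩, MemLp.zero'⟩
    simp
  | insert i t hi ih =>
    rw [Finset.sum_insert hi]
    exact ⟨(h i).1.add ih.1, (h i).2.add ih.2⟩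

lemma deriv_translate_fst (a : ℝ) (P : Hydro) (x : ℝ) :
    deriv (translate a P).1 x = deriv P.1 (x - a) :=
  deriv_comp_sub_const _ _ _

lemma energy_translate (f : ℝ → ℝ) (a : ℝ) (P : Hydro) :
    energy f (translate a P) = energy f P := by
  simp only [energy, deriv_translate_fst]
  simp only [translate]
  rw [integral_sub_right_eq_self (fun x => deriv P.1 x ^ 2 / (1 - P.1 x)) a,
    integral_sub_right_eq_self (fun x => (1 - P.1 x) * P.2 x ^ 2) a,
    integral_sub_right_eq_self (fun x => potential f (1 - P.1 x)) a]

lemma diagDeriv_energy_translate (f : ℝ → ℝ) (n : ℕ) (a : ℝ) (P ε : Hydro) :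
    diagDeriv n (energy f) (translate a P) (translate a ε) = diagDeriv n (energy f) P ε := by
  have h : ∀ s : ℝ, translate a P + s • translate a ε = translate a (P + s • ε) := fun s => rfl
  simp only [diagDeriv, h, energy_translate]

/-- By translation invariance of the energy, recentring the perturbation at `0` amounts to moving
the soliton to `a k`. -/
lemma diagDeriv_epsSol (f : ℝ → ℝ) {N : ℕ} (τ L : ℝ) (a : Fin N → ℝ) (ε P : Hydro) (k : Fin N) :
    diagDeriv 2 (energy f) P (epsSol τ L a ε k) =
      diagDeriv 2 (energy f) (translate (a k) P)
        (mulCut (fun x => Real.sqrt (solCutoff τ L a k x)) ε) := by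
  rw [← diagDeriv_energy_translate f 2 (a k)]
  congr 1
  simp [translate, epsSol, mulCut]

lemma iteratedDeriv_translate (k : ℕ) (u : ℝ → ℝ) (a x : ℝ) :
    iteratedDeriv k (fun x => u (x - a)) x = iteratedDeriv k u (x - a) :=
  congrFun (iteratedDeriv_comp_sub_const k u a) x

lemma IsSoliton.translate {f : ℝ → ℝ} {c : ℝ} {P : Hydro} (hP : IsSoliton f c P) (a : ℝ) :
    IsSoliton f c (translate a P) := by
  obtain ⟨x, y, hxy⟩ := hP.nonconst
  refine ⟨⟨translate_mem_XSpace hP.mem.1 a, fun x => hP.mem.2 _⟩,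
    hP.smooth_eta.comp (contDiff_id.sub contDiff_const),
    hP.smooth_v.comp (contDiff_id.sub contDiff_const), ⟨x + a, y + a, ?_⟩,
    fun x => hP.eq_one _, fun x => ?_⟩
  · simpa [NLSHydro.translate] using hxy
  · rw [deriv_translate_fst]
    have := hP.eq_two (x - a)
    rw [← iteratedDeriv_translate] at this
    exact this

/-! ### Solitons are critical points -/

/-- The differential of the momentum. -/
lemma diagDeriv_momentum {P ε : Hydro} (hP : P ∈ XSpace) (hε : ε ∈ XSpace) :
    diagDeriv 1 momentum P ε = 1 / 2 * ∫ x, (P.1 x * ε.2 x + ε.1 x * P.2 x) := by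
  have i0 : Integrable (fun x => P.1 x * P.2 x) := hP.1.1.integrable_mul hP.2
  have i1 : Integrable (fun x => P.1 x * ε.2 x + ε.1 x * P.2 x) :=
    (hP.1.1.integrable_mul hε.2).add (hε.1.1.integrable_mul hP.2)
  have i2 : Integrable (fun x => ε.1 x * ε.2 x) := hε.1.1.integrable_mul hε.2
  have h : ∀ s : ℝ, momentum (P + s • ε) = 1 / 2 * ((∫ x, P.1 x * P.2 x)
      + s * (∫ x, (P.1 x * ε.2 x + ε.1 x * P.2 x)) + s ^ 2 * ∫ x, ε.1 x * ε.2 x) := fun s => by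
    have s1 := integral_add i0 (i1.const_mul s)
    have s2 := integral_add (i0.add (i1.const_mul s)) (i2.const_mul (s ^ 2))
    simp only [Pi.add_apply] at s2
    rw [momentum, ← integral_const_mul s, ← integral_const_mul (s ^ 2), ← s1, ← s2]
    congr 1
    refine integral_congr_ae (Eventually.of_forall fun x => ?_)
    simp only [Prod.fst_add, Prod.snd_add, Prod.smul_fst, Prod.smul_snd, Pi.add_apply,
      Pi.smul_apply, smul_eq_mul]
    ring
  rw [diagDeriv, iteratedDeriv_one]
  simp only [h]
  have hd := ((((hasDerivAt_id (0 : ℝ)).mul_const (∫ x, (P.1 x * ε.2 x + ε.1 x * P.2 x))).const_add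
    (∫ x, P.1 x * P.2 x)).add (((hasDerivAt_id (0 : ℝ)).pow 2).mul_const
      (∫ x, ε.1 x * ε.2 x))).const_mul (1 / 2 : ℝ)
  refine (hd.congr_deriv ?_).deriv
  simp

lemma IsSoliton.hasDerivAt_coefQ {f : ℝ → ℝ} {c : ℝ} {P : Hydro} (hP : IsSoliton f c P) (x : ℝ) :
    HasDerivAt (fun x => coefQ (jet P x)) (iteratedDeriv 2 P.1 x / (4 * (1 - P.1 x))
      + deriv P.1 x ^ 2 / (4 * (1 - P.1 x) ^ 2)) x := by
  have h1 : 1 - P.1 x ≠ 0 := (sub_pos.2 (hP.mem.2 x)).ne'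
  refine ((hP.hasDerivAt_deriv_eta x).div (((hP.hasDerivAt_eta x).const_sub 1).const_mul 4)
    (mul_ne_zero four_ne_zero h1)).congr_deriv ?_
  field_simp
  ring

/-- The flux of a localised soliton belongs to `H¹`. -/
lemma IsSoliton.memH1_coefQ {f : ℝ → ℝ} {c K a ν : ℝ} {P : Hydro} (hP : IsSoliton f c P)
    (h : SolitonBounds K a ν P) (ha : 0 < a) (hν : 0 < ν) (hK : 0 ≤ K) :
    MemH1 fun x => coefQ (jet P x) := by
  have h1 : ∀ x, 3 / 4 ≤ 1 - P.1 x := fun x => by linarith [h.le_quarter x]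
  have hne : ∀ x, 1 - P.1 x ≠ 0 := fun x => by linarith [h1 x]
  have hd := hP.hasDerivAt_coefQ
  have c0 : Continuous P.1 := hP.smooth_eta.continuous
  have c1 : Continuous (deriv P.1) := hP.smooth_eta.continuous_deriv (by norm_num)
  have c2 : Continuous (iteratedDeriv 2 P.1) := hP.smooth_eta.continuous_iteratedDeriv 2 (by norm_num)
  have cd : Continuous fun x => iteratedDeriv 2 P.1 x / (4 * (1 - P.1 x))
      + deriv P.1 x ^ 2 / (4 * (1 - P.1 x) ^ 2) :=
    (c2.div (by fun_prop) fun x => mul_ne_zero four_ne_zero (hne x)).add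
      ((c1.pow 2).div (by fun_prop) fun x => mul_ne_zero four_ne_zero (pow_ne_zero 2 (hne x)))
  have hderiv : deriv (fun x => coefQ (jet P x)) = fun x =>
      iteratedDeriv 2 P.1 x / (4 * (1 - P.1 x)) + deriv P.1 x ^ 2 / (4 * (1 - P.1 x) ^ 2) :=
    funext fun x => (hd x).deriv
  have e1 : ∀ x, |deriv P.1 x| ≤ K * ν ^ 2 * Real.exp (-(a * ν * |x|)) := fun x => by
    simpa using h.eta 1 (by norm_num) x
  have e2 := h.eta 2 (by norm_num)
  have hexp : ∀ x, Real.exp (-(a * ν * |x|)) ≤ 1 := fun x => by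
    apply Real.exp_le_one_iff.2
    have : 0 ≤ a * ν * |x| := by positivity
    linarith
  have m1 : MemLp (deriv P.1) 2 volume := hP.mem.1.1.memLp_deriv
  have m2 : MemLp (iteratedDeriv 2 P.1) 2 volume := memLp_two_of_le_exp c2 (by positivity) e2
  refine memH1_of_contDiff ?_ ?_ ?_
  · rw [contDiff_one_iff_deriv, hderiv]
    exact ⟨fun x => (hd x).differentiableAt, cd⟩
  · refine m1.of_le (Continuous.aestronglyMeasurable
      (continuous_iff_continuousAt.2 fun x => (hd x).continuousAt)) (Eventually.of_forall fun x => ?_)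
    simp only [coefQ, jet]
    rw [norm_div]
    refine div_le_self (norm_nonneg _) ?_
    rw [Real.norm_of_nonneg (by linarith [h1 x])]
    linarith [h1 x]
  · rw [hderiv]
    refine (m2.norm.add (m1.norm.const_mul (K * ν ^ 2))).of_le cd.aestronglyMeasurable
      (Eventually.of_forall fun x => ?_)
    have hx := h1 x
    have b1 : ‖iteratedDeriv 2 P.1 x / (4 * (1 - P.1 x))‖ ≤ ‖iteratedDeriv 2 P.1 x‖ := by
      rw [norm_div]
      refine div_le_self (norm_nonneg _) ?_
      rw [Real.norm_of_nonneg (by linarith)]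
      linarith
    have b2 : ‖deriv P.1 x ^ 2 / (4 * (1 - P.1 x) ^ 2)‖ ≤ K * ν ^ 2 * ‖deriv P.1 x‖ := by
      rw [norm_div]
      refine (div_le_self (norm_nonneg _) ?_).trans ?_
      · rw [Real.norm_of_nonneg (by positivity)]
        nlinarith
      · rw [norm_pow, pow_two]
        refine mul_le_mul_of_nonneg_right ((e1 x).trans ?_) (norm_nonneg _)
        exact mul_le_of_le_one_right (by positivity) (hexp x)
    have b3 : 0 ≤ ‖iteratedDeriv 2 P.1 x‖ + K * ν ^ 2 * ‖deriv P.1 x‖ := by positivity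
    rw [Pi.add_apply, Real.norm_of_nonneg b3]
    exact (norm_add_le _ _).trans (add_le_add b1 b2)

/-- A soliton of speed `c` is a critical point of `E - c p`. -/
lemma IsSoliton.integral_D1 {f : ℝ → ℝ} {c : ℝ} {P ε : Hydro} (hP : IsSoliton f c P)
    (hQ : MemH1 fun x => coefQ (jet P x))
    (hε : ε ∈ XSpace) (hi : Integrable (D1 f P ε)) : ∫ x, D1 f P ε x = c * diagDeriv 1 momentum P ε := by
  have j1 : Integrable (fun x => coefQ (jet P x) * deriv ε.1 x) :=
    hQ.1.integrable_mul hε.1.memLp_deriv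
  have j2 : Integrable (fun x => deriv (fun x => coefQ (jet P x)) x * ε.1 x) :=
    hQ.memLp_deriv.integrable_mul hε.1.1
  have hibp := hQ.integral_mul_deriv hε.1
  -- Once `coefQ` has been integrated by parts, the integrand is the Euler-Lagrange expression of
  -- `E`, which the travelling wave system identifies with `c` times the density of the differential
  -- of the momentum.
  have hpt : ∀ x, D1 f P ε x - coefQ (jet P x) * deriv ε.1 x
      - deriv (fun x => coefQ (jet P x)) x * ε.1 x =
      c * (1 / 2 * (P.1 x * ε.2 x + ε.1 x * P.2 x)) := fun x => by
    have e1 := dens1_eq (f := f) (jet P x) (ε.1 x) (deriv ε.1 x) (ε.2 x)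
    have e2 : D1 f P ε x = dens1 f (jet P x).1 (jet P x).2.1 (jet P x).2.2
      (ε.1 x) (deriv ε.1 x) (ε.2 x) := rfl
    rw [e2, e1, (hP.hasDerivAt_coefQ x).deriv]
    simp only [coefA, coefW, jet]
    have h1 := hP.eq_one x
    have h2 := hP.eq_two x
    have h3 : 1 - P.1 x ≠ 0 := (sub_pos.2 (hP.mem.2 x)).ne'
    have h4 : f (1 - P.1 x) = c * P.2 x + P.2 x ^ 2
      + iteratedDeriv 2 P.1 x / (2 * (1 - P.1 x)) + deriv P.1 x ^ 2 / (4 * (1 - P.1 x) ^ 2) := by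
      linarith
    have h5 : (1 - P.1 x) * P.2 x = c / 2 * P.1 x := by linarith
    rw [h5, h4]
    field_simp
    ring
  have hsum : (∫ x, D1 f P ε x) - (∫ x, coefQ (jet P x) * deriv ε.1 x)
      - (∫ x, deriv (fun x => coefQ (jet P x)) x * ε.1 x) =
      c * (1 / 2 * ∫ x, (P.1 x * ε.2 x + ε.1 x * P.2 x)) := by
    have s1 := integral_sub hi j1
    have s2 := integral_sub (hi.sub j1) j2
    simp only [Pi.sub_apply] at s2
    rw [← s1, ← s2, ← integral_const_mul, ← integral_const_mul]
    exact integral_congr_ae (Eventually.of_forall hpt)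
  rw [diagDeriv_momentum hP.mem.1 hε, ← hsum, hibp]
  ring

/-! ### Chains of solitons -/

lemma nuMin_le (f : ℝ → ℝ) {N : ℕ} (c : Fin N → ℝ) (k : Fin N) :
    nuMin f c ≤ Real.sqrt (soundSpeed f ^ 2 - c k ^ 2) :=
  ciInf_le (Set.finite_range _).bddBelow k

lemma sqrt_pos_of_mem {f : ℝ → ℝ} {c₀ c : ℝ} (hc₀ : 0 < c₀) (hc : c ∈ Ioo c₀ (soundSpeed f)) :
    0 < Real.sqrt (soundSpeed f ^ 2 - c ^ 2) :=
  Real.sqrt_pos.2 (by nlinarith [hc.1, hc.2])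

lemma nuMin_pos {f : ℝ → ℝ} {c₀ : ℝ} (hc₀ : 0 < c₀) {N : ℕ} (hN : 0 < N) {c : Fin N → ℝ}
    (hc : c ∈ Adm f c₀ N) : 0 < nuMin f c := by
  have : Nonempty (Fin N) := ⟨⟨0, hN⟩⟩
  obtain ⟨k, hk⟩ := exists_eq_ciInf_of_finite (f := fun k => Real.sqrt (soundSpeed f ^ 2 - c k ^ 2))
  rw [nuMin, ← hk]
  exact sqrt_pos_of_mem hc₀ (hc.1 k)

lemma sqrt_sub_sq_le {s c : ℝ} (hs : 0 ≤ s) : Real.sqrt (s ^ 2 - c ^ 2) ≤ s :=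
  Real.sqrt_le_iff.2 ⟨hs, by nlinarith [sq_nonneg c]⟩

lemma jet_translate (a : ℝ) (P : Hydro) (x : ℝ) : jet (translate a P) x = jet P (x - a) := by
  simp only [jet, deriv_translate_fst]
  rfl

lemma SolitonBounds.norm_jet_le {K a ν : ℝ} {P : Hydro} (h : SolitonBounds K a ν P) (x : ℝ) :
    ‖jet P x‖ ≤ K * ν ^ 2 * Real.exp (-(a * ν * |x|)) := by
  rw [norm_prod_le_iff, norm_prod_le_iff]
  refine ⟨?_, ?_, ?_⟩
  · simpa [jet] using h.eta 0 (by norm_num) x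
  · simpa [jet] using h.eta 1 (by norm_num) x
  · simpa [jet] using h.v 0 (by norm_num) x

section Branch

variable {f : ℝ → ℝ} {c₀ K : ℝ} {Q : ℝ → Hydro} {N : ℕ} {c a : Fin N → ℝ} {L : ℝ}

lemma isFamily_chain (hf : Nonlinearity f) (hc₀ : 0 < c₀) (hK : 0 ≤ K)
    (hQ : IsSolitonBranch f c₀ Q) (hb : ∀ c ∈ Ioo c₀ (soundSpeed f),
      SolitonBounds K (1 / 4) (Real.sqrt (soundSpeed f ^ 2 - c ^ 2)) (Q c))
    (hN : 0 < N) (hc : c ∈ Adm f c₀ N) (hL : 0 < L) (ha : a ∈ Pos N L) {β : ℝ} (hβ0 : 0 ≤ β)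
    (hle : ∀ x, (chain Q c a).1 x ≤ β) :
    IsFamily K (soundSpeed f) β (nuMin f c) L (fun k => Real.sqrt (soundSpeed f ^ 2 - c k ^ 2)) a
      (fun k => translate (a k) (Q (c k))) where
  K_nonneg := hK
  β_nonneg := hβ0
  ν_pos := nuMin_pos hc₀ hN hc
  ν_le := nuMin_le f c
  le_s _ := sqrt_sub_sq_le hf.soundSpeed_pos.le
  sep _ _ h := Pos.le_abs_sub hL ha h
  L_pos := hL
  weakX k := weakX_of_mem (translate_mem_XSpace (hQ _ (hc.1 k)).1.mem.1 _)
  diff k x := ((hQ _ (hc.1 k)).1.translate (a k)).hasDerivAt_eta x |>.differentiableAt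
  nonneg k x := ((hb _ (hc.1 k)).pos (x - a k)).le
  bound k x := by
    rw [jet_translate]
    exact (hb _ (hc.1 k)).norm_jet_le _
  le := hle

/-- With `z = ν L / 8`, the inequality `z² exp(-z) ≤ 2` bounds `ν² exp(-z)` by `128 / L²` for all
`ν`. The small amplitude thus compensates for the slow decay near `c_s`, so the separation `L₀` does
not depend on the speeds. -/
lemma far_le {ν y : ℝ} (hK : 0 ≤ K) (hν : 0 < ν) (hL : 0 < L) (hy : L / 2 ≤ |y|) :
    K * ν ^ 2 * Real.exp (-(1 / 4 * ν * |y|)) ≤ 128 * K / L ^ 2 := by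
  set z := ν * L / 8 with hz
  have hz0 : 0 ≤ z := by positivity
  have h1 : Real.exp (-(1 / 4 * ν * |y|)) ≤ Real.exp (-z) := by
    apply Real.exp_le_exp.2
    have := mul_le_mul_of_nonneg_left hy hν.le
    rw [hz]
    linarith
  have h2 : z ^ 2 * Real.exp (-z) ≤ 2 := by
    have h3 := Real.quadratic_le_exp_of_nonneg hz0
    have h4 : z ^ 2 ≤ 2 * Real.exp z := by linarith
    calc z ^ 2 * Real.exp (-z) ≤ 2 * Real.exp z * Real.exp (-z) :=
          mul_le_mul_of_nonneg_right h4 (Real.exp_pos _).le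
      _ = 2 := by rw [mul_assoc, ← Real.exp_add]; simp
  rw [le_div_iff₀ (by positivity)]
  calc K * ν ^ 2 * Real.exp (-(1 / 4 * ν * |y|)) * L ^ 2
      ≤ K * ν ^ 2 * Real.exp (-z) * L ^ 2 := by gcongr
    _ = 64 * K * (z ^ 2 * Real.exp (-z)) := by rw [hz]; ring
    _ ≤ 64 * K * 2 := mul_le_mul_of_nonneg_left h2 (by positivity)
    _ = _ := by ring

lemma chain_fst (x : ℝ) : (chain Q c a).1 x = ∑ k, (Q (c k)).1 (x - a k) :=
  sum_hydro_fst _ _ x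

/-- A chain of well separated solitons does not vanish. -/
lemma chain_le_half (hc₀ : 0 < c₀) (hK : 0 ≤ K) (hb : ∀ c ∈ Ioo c₀ (soundSpeed f),
      SolitonBounds K (1 / 4) (Real.sqrt (soundSpeed f ^ 2 - c ^ 2)) (Q c))
    (hc : c ∈ Adm f c₀ N) (hL : 1 + 512 * K * N ≤ L) (ha : a ∈ Pos N L) (x : ℝ) :
    (chain Q c a).1 x ≤ 1 / 2 := by
  have hKN : 0 ≤ K * N := by positivity
  have hL1 : 1 ≤ L := by linarith
  have hL0 : 0 < L := by linarith
  have hfar : ∀ k, L / 2 ≤ |x - a k| → (Q (c k)).1 (x - a k) ≤ 128 * K / L ^ 2 := fun k hk => by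
    have h1 := (hb _ (hc.1 k)).eta 0 (by norm_num) (x - a k)
    rw [iteratedDeriv_zero] at h1
    exact (le_abs_self _).trans (h1.trans (far_le hK (sqrt_pos_of_mem hc₀ (hc.1 k)) hL0 hk))
  have hsmall : N * (128 * K / L ^ 2) ≤ 1 / 4 := by
    rw [mul_div_assoc', div_le_iff₀ (by positivity)]
    nlinarith
  have h0 : 0 ≤ 128 * K / L ^ 2 := by positivity
  have hset : ∀ t : Finset (Fin N), (∀ k ∈ t, L / 2 ≤ |x - a k|) →
      ∑ k ∈ t, (Q (c k)).1 (x - a k) ≤ 1 / 4 := fun t ht => by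
    calc ∑ k ∈ t, (Q (c k)).1 (x - a k) ≤ ∑ _k ∈ t, 128 * K / L ^ 2 :=
          Finset.sum_le_sum fun k hk => hfar k (ht k hk)
      _ ≤ ∑ _k : Fin N, 128 * K / L ^ 2 :=
          Finset.sum_le_sum_of_subset_of_nonneg (Finset.subset_univ t) fun _ _ _ => h0
      _ = N * (128 * K / L ^ 2) := by simp
      _ ≤ 1 / 4 := hsmall
  rw [chain_fst]
  -- At most one centre lies within `L / 2` of `x`. Its soliton contributes at most `1 / 4`, and all
  -- the others together at most `1 / 4`.
  by_cases hex : ∃ j, |x - a j| < L / 2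
  · obtain ⟨j, hj⟩ := hex
    rw [← Finset.add_sum_erase _ _ (Finset.mem_univ j)]
    have h1 := (hb _ (hc.1 j)).le_quarter (x - a j)
    have h2 := hset (Finset.univ.erase j) fun k hk => by
      have h3 := Pos.le_abs_sub hL0 ha (Finset.ne_of_mem_erase hk)
      have h4 := abs_sub (x - a j) (x - a k)
      have e : x - a j - (x - a k) = a k - a j := by ring
      rw [e] at h4
      linarith
    linarith
  · push Not at hex
    linarith [hset Finset.univ fun k _ => hex k]

/-- The differentials of the energy at the solitons vanish in the orthogonal directions. -/
lemma integral_D1_soliton (hf : Nonlinearity f) (hc₀ : 0 < c₀) (hK : 0 ≤ K)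
    (hQ : IsSolitonBranch f c₀ Q) (hb : ∀ c ∈ Ioo c₀ (soundSpeed f),
      SolitonBounds K (1 / 4) (Real.sqrt (soundSpeed f ^ 2 - c ^ 2)) (Q c)) {c a : ℝ}
    (hc : c ∈ Ioo c₀ (soundSpeed f)) {ε : Hydro} (hε : ε ∈ XSpace)
    (hp : diagDeriv 1 momentum (translate a (Q c)) ε = 0) :
    ∫ x, D1 f (translate a (Q c)) ε x = 0 := by
  have hs := (hQ c hc).1
  have hm := (hs.memH1_coefQ (hb c hc) (by norm_num) (sqrt_pos_of_mem hc₀ hc) hK).comp_sub_const a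
  simp only [← jet_translate] at hm
  have hi := (diagDeriv_energy hf (weakX_of_mem (translate_mem_XSpace hs.mem.1 a))
    (weakX_of_mem hε) (b := 1 / 4) (by norm_num) (by norm_num)
    fun x => (hb c hc).le_quarter (x - a)).1
  rw [(hs.translate a).integral_D1 hm hε hi, hp, mul_zero]

end Branch

/-- The interaction bounds hold without `Λ`; this inequality inserts it into the final estimate. -/
lemma one_le_mul_Lam {f : ℝ → ℝ} {N : ℕ} {c : Fin N → ℝ} {L : ℝ} (hν : 0 < nuMin f c)
    (hνs : nuMin f c ≤ soundSpeed f) (hL : 0 ≤ L) : 1 ≤ soundSpeed f * Lam f L c := by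
  have h1 : 1 / soundSpeed f ≤ Lam f L c := by
    have := one_div_le_one_div_of_le hν hνs
    rw [Lam]
    linarith
  have hs := hν.trans_le hνs
  calc 1 = soundSpeed f * (1 / soundSpeed f) := by field_simp
    _ ≤ _ := mul_le_mul_of_nonneg_left h1 hs.le

end NLSHydro

/-! ### Assembly of the main theorem -/

open NLSHydro
theorem mainTheorem6 (f : ℝ → ℝ) (hf : Nonlinearity f) :
    ∃ (c₀ : ℝ) (Q : ℝ → Hydro) (a_d K_d : ℝ),
      0 < c₀ ∧ c₀ < soundSpeed f ∧ 0 < a_d ∧ 0 < K_d ∧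
      IsSolitonBranch f c₀ Q ∧ HasDecay f c₀ Q a_d K_d ∧
      ∀ N : ℕ, 1 ≤ N →
        (∃ L₀ β₀ : ℝ, 0 < L₀ ∧ β₀ < 1 ∧
          ∀ c ∈ Adm f c₀ N, ∀ L : ℝ, L₀ ≤ L → ∀ a ∈ Pos N L, ∀ x, (chain Q c a).1 x ≤ β₀) ∧
        ∀ β : ℝ, β < 1 → ∃ C : ℝ, 0 < C ∧
          ∀ c ∈ Adm f c₀ N, ∀ L : ℝ, 0 < L → ∀ a ∈ Pos N L,
            (∀ x, (chain Q c a).1 x ≤ β) →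
            ∀ P ∈ perpSet Q c a L, P ∈ NXSpace →
            ∀ τ : ℝ, 0 < τ → 2 * τ < nuMin f c →
            ∀ ε : Hydro, P = chain Q c a + ε →
              |energy f P
                  - (∑ k, energy f (Q (c k))
                    + 1 / 2 * (∑ k, diagDeriv 2 (energy f) (Q (c k)) (epsSol τ L a ε k)
                        + ∑ k, diagDeriv 2 (energy f) 0 (epsGap τ L a ε k))
                    + remainder f (chain Q c a) ε)|
                ≤ C * (Lam f L c * Real.exp (-a_d * nuMin f c * L)
                    + normX ε * Real.sqrt (Lam f L c) * Real.exp (-a_d * nuMin f c * L)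
                    + τ * normX ε ^ 2
                    + normX ε ^ 2 * Real.exp (-(a_d * τ * L / 2))) := by
  obtain ⟨c₀, Q, K, hc₀, hc₀s, hK, hQ, hb⟩ := hf.exists_branch
  have hs := hf.soundSpeed_pos
  refine ⟨c₀, Q, 1 / 8, 12 * (K * (1 + (1 + soundSpeed f) ^ 5)), hc₀, hc₀s, by norm_num,
    by positivity, hQ, hasDecay_of_bounds hc₀ (by norm_num) hb, fun N hN => ⟨?_, ?_⟩⟩
  · exact ⟨1 + 512 * K * N, 1 / 2, by positivity, by norm_num,
      fun c hc L hL a ha x => chain_le_half hc₀ hK.le hb hc hL ha x⟩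
  intro β hβ
  -- The bounds on the densities need a box containing `0`, whereas `β` may be negative.
  have hβ'1 : max β 0 < 1 := max_lt hβ one_pos
  have hβ'0 : 0 ≤ max β 0 := le_max_right _ _
  obtain ⟨C₁, hC₁, h₁⟩ := exists_energy_interaction hf N K (soundSpeed f) (max β 0) hβ'1
  obtain ⟨C₂, hC₂, h₂⟩ := exists_gradient_interaction hf N K (soundSpeed f) (max β 0) hβ'1
  obtain ⟨C₃, hC₃, h₃⟩ := exists_hessian_localisation hf N (s := soundSpeed f) hK.le hβ'0 hβ'1
  refine ⟨C₁ * soundSpeed f + C₂ * Real.sqrt (soundSpeed f) + C₃ + 1, by positivity, ?_⟩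
  intro c hc L hL a ha hle P hP hPN τ hτ hτν ε hPε
  have hfam := isFamily_chain hf hc₀ hK.le hQ hb hN hc hL ha hβ'0
    fun x => (hle x).trans (le_max_left _ _)
  have hν := nuMin_pos hc₀ hN hc
  have hνs : nuMin f c ≤ soundSpeed f :=
    (nuMin_le f c ⟨0, hN⟩).trans (sqrt_sub_sq_le hs.le)
  have hchain : chain Q c a ∈ NLSHydro.XSpace :=
    sum_mem_XSpace (fun k => translate_mem_XSpace (hQ _ (hc.1 k)).1.mem.1 _) _
  have hdiff : P - chain Q c a = ε := by rw [hPε, add_sub_cancel_left]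
  have hε : ε ∈ XSpace := hdiff ▸ sub_mem_XSpace hP.1 hchain
  have hεw := weakX_of_mem hε
  have hperp := hP.2.2
  rw [hdiff] at hperp
  -- The bound `b` depends on `P`, but it serves only to justify Taylor's identity and does not
  -- enter the constant `C`.
  obtain ⟨b, hb1, hPb⟩ := hPN.1.1.exists_upper_bound one_pos hPN.2
  have htaylor := energy_taylor hf (P := chain Q c a) (weakX_of_mem hchain) hεw
    (b := max (max β 0) b) (hβ'0.trans (le_max_left _ _)) (max_lt hβ'1 hb1)
    (fun x => ((hle x).trans (le_max_left _ _)).trans (le_max_left _ _))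
    (fun x => by rw [← hPε]; exact (hPb x).trans (le_max_right _ _))
  have k₁ := h₁ _ _ _ _ _ hfam
  have k₂ := h₂ _ _ _ _ _ hfam ε hεw
  have k₃ := h₃ _ _ τ _ _ _ hfam ha hτ hτν hνs ε hεw
  simp only [energy_translate] at k₁
  -- Each soliton is critical for `E - cₖ p`, and `ε` is orthogonal to the momentum gradients, so
  -- all decoupled gradient terms vanish.
  rw [Finset.sum_eq_zero fun k _ =>
    integral_D1_soliton hf hc₀ hK.le hQ hb (hc.1 k) hε (hperp k).2, sub_zero] at k₂
  simp only [← diagDeriv_epsSol] at k₃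
  change |energy f (chain Q c a) - _| ≤ _ at k₁
  change |∫ x, D1 f (chain Q c a) ε x| ≤ _ at k₂
  change |(∫ x, D2 f (chain Q c a) ε x) - (_ + ∑ k, diagDeriv 2 (energy f) 0 (epsGap τ L a ε k))|
    ≤ _ at k₃
  rw [hPε, htaylor]
  have e₁ : Real.exp (-(1 / 8) * nuMin f c * L) = Real.exp (-(1 / 8 * nuMin f c * L)) := by
    rw [neg_mul, neg_mul]
  -- With `a_d = 1 / 8`, half of the profile rate, both exponents match those of the interaction and
  -- localisation estimates.
  have e₂ : Real.exp (-(1 / 8 * τ * L / 2)) = Real.exp (-(τ * L / 16)) := by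
    congr 1; ring
  rw [e₁, e₂]
  have l₁ := one_le_mul_Lam hν hνs hL.le
  have l₂ : 1 ≤ Real.sqrt (soundSpeed f) * Real.sqrt (Lam f L c) := by
    rw [← Real.sqrt_mul hs.le, Real.one_le_sqrt]; exact l₁
  have hΛ : 0 ≤ Lam f L c := by rw [Lam]; positivity
  have hn := normX_nonneg ε
  set E := Real.exp (-(1 / 8 * nuMin f c * L)) with hE
  set T := Real.exp (-(τ * L / 16)) with hT
  have hE0 : 0 < E := Real.exp_pos _
  have hT0 : 0 < T := Real.exp_pos _
  set n := normX ε with hn'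
  have m₁ : C₁ * E ≤ C₁ * soundSpeed f * (Lam f L c * E) := by
    have := mul_le_mul_of_nonneg_left l₁ (mul_nonneg hC₁ hE0.le)
    linarith
  have m₂ : C₂ * E * n ≤ C₂ * Real.sqrt (soundSpeed f) * (n * Real.sqrt (Lam f L c) * E) := by
    have := mul_le_mul_of_nonneg_left l₂ (mul_nonneg (mul_nonneg hC₂ hE0.le) hn)
    linarith
  set A := Lam f L c * E with hA
  set B := n * Real.sqrt (Lam f L c) * E with hB
  have hA0 : 0 ≤ A := by positivity
  have hB0 : 0 ≤ B := by positivity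
  have hτn : 0 ≤ τ * n ^ 2 := by positivity
  have hTn : 0 ≤ n ^ 2 * T := by positivity
  rw [abs_le] at k₁ k₂ k₃
  have hs' := Real.sqrt_nonneg (soundSpeed f)
  have p₁ : 0 ≤ C₁ * soundSpeed f := by positivity
  have p₂ : 0 ≤ C₂ * Real.sqrt (soundSpeed f) := by positivity
  set S := A + B + τ * n ^ 2 + n ^ 2 * T with hS
  have b₁ : C₁ * soundSpeed f * A ≤ C₁ * soundSpeed f * S :=
    mul_le_mul_of_nonneg_left (by linarith) p₁
  have b₂ : C₂ * Real.sqrt (soundSpeed f) * B ≤ C₂ * Real.sqrt (soundSpeed f) * S :=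
    mul_le_mul_of_nonneg_left (by linarith) p₂
  have b₃ : C₃ * (T + τ) * n ^ 2 ≤ C₃ * S := by
    have := mul_le_mul_of_nonneg_left (a := C₃) (b := τ * n ^ 2 + n ^ 2 * T) (c := S)
      (by linarith) hC₃
    linarith
  have hS0 : 0 ≤ S := by positivity
  have b₄ : 0 ≤ C₃ * S := by positivity
  rw [abs_le]
  constructor <;> linarith [k₁.1, k₁.2, k₂.1, k₂.2, k₃.1, k₃.2]
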